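/- For a finite simple graph $G$ let $\alpha(G)$ be its independence number, let $\mathrm{VCdim}(G)$ be the VC-dimension of the hypergraph $(V(G),\{N(v): v\in V(G)\})$ of open neighbourhoods, and let $\mathrm{iocp}(G)$ be the maximum number of pairwise vertex-disjoint odd cycles of $G$ with no edge of $G$ between any two of them. For $d,i\in\mathbb N$ and $\beta>0$ let $\mathcal X(d,\beta,i)$ be the class of graphs $G$ with $\mathrm{VCdim}(G)\le d$, $\alpha(G)\ge\beta|V(G)|$ and $\mathrm{iocp}(G)\le i$. Theorem. Fix constants $d\in\mathbb N$ and $0<\beta\le 1$. (1) For every constant $\eta>0$ there is a randomized algorithm that, for every $0<\varepsilon<1$ and every graph $G\in\mathcal X(d,\beta,1)$ on $n$ vertices, given $G$ and $\varepsilon$, runs in time $2^{\tilde O(1/\varepsilon^3)}n^{O(1)}$, always outputs an independent set of $G$, and outputs one of size at least $(1-\varepsilon)\alpha(G)$ with probability at least $1-\eta$. (2) There is a deterministic algorithm (a PTAS for Maximum Independent Set on $\mathcal X(d,\beta,1)$) that, for every $0<\varepsilon<1$ and every graph $G\in\mathcal X(d,\beta,1)$ on $n$ vertices, given $G$ and $\varepsilon$,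 runs in time $n^{\tilde O(1/\varepsilon^3)}$ and outputs an independent set of $G$ of size at least $(1-\varepsilon)\alpha(G)$. Here $\tilde O(1/\varepsilon^3)$ stands for a quantity bounded by $C\,\varepsilon^{-3}(1+\log(1/\varepsilon))^{k}$ for all $0<\varepsilon<1$; $C$, $k$ and the exponent hidden in $n^{O(1)}$ depend only on $d$ and $\beta$ (and on $\eta$ in (1)). In the running times $n$ is read as $\max(n,2)$. Time is the worst-case number of steps of a random access machine with unit-cost addition, truncated subtraction, comparison with zero, indirect addressing and, in (1), fair coin flips. The input consists of the number of vertices, the adjacency matrix, and two positive integers $p,q$ with $\varepsilon/2\le p/q\le\varepsilon$ which encode the accuracy ($p/q=\varepsilon$ is possible whenever $\varepsilon$ is rational). -/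

import Mathlib

/-! ### The graph class `X(d, β, i)` -/

namespace SimpleGraph

open Classical in
/-- The VC-dimension of a graph: the VC-dimension of its (open) neighbourhood hypergraph,
whose vertices are the vertices of `G` and whose hyperedges are the sets `N(v)`. -/
noncomputable def nbhdVCDim {V : Type*} [Fintype V] [DecidableEq V] (G : SimpleGraph V) : ℕ :=
  (Finset.univ.image fun v : V => G.neighborFinset v).vcDim

/-- `G` contains `k` pairwise vertex-disjoint odd cycles with no edge between any two of them. -/
def HasInducedOddCyclePacking {V : Type*} (G : SimpleGraph V) (k : ℕ) : Prop :=
  ∃ (v : Fin k → V) (c : ∀ i, G.Walk (v i) (v i)),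
    (∀ i, (c i).IsCycle ∧ Odd (c i).length) ∧
    ∀ i j, i ≠ j → ∀ x ∈ (c i).support, ∀ y ∈ (c j).support, x ≠ y ∧ ¬ G.Adj x y

/-- The induced odd cycle packing number (the maximum, for a finite graph). -/
noncomputable def iocp {V : Type*} (G : SimpleGraph V) : ℕ :=
  sSup {k | G.HasInducedOddCyclePacking k}

/-- Membership of a finite graph in the class `X(d, β, i)`. -/
def InClassX {V : Type*} [Fintype V] [DecidableEq V] (G : SimpleGraph V)
    (d : ℕ) (β : ℝ) (i : ℕ) : Prop :=
  G.nbhdVCDim ≤ d ∧ β * (Fintype.card V : ℝ) ≤ (G.indepNum : ℝ) ∧ G.iocp ≤ i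

end SimpleGraph

/-! ### A random access machine

A program acts on natural-number registers and on finitely many memory banks with indirect
addressing. The only arithmetic operations are addition and truncated subtraction, so the bit
length of the stored numbers grows by at most a constant per step, and unit cost per instruction
is polynomially equivalent to Turing machine time. -/

namespace RAM

/-- The data of the machine: registers, memory banks (bank, address), and the random bits that
have not been read yet. -/
structure Store where
  reg : ℕ → ℕ
  mem : ℕ → ℕ → ℕ
  coins : List Bool

/-- Expressions. A program holds finitely many of them, each of constant size. -/
inductive Expr where
  /-- a constant -/
  | lit (c : ℕ)
  /-- the content of register `x` -/
  | reg (x : ℕ)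
  /-- the content of bank `a` at the address given by an expression -/
  | load (a : ℕ) (addr : Expr)
  /-- sum -/
  | add (e₁ e₂ : Expr)
  /-- truncated difference -/
  | sub (e₁ e₂ : Expr)

/-- The value of an expression. -/
def Expr.eval (s : Store) : Expr → ℕ
  | .lit c => c
  | .reg x => s.reg x
  | .load a e => s.mem a (e.eval s)
  | .add e₁ e₂ => e₁.eval s + e₂.eval s
  | .sub e₁ e₂ => e₁.eval s - e₂.eval s

/-- Programs. -/
inductive Cmd where
  /-- do nothing -/
  | skip
  /-- put the value of `e` into register `x` -/
  | assign (x : ℕ) (e : Expr)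
  /-- put the value of `e` into bank `a` at address `addr` -/
  | store (a : ℕ) (addr e : Expr)
  /-- put a fresh random bit into register `x` -/
  | flip (x : ℕ)
  /-- sequential composition -/
  | seq (P Q : Cmd)
  /-- run `P` if the value of `e` is nonzero, and `Q` otherwise -/
  | ite (e : Expr) (P Q : Cmd)
  /-- run `P` as long as the value of `e` is nonzero -/
  | loop (e : Expr) (P : Cmd)

/-- Programs without coin flips. -/
def Cmd.CoinFree : Cmd → Prop
  | .skip => True
  | .assign _ _ => True
  | .store _ _ _ => True
  | .flip _ => False
  | .seq P Q => P.CoinFree ∧ Q.CoinFree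
  | .ite _ P Q => P.CoinFree ∧ Q.CoinFree
  | .loop _ P => P.CoinFree

/-- A configuration: the commands still to be executed, in this order, and the data. -/
structure Config where
  todo : List Cmd
  data : Store

/-- One step of the machine. A configuration with nothing left to do has halted and does not
change any more; a coin flip when no random bit is left blocks the machine for ever. -/
def step : Config → Config
  | ⟨[], s⟩ => ⟨[], s⟩
  | ⟨.skip :: K, s⟩ => ⟨K, s⟩
  | ⟨.assign x e :: K, s⟩ => ⟨K, { s with reg := Function.update s.reg x (e.eval s) }⟩
  | ⟨.store a i e :: K, s⟩ =>
      ⟨K, { s with mem := Function.update s.mem a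
                            (Function.update (s.mem a) (i.eval s) (e.eval s)) }⟩
  | ⟨.flip x :: K, s⟩ =>
      match s.coins with
      | [] => ⟨.flip x :: K, s⟩
      | b :: bs => ⟨K, { s with reg := Function.update s.reg x b.toNat, coins := bs }⟩
  | ⟨.seq P Q :: K, s⟩ => ⟨P :: Q :: K, s⟩
  | ⟨.ite e P Q :: K, s⟩ => ⟨(if e.eval s ≠ 0 then P else Q) :: K, s⟩
  | ⟨.loop e P :: K, s⟩ => ⟨if e.eval s ≠ 0 then P :: .loop e P :: K else K, s⟩

/-- The configuration reached from the data `s` after `t` steps of the program `P`. -/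
def Cmd.run (P : Cmd) (s : Store) (t : ℕ) : Config :=
  step^[t] ⟨[P], s⟩

/-- The program has halted. -/
def Config.Halted (c : Config) : Prop := c.todo = []

open Classical in
/-- The input: the number `n` of vertices in register 0, an accuracy parameter `p / q` in
registers 1 and 2, the adjacency matrix of `G` row by row in bank 0, and a string of random
bits. All other registers and memory cells hold 0. -/
noncomputable def input {n : ℕ} (G : SimpleGraph (Fin n)) (p q : ℕ) (coins : List Bool) :
    Store where
  reg x := if x = 0 then n else if x = 1 then p else if x = 2 then q else 0
  mem a addr :=
    if a = 0 ∧ ∃ i j : Fin n, addr = (i : ℕ) * n + (j : ℕ) ∧ G.Adj i j then 1 else 0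
  coins := coins

/-- The output: the vertex set whose characteristic vector stands in bank 1. -/
def Config.output (c : Config) (n : ℕ) : Finset (Fin n) :=
  Finset.univ.filter fun v : Fin n => c.data.mem 1 (v : ℕ) ≠ 0

end RAM

/-- The function `C · (1/ε)³ · (1 + log (1/ε))ᵏ` of `0 < ε < 1`: a function of `ε` is `Õ(1/ε³)` when
it is bounded by one of these, with constants `C` and `k`. -/
noncomputable def softCube (C : ℝ) (k : ℕ) (ε : ℝ) : ℝ :=
  C * (1 / ε) ^ 3 * (1 + Real.log (1 / ε)) ^ k

/-! Let `S` be a maximum independent set and let `e` be about `1/ε`. The core is a structural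
statement, `exists_good_layers`. Suppose that a vertex set `W` contains `S` and that no vertex of
`W` has more than `|S|/(12e²)` neighbours in `S`. Take a shortest odd cycle `C` of `G[W]`, of length
`2t+1`, and a vertex `r` on it. Two odd closed walks of `G` always touch (`odd_walks_touch`), so the
vertices at distance more than `j ≥ 1` from `C` span a bipartite graph. Inside the tube of radius
`j` around `C` there may be odd cycles, but they have to run around with `C`, and a layer around `r`
cuts them; minimality of `C` yields an explicit 2-colouring of what is left
(`exists_bicoloring_off_layers`). If `t ≥ 6e`, there are `2e` candidates for either layer, and
averaging finds two that together contain at most `|S|/e` vertices of `S`. If `t < 6e`, it suffices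
to delete `r` and the vertices at distance one from `C`; all of them are neighbours of the fewer
than `12e` vertices of `C`, so again at most `|S|/e` vertices of `S` are lost.

Such a `W` comes from an ε-net. Since `|S| ≥ βn`, a vertex with more than `|S|/(12e²)` neighbours in
`S` has a neighbourhood in `S` of density of order `β/e²`. Bounded VC-dimension makes a random
sample of `M` vertices hit all these neighbourhoods with large probability (`card_non_nets_le`, by
double sampling and the Sauer-Shelah bound). Order `e² log e` samples would do; `M = c e³` is used,
which absorbs the logarithm. Having guessed which members of the sample lie in `S`, one deletes
their neighbours: nothing of `S` is lost because `S` is independent, and every vertex with too many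
neighbours in `S` disappears.

The bipartite remainder is solved through its bipartite double cover. An auction computes the vertex
cover number of the double cover (`IsAuction.isCoverNumber`), and vertices are dropped as long as
this changes the number (`IsReduction`). Cover number zero certifies independence for any graph, so
wrong guesses do no harm: the search goes through all parts of the sample, all triples of vertices
that may span a shortest odd cycle and all pairs of layers, and keeps the largest certified set. The
cost is `2^M` times a polynomial in `n` and `e` for one random sample. The deterministic version
goes through all `n^M` samples, one of which is good.

The algorithms are written as structured programs whose effect is a function on stores and whose
cost is bounded by size and loop depth; `exec_compile` and `cost_le` carry this over to the machine.
-/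

namespace SimpleGraph

/-! ### Odd closed walks, odd cycles and 2-colourings. -/

section OddWalks

variable {V : Type*} {G : SimpleGraph V}

/-- A walk which is not a path contains a nonempty closed walk. -/
lemma Walk.exists_closed_of_not_isPath {u v : V} (p : G.Walk u v) (hp : ¬ p.IsPath) :
    ∃ (w : V) (a : G.Walk u w) (c : G.Walk w w) (b : G.Walk w v),
      p = a.append (c.append b) ∧ 0 < c.length := by
  classical
  induction p with
  | nil => simp at hp
  | @cons u v' w h q ih =>
    by_cases hq : q.IsPath
    · have hu : u ∈ q.support := by
        by_contra hu
        exact hp ((Walk.cons_isPath_iff h q).2 ⟨hq, hu⟩)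
      refine ⟨u, .nil, .cons h (q.takeUntil u hu), q.dropUntil u hu, ?_, by simp⟩
      simp
    · obtain ⟨z, a, c, b, hqe, hc⟩ := ih hq
      exact ⟨z, .cons h a, c, b, by simp [hqe], hc⟩

/-- Every odd closed walk contains an odd cycle. -/
lemma Walk.exists_odd_isCycle {u : V} (p : G.Walk u u) (hp : Odd p.length) :
    ∃ (w : V) (c : G.Walk w w), c.IsCycle ∧ Odd c.length ∧ c.support ⊆ p.support := by
  induction hn : p.length using Nat.strong_induction_on generalizing u with
  | _ n ih =>
    cases p with
    | nil => simp at hp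
    | @cons _ v _ h q =>
      by_cases hq : q.IsPath
      · refine ⟨u, .cons h q, ?_, hp, fun _ => id⟩
        rw [Walk.cons_isCycle_iff]
        refine ⟨hq, fun he => ?_⟩
        -- The cycle condition fails only if the path `q` uses the edge `h`. Its start `v` occurs
        -- once, so `h` is its first edge, after which it has arrived at its end `u`. The closed
        -- walk then has length 2, which is even.
        have : q.length = 1 := by
          cases q with
          | nil => simp at he
          | @cons _ z _ h' q' =>
            rw [Walk.cons_isPath_iff] at hq
            rw [Walk.edges_cons, List.mem_cons] at he
            rcases he with he | he
            · have hz : u = z := by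
                rcases Sym2.eq_iff.1 he with ⟨h1, h2⟩ | ⟨h1, _⟩
                · exact absurd h1 h.ne
                · exact h1
              subst hz
              have := Walk.length_eq_zero_iff.2 (Walk.isPath_iff_nil.1 hq.1)
              simp [this]
            · exact absurd (Walk.snd_mem_support_of_mem_edges _ he) hq.2
        rw [Walk.length_cons, this] at hp
        exact absurd hp (by decide)
      · obtain ⟨z, a, c, b, hqe, hc⟩ := q.exists_closed_of_not_isPath hq
        subst hqe
        simp only [Walk.length_cons, Walk.length_append] at hp hn
        -- The walk splits into the closed walk `c` and the closed walk that skips `c`. Their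
        -- lengths add up to an odd number, so one of the two is odd, and both are shorter.
        by_cases hodd : Odd c.length
        · obtain ⟨w, c', h1, h2, h3⟩ := ih c.length (by omega) c hodd rfl
          refine ⟨w, c', h1, h2, fun x hx => ?_⟩
          have := h3 hx
          simp [Walk.mem_support_append_iff, this]
        · have hodd' : Odd (Walk.cons h (a.append b)).length := by
            simp only [Walk.length_cons, Walk.length_append]
            grind
          obtain ⟨w, c', h1, h2, h3⟩ := ih _ (by simp; omega) _ hodd' rfl
          refine ⟨w, c', h1, h2, fun x hx => ?_⟩
          have := h3 hx
          simp only [Walk.support_cons, List.mem_cons, Walk.mem_support_append_iff] at this ⊢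
          tauto

/-- A graph without odd closed walks is 2-colourable. -/
lemma exists_bicoloring (h : ∀ (u : V) (p : G.Walk u u), ¬ Odd p.length) :
    ∃ χ : V → Bool, ∀ u v, G.Adj u v → χ u ≠ χ v := by
  classical
  -- One base point per component; a vertex is coloured by the parity of a fixed walk from the base
  -- point. A monochromatic edge would close up two such walks to an odd closed walk.
  let rep : V → V := fun v => (G.connectedComponentMk v).out
  have hrep : ∀ v, G.Reachable (rep v) v := fun v =>
    ConnectedComponent.exact (Quot.out_eq (G.connectedComponentMk v))
  choose P hP using fun v => (hrep v).exists_walk_length_eq_dist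
  refine ⟨fun v => decide (Odd (P v).length), fun u v huv hχ => ?_⟩
  have hr : rep u = rep v := by
    have : G.connectedComponentMk u = G.connectedComponentMk v :=
      ConnectedComponent.sound huv.reachable
    simp only [rep, this]
  have hc := h _ (((P u).append (.cons huv (P v).reverse)).copy rfl hr.symm)
  rw [decide_eq_decide] at hχ
  simp only [Walk.length_copy, Walk.length_append, Walk.length_cons, Walk.length_reverse] at hc
  grind

/-- The subgraph of `G` spanned by the vertices in `R`, the other vertices being isolated. -/
def restrictTo (G : SimpleGraph V) (R : Set V) : SimpleGraph V where
  Adj u v := G.Adj u v ∧ u ∈ R ∧ v ∈ R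
  symm := ⟨fun _ _ h => ⟨h.1.symm, h.2.2, h.2.1⟩⟩
  loopless := ⟨fun _ h => h.1.ne rfl⟩

lemma restrictTo_le (R : Set V) : G.restrictTo R ≤ G := fun _ _ h => h.1

/-- Every vertex of a nontrivial walk is an end of an edge. The trivial walk is excluded because
vertices outside `R` are kept as isolated vertices. -/
lemma Walk.mem_of_restrictTo {R : Set V} {u v : V} (p : (G.restrictTo R).Walk u v)
    (hp : 0 < p.length) : ∀ x ∈ p.support, x ∈ R := by
  induction p with
  | nil => simp at hp
  | cons h q ih =>
    intro x hx
    rw [Walk.support_cons, List.mem_cons] at hx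
    rcases hx with rfl | hx
    · exact h.2.1
    · cases q with
      | nil => simp at hx; subst hx; exact h.2.2
      | cons h' q' => exact ih (by simp) x hx

/-- `sSup` of an unbounded set of naturals is 0, so the bound on `iocp` has content only once
packings are known to be bounded: the base points of the cycles of a packing are distinct. -/
lemma not_hasInducedOddCyclePacking_two [Finite V] (h : G.iocp ≤ 1) :
    ¬ G.HasInducedOddCyclePacking 2 := by
  intro h2
  have hb : BddAbove {k | G.HasInducedOddCyclePacking k} := by
    refine ⟨Nat.card V, ?_⟩
    rintro k ⟨v, c, -, hc⟩
    have hinj : Function.Injective v := by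
      intro i j hij
      by_contra hne
      exact (hc i j hne (v i) (c i).start_mem_support (v j) (c j).start_mem_support).1 hij
    simpa using Nat.card_le_card_of_injective v hinj
  have := le_csSup hb h2
  unfold iocp at h
  omega

/-- With induced odd cycle packing number at most one, two odd closed walks touch each other. -/
lemma odd_walks_touch [Finite V] (h : G.iocp ≤ 1) {u v : V} (p : G.Walk u u) (q : G.Walk v v)
    (hp : Odd p.length) (hq : Odd q.length) :
    ∃ x ∈ p.support, ∃ y ∈ q.support, x = y ∨ G.Adj x y := by
  by_contra! hno
  obtain ⟨u', p', hp1, hp2, hp3⟩ := p.exists_odd_isCycle hp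
  obtain ⟨v', q', hq1, hq2, hq3⟩ := q.exists_odd_isCycle hq
  refine not_hasInducedOddCyclePacking_two h
    ⟨![u', v'], fun i => match i with | 0 => p' | 1 => q', ?_, ?_⟩
  · intro i
    match i with
    | 0 => exact ⟨hp1, hp2⟩
    | 1 => exact ⟨hq1, hq2⟩
  · intro i j hij x hx y hy
    fin_cases i <;> fin_cases j
    · exact absurd rfl hij
    · exact hno x (hp3 hx) y (hq3 hy)
    · have := hno y (hp3 hy) x (hq3 hx)
      exact ⟨this.1.symm, fun h => this.2 h.symm⟩
    · exact absurd rfl hij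

end OddWalks

end SimpleGraph


namespace SimpleGraph

/-! ### Distance layers around a shortest odd cycle. -/

section Layers

variable {V : Type*} {G H : SimpleGraph V}

/-- `d` is the distance from the set `K`, with the value `I` or more for vertices out of reach. -/
structure IsLevel (H : SimpleGraph V) (I : ℕ) (K : Set V) (d : V → ℕ) : Prop where
  zero : ∀ v ∈ K, d v = 0
  step : ∀ u v, H.Adj u v → d v ≤ d u + 1
  walk : ∀ v, d v < I → ∃ k ∈ K, ∃ p : H.Walk k v, p.length = d v

lemma IsLevel.le_add_length {I : ℕ} {K : Set V} {d : V → ℕ} (hd : H.IsLevel I K d) {u v : V}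
    (p : H.Walk u v) : d v ≤ d u + p.length := by
  induction p with
  | nil => simp
  | cons h q ih =>
    have := hd.step _ _ h
    simp only [Walk.length_cons]
    omega

/-- The set `K` consists of the vertices of two shortest paths, from `r` to `x` and to `y`. -/
def IsFork (H : SimpleGraph V) (I : ℕ) (d : V → ℕ) (r x y : V) (K : Set V) : Prop :=
  d x < I → d y < I → ∃ (p : H.Walk r x) (q : H.Walk r y),
    p.length = d x ∧ q.length = d y ∧ ∀ v, v ∈ K ↔ v ∈ p.support ∨ v ∈ q.support

/-- A shortest odd closed walk, cut at an edge opposite to its base point. -/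
lemma exists_shortest_odd [Finite V] (h : ¬ ∀ (u : V) (p : H.Walk u u), ¬ Odd p.length) :
    ∃ (t : ℕ) (r x y : V) (p : H.Walk r x) (q : H.Walk r y), p.length = t ∧ q.length = t ∧
      H.Adj x y ∧ 0 < t ∧ t < Nat.card V ∧
      ∀ (u : V) (p : H.Walk u u), Odd p.length → 2 * t + 1 ≤ p.length := by
  classical
  have := Fintype.ofFinite V
  let Q : ℕ → Prop := fun m => ∃ (u : V) (p : H.Walk u u), Odd p.length ∧ p.length = m
  have hQ : ∃ m, Q m := by
    push Not at h
    obtain ⟨u, p, hp⟩ := h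
    exact ⟨_, u, p, hp, rfl⟩
  obtain ⟨r, c, hodd, hlen⟩ := Nat.find_spec hQ
  have hmin : ∀ (u : V) (p : H.Walk u u), Odd p.length → c.length ≤ p.length := fun u p hp => by
    rw [hlen]; exact Nat.find_min' hQ ⟨u, p, hp, rfl⟩
  obtain ⟨t, ht⟩ := hodd
  have hadj : H.Adj (c.getVert t) (c.getVert (t + 1)) := c.adj_getVert_succ (by omega)
  refine ⟨t, r, c.getVert t, c.getVert (t + 1), c.take t, (c.drop (t + 1)).reverse, ?_, ?_, hadj,
    ?_, ?_, fun u p hp => ht ▸ hmin u p hp⟩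
  · rw [Walk.take_length]; omega
  · rw [Walk.length_reverse, Walk.drop_length]; omega
  · by_contra h0
    have h0 : t = 0 := by omega
    subst h0
    have h1 : c.getVert 1 = r := by
      have := c.getVert_length
      rwa [ht] at this
    simp [h1] at hadj
  -- The odd cycle inside `c` is at least as long as `c` by minimality, and it has at most `|V|`
  -- vertices.
  · obtain ⟨w, c', h1, h2, -⟩ := c.exists_odd_isCycle ⟨t, ht⟩
    have h3 := hmin w c' h2
    have h4 := h1.support_nodup.length_le_card
    rw [List.length_tail, Walk.length_support, ← Nat.card_eq_fintype_card] at h4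
    omega

/-- A shorter walk from `r` to `x` could be closed up either along `p` or along the edge `x y` and
`q`. These two closed walks differ in length by one, so one of them is odd, and both would be
shorter than `2t+1`. Hence shortest odd closed walks consist of shortest paths from `r`. -/
lemma IsLevel.eq_of_shortest_odd {I t : ℕ} {r x y : V} {d : V → ℕ} (hd : H.IsLevel I {r} d)
    (p : H.Walk r x) (q : H.Walk r y) (hp : p.length = t) (hq : q.length = t) (hxy : H.Adj x y)
    (ht : t < I) (hmin : ∀ (u : V) (p : H.Walk u u), Odd p.length → 2 * t + 1 ≤ p.length) :
    d x = t := by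
  have hr : d r = 0 := hd.zero r rfl
  have hle := hd.le_add_length p
  obtain ⟨_, rfl, p', hp'⟩ := hd.walk x (by omega)
  have h1 := hmin _ (p'.append p.reverse)
  have h2 := hmin _ (p'.append (.cons hxy q.reverse))
  simp only [Walk.length_append, Walk.length_cons, Walk.length_reverse] at h1 h2
  by_contra hne
  have h3 : d x < t := by omega
  rcases Nat.even_or_odd (p'.length + p.length) with h4 | h4
  · have := h2 (by rw [hq, ← hp]; grind)
    omega
  · have := h1 h4
    omega

/-- A vertex near the fork hangs on one of its two branches: `b` tells the branch, `i` and `l`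
are the lengths of the parts of the branch before and after the foot. -/
lemma exists_branch {I j t : ℕ} {r x y : V} {d₂ : V → ℕ} {K : Set V} (hK : H.IsLevel I K d₂)
    (p : H.Walk r x) (q : H.Walk r y) (hp : p.length = t) (hq : q.length = t)
    (hKs : ∀ v, v ∈ K ↔ v ∈ p.support ∨ v ∈ q.support) (hj : j ≤ I) (v : V) (hv : d₂ v < j) :
    ∃ (b : Bool) (i l : ℕ), i + l = t ∧ (∃ a : H.Walk r v, a.length = i + d₂ v) ∧
      ((b = false ∧ ∃ a : H.Walk x v, a.length = l + d₂ v) ∨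
        (b = true ∧ ∃ a : H.Walk y v, a.length = l + d₂ v)) := by
  classical
  obtain ⟨k, hk, w, hw⟩ := hK.walk v (by omega)
  rcases (hKs k).1 hk with hk | hk
  · refine ⟨false, (p.takeUntil k hk).length, (p.dropUntil k hk).length, ?_, ?_, ?_⟩
    · rw [← Walk.length_append, Walk.take_spec, hp]
    · exact ⟨(p.takeUntil k hk).append w, by simp [hw]⟩
    · exact .inl ⟨rfl, (p.dropUntil k hk).reverse.append w, by simp [hw]⟩
  · refine ⟨true, (q.takeUntil k hk).length, (q.dropUntil k hk).length, ?_, ?_, ?_⟩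
    · rw [← Walk.length_append, Walk.take_spec, hq]
    · exact ⟨(q.takeUntil k hk).append w, by simp [hw]⟩
    · exact .inr ⟨rfl, (q.dropUntil k hk).reverse.append w, by simp [hw]⟩

/-- Deleting the layer `a` around the base point and the layer `j` around a shortest odd closed
walk destroys all odd cycles. -/
lemma exists_bicoloring_off_layers [Finite V] {W : Set V} (hG : G.iocp ≤ 1) {I t j a : ℕ}
    {r x y : V} {d₁ d₂ : V → ℕ} {K : Set V} (h₁ : (G.restrictTo W).IsLevel I {r} d₁)
    (h₂ : (G.restrictTo W).IsLevel I K d₂)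
    (p : (G.restrictTo W).Walk r x) (q : (G.restrictTo W).Walk r y)
    (hp : p.length = t) (hq : q.length = t)
    (hK : ∀ v, v ∈ K ↔ v ∈ p.support ∨ v ∈ q.support) (hxy : (G.restrictTo W).Adj x y)
    (hmin : ∀ (u : V) (p : (G.restrictTo W).Walk u u), Odd p.length → 2 * t + 1 ≤ p.length)
    (hjI : j ≤ I) (haI : a ≤ I) (hj : 1 ≤ j) (hjt : 2 * j ≤ t + 1) (hja : 2 * j ≤ a + 2)
    (hat : a ≤ t) :
    ∃ χ : V → Bool, ∀ u v, u ∈ {z ∈ W | d₁ z ≠ a ∧ d₂ z ≠ j} →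
      v ∈ {z ∈ W | d₁ z ≠ a ∧ d₂ z ≠ j} → G.Adj u v → χ u ≠ χ v := by
  classical
  have hr : d₁ r = 0 := h₁.zero r rfl
  let F : Set V := {v | j < d₂ v}
  -- An odd closed walk at distance more than `j ≥ 1` from `K` neither meets nor is adjacent to the
  -- odd closed walk formed by the two branches and the edge `x y`.
  have hfar : ∀ (u : V) (c : ((G.restrictTo W).restrictTo F).Walk u u), ¬ Odd c.length := by
    intro u c hc
    have hC : Odd ((p.append (.cons hxy q.reverse)).mapLe (restrictTo_le W)).length := by
      simp [hp, hq]
    obtain ⟨z, hz, w, hw, hzw⟩ := odd_walks_touch hG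
      ((p.append (.cons hxy q.reverse)).mapLe (restrictTo_le W))
      ((c.mapLe (restrictTo_le F)).mapLe (restrictTo_le W)) hC
      (by rw [Walk.mapLe, Walk.length_map, Walk.mapLe, Walk.length_map]; exact hc)
    rw [Walk.support_mapLe_eq_support] at hz hw
    rw [Walk.support_mapLe_eq_support] at hw
    have hzK : z ∈ K := by
      rw [hK]
      simp only [Walk.mem_support_append_iff, Walk.support_cons, List.mem_cons,
        Walk.support_reverse, List.mem_reverse] at hz
      rcases hz with hz | rfl | hz
      · exact .inl hz
      · exact .inl p.end_mem_support
      · exact .inr hz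
    have hz0 : d₂ z = 0 := h₂.zero z hzK
    have hwF : w ∈ F := c.mem_of_restrictTo hc.pos w hw
    have hwW : w ∈ W := (c.mapLe (restrictTo_le F)).mem_of_restrictTo (by simpa using hc.pos) w
      (by rwa [Walk.support_mapLe_eq_support])
    have hzW : z ∈ W := (p.append (.cons hxy q.reverse)).mem_of_restrictTo (by simp) z hz
    have hwF : j < d₂ w := hwF
    rcases hzw with rfl | hzw
    · omega
    · have := h₂.step z w ⟨hzw, hzW, hwW⟩
      omega
  obtain ⟨χ, hχ⟩ := exists_bicoloring hfar
  have hbr := exists_branch h₂ p q hp hq hK hjI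
  choose! b i l hil hA hB using hbr
  -- The deleted layers separate three regions. The outside is coloured by `χ`, the surroundings of
  -- `r` by the parity of `d₁`. The rest of the tube is coloured by the parity of the walk from `r`
  -- along the branch, with colours exchanged on one of the two branches. The exchange makes the
  -- edge `x y` bichromatic and shifts the parity defect of the odd cycle to `r`, where the layer
  -- `a` hides it.
  refine ⟨fun v => if j < d₂ v then χ v else if d₁ v < a then decide (Odd (d₁ v)) else
    (b v).xor (decide (Odd (d₂ v + i v))), fun u v hu hv huv => ?_⟩
  obtain ⟨huW, hua, huj⟩ := hu
  obtain ⟨hvW, hva, hvj⟩ := hv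
  have hH : (G.restrictTo W).Adj u v := ⟨huv, huW, hvW⟩
  have s1 := h₁.step _ _ hH
  have s2 := h₁.step _ _ hH.symm
  have s3 := h₂.step _ _ hH
  have s4 := h₂.step _ _ hH.symm
  by_cases hu2 : j < d₂ u
  · have hv2 : j < d₂ v := by omega
    simp only [hu2, hv2, if_true]
    exact hχ u v ⟨hH, hu2, hv2⟩
  have hv2 : ¬ j < d₂ v := by omega
  have hu3 : d₂ u < j := by omega
  have hv3 : d₂ v < j := by omega
  by_cases hu1 : d₁ u < a
  · have hv1 : d₁ v < a := by omega
    simp only [hu2, hv2, hu1, hv1, if_true, if_false]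
    obtain ⟨_, rfl, pu, hpu⟩ := h₁.walk u (by omega)
    obtain ⟨_, rfl, pv, hpv⟩ := h₁.walk v (by omega)
    -- Both walks have length less than `a ≤ t`, so this closed walk is too short to be odd.
    have := hmin _ (pu.append (.cons hH pv.reverse))
    simp only [Walk.length_append, Walk.length_cons, Walk.length_reverse] at this
    rw [ne_eq, decide_eq_decide]
    intro hpar
    have := this (by grind)
    omega
  · have hv1 : ¬ d₁ v < a := by omega
    simp only [hu2, hv2, hu1, hv1, if_false]
    obtain ⟨au, hau⟩ := hA u hu3
    obtain ⟨av, hav⟩ := hA v hv3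
    have lu := h₁.le_add_length au
    have lv := h₁.le_add_length av
    have eu := hil u hu3
    have ev := hil v hv3
    -- The edge `u v` is closed up in two ways: through `r`, and through the other ends of the
    -- branches.
    have m1 := hmin _ (au.append (.cons hH av.reverse))
    simp only [Walk.length_append, Walk.length_cons, Walk.length_reverse, Nat.odd_iff] at m1
    rcases hB u hu3 with ⟨hbb, bu, hbu⟩ | ⟨hbb, bu, hbu⟩ <;>
      rcases hB v hv3 with ⟨hbb', bv, hbv⟩ | ⟨hbb', bv, hbv⟩ <;>
      simp only [hbb, hbb', Bool.false_xor, Bool.true_xor, ne_eq, ← decide_not,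
        decide_eq_decide, Nat.odd_iff]
    -- On a common branch, equal colours make both closed walks odd. Their lengths add up to at most
    -- `2t + 4j - 2 ≤ 4t`, while two odd closed walks have total length at least `4t + 2`.
    · have m2 := hmin _ (bu.append (.cons hH bv.reverse))
      simp only [Walk.length_append, Walk.length_cons, Walk.length_reverse, Nat.odd_iff] at m2
      omega
    -- On different branches, equal colours make the closed walk through the edge `x y` odd. That it
    -- is not shorter than `2t+1` forces the feet of `u` and `v` close to `r`, against `d₁ > a ≥ 2j
    -- - 2` at both vertices.
    · have m2 := hmin _ ((bu.append (.cons hH bv.reverse)).append (.cons hxy.symm .nil))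
      simp only [Walk.length_append, Walk.length_cons, Walk.length_reverse, Walk.length_nil,
        Nat.odd_iff] at m2
      omega
    · have m2 := hmin _ ((bu.append (.cons hH bv.reverse)).append (.cons hxy .nil))
      simp only [Walk.length_append, Walk.length_cons, Walk.length_reverse, Walk.length_nil,
        Nat.odd_iff] at m2
      omega
    · have m2 := hmin _ (bu.append (.cons hH bv.reverse))
      simp only [Walk.length_append, Walk.length_cons, Walk.length_reverse, Nat.odd_iff] at m2
      omega

end Layers

end SimpleGraph


namespace SimpleGraph

/-! ### Two layers that contain few vertices of the independent set. -/

section GoodLayers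

variable {V : Type*} {G : SimpleGraph V}

/-- Among `m` consecutive layers there is one with at most the average number of elements. -/
lemma exists_light_layer (S : Finset V) (d : V → ℕ) (b m : ℕ) (hm : 0 < m) :
    ∃ j, b ≤ j ∧ j < b + m ∧ m * (S.filter fun u => d u = j).card ≤ S.card := by
  classical
  by_contra! hno
  have h1 : ∑ j ∈ Finset.Ico b (b + m), (S.filter fun u => d u = j).card ≤ S.card := by
    rw [← Finset.card_biUnion]
    · refine Finset.card_le_card fun u hu => ?_
      simp only [Finset.mem_biUnion, Finset.mem_filter] at hu
      obtain ⟨_, _, h, _⟩ := hu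
      exact h
    · intro i _ j _ hij
      rw [Function.onFun, Finset.disjoint_left]
      intro u hu hu'
      rw [Finset.mem_filter] at hu hu'
      exact hij (hu.2.symm.trans hu'.2)
  have h2 : ∑ j ∈ Finset.Ico b (b + m), S.card <
      ∑ j ∈ Finset.Ico b (b + m), m * (S.filter fun u => d u = j).card := by
    refine Finset.sum_lt_sum_of_nonempty ⟨b, by simp [hm]⟩ fun j hj => ?_
    rw [Finset.mem_Ico] at hj
    exact hno j hj.1 hj.2
  rw [← Finset.mul_sum, Finset.sum_const, Nat.card_Ico, smul_eq_mul, Nat.add_sub_cancel_left] at h2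
  have := Nat.lt_of_mul_lt_mul_left h2
  omega

/-- If no vertex of `W` has many neighbours in the independent set `S`, then `W` can be made
bipartite by deleting two layers with few vertices of `S`. -/
theorem exists_good_layers [Finite V] [Nonempty V] (hG : G.iocp ≤ 1)
    (S : Finset V) (W : Set V) {e I : ℕ} (he : 1 ≤ e) (hI : Nat.card V + 6 * e < I)
    [DecidableRel G.Adj]
    (hlight : ∀ v ∈ W, 12 * e ^ 2 * (S.filter fun u => G.Adj v u).card ≤ S.card) :
    ∃ r x y : V, ∀ d₁, (G.restrictTo W).IsLevel I {r} d₁ →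
      ∀ K, (G.restrictTo W).IsFork I d₁ r x y K → ∀ d₂, (G.restrictTo W).IsLevel I K d₂ →
      ∃ j < I, ∃ a < I,
        (∃ χ : V → Bool, ∀ u v, u ∈ {z ∈ W | d₁ z ≠ a ∧ d₂ z ≠ j} →
          v ∈ {z ∈ W | d₁ z ≠ a ∧ d₂ z ≠ j} → G.Adj u v → χ u ≠ χ v) ∧
        e * (S.filter fun u => d₁ u = a ∨ d₂ u = j).card ≤ S.card := by
  classical
  -- Two windows of `2e` layers each, so that either light layer takes at most `|S|/(2e)`. The
  -- windows are placed so that `2j ≤ 4e ≤ a < 6e`, as the colouring requires.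
  have hlayers : ∀ d₁ d₂ : V → ℕ, ∃ j a, 1 ≤ j ∧ j < 1 + 2 * e ∧ 4 * e ≤ a ∧ a < 4 * e + 2 * e ∧
      e * (S.filter fun u => d₁ u = a ∨ d₂ u = j).card ≤ S.card := by
    intro d₁ d₂
    obtain ⟨a, h1, h2, h3⟩ := exists_light_layer S d₁ (4 * e) (2 * e) (by omega)
    obtain ⟨j, h4, h5, h6⟩ := exists_light_layer S d₂ 1 (2 * e) (by omega)
    refine ⟨j, a, h4, h5, h1, h2, ?_⟩
    have := Finset.card_union_le (S.filter fun u => d₁ u = a) (S.filter fun u => d₂ u = j)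
    rw [← Finset.filter_or] at this
    nlinarith
  by_cases hodd : ∀ (u : V) (p : (G.restrictTo W).Walk u u), ¬ Odd p.length
  · obtain ⟨r⟩ := ‹Nonempty V›
    refine ⟨r, r, r, fun d₁ _ K _ d₂ _ => ?_⟩
    obtain ⟨j, a, h1, h2, h3, h4, h5⟩ := hlayers d₁ d₂
    obtain ⟨χ, hχ⟩ := exists_bicoloring hodd
    exact ⟨j, by omega, a, by omega,
      ⟨χ, fun u v hu hv huv => hχ u v ⟨huv, hu.1, hv.1⟩⟩, h5⟩
  · obtain ⟨t, r, x, y, p₀, q₀, hp₀, hq₀, hxy, ht0, htV, hmin⟩ := exists_shortest_odd hodd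
    refine ⟨r, x, y, fun d₁ h₁ K hK d₂ h₂ => ?_⟩
    have hdx := h₁.eq_of_shortest_odd p₀ q₀ hp₀ hq₀ hxy (by omega) hmin
    have hdy := h₁.eq_of_shortest_odd q₀ p₀ hq₀ hp₀ hxy.symm (by omega) hmin
    -- The marked shortest paths may differ from `p₀` and `q₀`. They have the same lengths, hence
    -- close up to a shortest odd closed walk as well; this is why trying triples of vertices is
    -- enough.
    obtain ⟨p, q, hp, hq, hKs⟩ := hK (by omega) (by omega)
    rw [hdx] at hp
    rw [hdy] at hq
    -- A long cycle has room for both windows.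
    by_cases ht : 6 * e ≤ t
    · obtain ⟨j, a, h1, h2, h3, h4, h5⟩ := hlayers d₁ d₂
      exact ⟨j, by omega, a, by omega,
        exists_bicoloring_off_layers hG h₁ h₂ p q hp hq hKs hxy hmin (by omega) (by omega) h1
          (by omega) (by omega) (by omega), h5⟩
    -- For a short cycle the layer around `r` is `r` alone, and the other one is the layer next to
    -- the cycle. All deleted vertices are neighbours of the cycle, including `r` as a neighbour of
    -- the next vertex of `p`.
    · refine ⟨1, by omega, 0, by omega,
        exists_bicoloring_off_layers hG h₁ h₂ p q hp hq hKs hxy hmin (by omega) (by omega) le_rfl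
          (by omega) (by omega) (by omega), ?_⟩
      let L : List V := p.support ++ q.support.tail
      have hLK : ∀ v, v ∈ K → v ∈ L := by
        intro v hv
        rcases (hKs v).1 hv with hv | hv
        · exact List.mem_append_left _ hv
        · rw [← Walk.cons_tail_support, List.mem_cons] at hv
          rcases hv with rfl | hv
          · exact List.mem_append_left _ p.start_mem_support
          · exact List.mem_append_right _ hv
      have hLW : ∀ v ∈ L, v ∈ W := by
        intro v hv
        rcases List.mem_append.1 hv with hv | hv
        · exact p.mem_of_restrictTo (by omega) v hv
        · exact q.mem_of_restrictTo (by omega) v (List.mem_of_mem_tail hv)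
      have hsub : (S.filter fun u => d₁ u = 0 ∨ d₂ u = 1) ⊆
          L.toFinset.biUnion fun k => S.filter fun u => G.Adj k u := by
        intro u hu
        obtain ⟨huS, hu⟩ := Finset.mem_filter.1 hu
        rw [Finset.mem_biUnion]
        rcases hu with hu | hu
        · obtain ⟨_, rfl, w, hw⟩ := h₁.walk u (by omega)
          obtain rfl := Walk.eq_of_length_eq_zero (hw.trans hu)
          cases p with
          | nil => simp at hp; omega
          | @cons _ z _ h p' =>
            refine ⟨z, ?_, Finset.mem_filter.2 ⟨huS, h.1.symm⟩⟩
            simp [L]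
        · obtain ⟨k, hk, w, hw⟩ := h₂.walk u (by omega)
          refine ⟨k, List.mem_toFinset.2 (hLK k hk), Finset.mem_filter.2 ⟨huS, ?_⟩⟩
          exact (Walk.adj_of_length_eq_one (hw.trans hu)).1
      -- The cycle has `2t+1 ≤ 12e - 1` vertices, and each is adjacent to at most `|S|/(12e²)`
      -- vertices of `S`.
      have hLc : L.toFinset.card ≤ 12 * e := by
        refine (List.toFinset_card_le L).trans ?_
        simp only [L, List.length_append, List.length_tail, Walk.length_support]
        omega
      have h1 : 12 * e ^ 2 * (S.filter fun u => d₁ u = 0 ∨ d₂ u = 1).card ≤ 12 * e * S.card := by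
        calc _ ≤ 12 * e ^ 2 * ∑ k ∈ L.toFinset, (S.filter fun u => G.Adj k u).card :=
              Nat.mul_le_mul_left _ ((Finset.card_le_card hsub).trans Finset.card_biUnion_le)
          _ = ∑ k ∈ L.toFinset, 12 * e ^ 2 * (S.filter fun u => G.Adj k u).card := by
              rw [Finset.mul_sum]
          _ ≤ ∑ k ∈ L.toFinset, S.card :=
              Finset.sum_le_sum fun k hk => hlight k (hLW k (List.mem_toFinset.1 hk))
          _ ≤ 12 * e * S.card := by
              rw [Finset.sum_const, smul_eq_mul]
              exact Nat.mul_le_mul_right _ hLc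
      refine le_of_mul_le_mul_left (a := 12 * e) ?_ (by omega)
      calc _ = 12 * e ^ 2 * (S.filter fun u => d₁ u = 0 ∨ d₂ u = 1).card := by ring
        _ ≤ _ := h1

end GoodLayers

end SimpleGraph


/-! ### Traces of set families of bounded VC-dimension. -/

section VC

open Finset

/-- A Sauer-Shelah bound for the number of traces on a set. -/
lemma Finset.card_traces_le {α : Type*} [DecidableEq α] (𝒜 : Finset (Finset α)) {d : ℕ}
    (hd : 𝒜.vcDim ≤ d) (Y : Finset α) : #(𝒜.image fun s => s ∩ Y) ≤ (#Y + 1) ^ d := by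
  -- A set shattered by the traces is contained in `Y` and shattered by `𝒜`, so it has at most `d`
  -- elements.
  have hsub : (𝒜.image fun s => s ∩ Y).shatterer ⊆
      (range (d + 1)).biUnion fun k => Y.powersetCard k := by
    intro s hs
    rw [mem_shatterer] at hs
    have hsY : s ⊆ Y := by
      obtain ⟨u, hu, hsu⟩ := hs.exists_superset
      obtain ⟨w, -, rfl⟩ := mem_image.1 hu
      exact hsu.trans inter_subset_right
    have hs' : 𝒜.Shatters s := by
      intro t ht
      obtain ⟨u, hu, hut⟩ := hs ht
      obtain ⟨w, hw, rfl⟩ := mem_image.1 hu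
      refine ⟨w, hw, ?_⟩
      rw [← hut]
      ext z
      simp only [mem_inter]
      exact ⟨fun h => ⟨h.1, h.2, hsY h.1⟩, fun h => ⟨h.1, h.2.1⟩⟩
    rw [mem_biUnion]
    exact ⟨#s, mem_range.2 (by have := hs'.card_le_vcDim; omega), mem_powersetCard.2 ⟨hsY, rfl⟩⟩
  calc _ ≤ _ := card_le_card_shatterer _
    _ ≤ _ := card_le_card hsub
    _ ≤ ∑ k ∈ range (d + 1), #(Y.powersetCard k) := card_biUnion_le
    -- The superfluous binomial coefficient makes the sum the expansion of `(|Y| + 1)^d`.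
    _ ≤ ∑ k ∈ range (d + 1), #Y ^ k * 1 ^ (d - k) * d.choose k := by
        refine sum_le_sum fun k hk => ?_
        rw [card_powersetCard, one_pow, mul_one]
        exact (Nat.choose_le_pow _ _).trans
          (Nat.le_mul_of_pos_right _ (Nat.choose_pos (by rw [mem_range] at hk; omega)))
    _ = _ := (add_pow _ _ _).symm

end VC

/-! ### The ε-net theorem by counting samples. -/

section Net

open Finset

variable {U : Type*} [DecidableEq U]

/-- Most samples hit a dense set often. -/
lemma two_mul_card_rarely_hit_le [Fintype U] (r : Finset U) (δ : ℝ) (M t : ℕ)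
    (hr : δ * Fintype.card U ≤ #r) (ht : (2 : ℝ) ^ t * Real.exp (-(δ / 2 * M)) ≤ 1 / 2) :
    (2 : ℝ) * #{B : Fin M → U | #{k | B k ∈ r} < t} ≤ (Fintype.card U : ℝ) ^ M := by
  -- An exponential moment: every hit of `r` contributes a factor `1/2`, which has mean at most `1 -
  -- δ/2 ≤ exp (-δ/2)`.
  have h1 : (∑ u : U, if u ∈ r then (1 / 2 : ℝ) else 1) ≤
      Fintype.card U * Real.exp (-(δ / 2)) := by
    have : (∑ u : U, if u ∈ r then (1 / 2 : ℝ) else 1) = Fintype.card U - #r / 2 := by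
      have : ∀ u : U, (if u ∈ r then (1 / 2 : ℝ) else 1) = 1 - (if u ∈ r then 1 / 2 else 0) := by
        intro u; split_ifs <;> norm_num
      simp_rw [this, sum_sub_distrib, ← sum_filter, filter_mem_eq_inter, univ_inter]
      simp
      ring
    rw [this]
    have h2 := Real.add_one_le_exp (-(δ / 2))
    have h3 : (0 : ℝ) ≤ Fintype.card U := Nat.cast_nonneg _
    nlinarith
  have h2 : ∀ B : Fin M → U,
      ∏ k, (if B k ∈ r then (1 / 2 : ℝ) else 1) = (1 / 2) ^ #{k | B k ∈ r} := by
    intro B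
    rw [prod_ite, prod_const, prod_const_one, mul_one]
  -- Markov's inequality: a sample with fewer than `t` hits has weight at least `(1/2)^t`.
  have h3 : (#{B : Fin M → U | #{k | B k ∈ r} < t} : ℝ) * (1 / 2) ^ t ≤
      (Fintype.card U * Real.exp (-(δ / 2))) ^ M := by
    calc _ = ∑ B ∈ ({B : Fin M → U | #{k | B k ∈ r} < t} : Finset _), (1 / 2 : ℝ) ^ t := by
          rw [sum_const, nsmul_eq_mul]
      _ ≤ ∑ B ∈ ({B : Fin M → U | #{k | B k ∈ r} < t} : Finset _),
            ∏ k, (if B k ∈ r then (1 / 2 : ℝ) else 1) := by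
          refine sum_le_sum fun B hB => ?_
          rw [h2]
          exact pow_le_pow_of_le_one (by norm_num) (by norm_num) (mem_filter.1 hB).2.le
      _ ≤ ∑ B : Fin M → U, ∏ k, (if B k ∈ r then (1 / 2 : ℝ) else 1) := by
          refine sum_le_sum_of_subset_of_nonneg (subset_univ _) fun B _ _ => ?_
          rw [h2]; positivity
      _ = (∑ u : U, if u ∈ r then (1 / 2 : ℝ) else 1) ^ M := by rw [Fintype.sum_pow]
      _ ≤ _ := pow_le_pow_left₀ (sum_nonneg fun u _ => by split_ifs <;> norm_num) h1 M
  rw [mul_pow, ← Real.exp_nat_mul] at h3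
  have h4 : (#{B : Fin M → U | #{k | B k ∈ r} < t} : ℝ) =
      #{B : Fin M → U | #{k | B k ∈ r} < t} * (1 / 2) ^ t * 2 ^ t := by
    rw [mul_assoc, ← mul_pow]; norm_num
  rw [h4]
  have h5 : (0 : ℝ) ≤ (Fintype.card U : ℝ) ^ M := by positivity
  have h6 : (M : ℝ) * -(δ / 2) = -(δ / 2 * M) := by ring
  rw [h6] at h3
  have h7 : (0 : ℝ) < 2 ^ t := by positivity
  calc _ ≤ 2 * ((Fintype.card U : ℝ) ^ M * Real.exp (-(δ / 2 * M)) * 2 ^ t) := by gcongr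
    _ = 2 * ((Fintype.card U : ℝ) ^ M * (2 ^ t * Real.exp (-(δ / 2 * M)))) := by ring
    _ ≤ 2 * ((Fintype.card U : ℝ) ^ M * (1 / 2)) := by gcongr
    _ = _ := by ring

/-- Among all ways to swap the coordinates of two samples, few make the first miss `τ` and the
second hit it often. -/
lemma card_swaps_mul_le (M t : ℕ) (A B : Fin M → U) (τ : Finset U) :
    #{σ : Fin M → Bool | (∀ k, (if σ k then B k else A k) ∉ τ) ∧
      t ≤ #{k | (if σ k then A k else B k) ∈ τ}} * 2 ^ t ≤ 2 ^ M := by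
  set Q : Finset (Fin M → Bool) := {σ : Fin M → Bool | (∀ k, (if σ k then B k else A k) ∉ τ) ∧
      t ≤ #{k | (if σ k then A k else B k) ∈ τ}} with hQ
  -- Coordinates at which exactly one of the two samples lies in `τ`. There the swap is forced,
  -- since the first sample has to miss `τ`; all hits of the second one are such coordinates.
  set F : Finset (Fin M) := {k | (A k ∈ τ ∧ B k ∉ τ) ∨ (A k ∉ τ ∧ B k ∈ τ)} with hF
  rcases Q.eq_empty_or_nonempty with h0 | ⟨σ₀, h0⟩
  · rw [h0]; simp
  have htF : t ≤ #F := by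
    obtain ⟨h1, h2⟩ := (mem_filter.1 h0).2
    refine h2.trans (card_le_card fun k hk => ?_)
    have h3 := h1 k
    have h4 := (mem_filter.1 hk).2
    rw [hF, mem_filter]
    refine ⟨mem_univ _, ?_⟩
    cases hs : σ₀ k <;> simp only [hs, if_true, if_false, Bool.false_eq_true] at h3 h4 <;> tauto
  have hsub : Q ⊆ Fintype.piFinset fun k => if k ∈ F then {decide (A k ∈ τ)} else univ := by
    intro σ hσ
    rw [Fintype.mem_piFinset]
    intro k
    split_ifs with hk
    · have h1 := (mem_filter.1 hσ).2.1 k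
      have h2 := (mem_filter.1 hk).2
      rw [mem_singleton]
      cases hs : σ k <;> simp only [hs, if_true, if_false, Bool.false_eq_true] at h1
      · simp [h1]
      · have : A k ∈ τ := by tauto
        simp [this]
    · exact mem_univ _
  have hcard := card_le_card hsub
  have h2 : ∀ k, #(if k ∈ F then {decide (A k ∈ τ)} else (univ : Finset Bool)) =
      if k ∈ F then 1 else 2 := by
    intro k; split_ifs <;> simp
  rw [Fintype.card_piFinset, prod_congr rfl fun k _ => h2 k, prod_ite, prod_const_one, one_mul,
    prod_const] at hcard
  have h3 : #(univ.filter fun k => k ∈ F) + #(univ.filter fun k => ¬ k ∈ F) = M := by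
    rw [card_filter_add_card_filter_not]; simp
  rw [filter_mem_eq_inter, univ_inter] at h3
  calc #Q * 2 ^ t ≤ 2 ^ #(univ.filter fun k => ¬ k ∈ F) * 2 ^ #F :=
        Nat.mul_le_mul hcard (Nat.pow_le_pow_right (by norm_num) htF)
    _ = 2 ^ M := by rw [← pow_add]; congr 1; omega

/-- The ε-net theorem of Haussler and Welzl, as a bound for the number of samples that miss some
dense range. -/
theorem card_non_nets_le [Fintype U] {ι : Type*} (J : Finset ι) (r : ι → Finset U) (d M t : ℕ) (δ : ℝ)
    (htr : ∀ Y : Finset U, #(J.image fun i => r i ∩ Y) ≤ (#Y + 1) ^ d)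
    (hr : ∀ i ∈ J, δ * Fintype.card U ≤ #(r i))
    (ht : (2 : ℝ) ^ t * Real.exp (-(δ / 2 * M)) ≤ 1 / 2) :
    (#{A : Fin M → U | ∃ i ∈ J, ∀ k, A k ∉ r i} : ℝ) * 2 ^ t ≤
      2 * (2 * M + 1) ^ d * (Fintype.card U : ℝ) ^ M := by
  classical
  set bad : Finset (Fin M → U) := {A : Fin M → U | ∃ i ∈ J, ∀ k, A k ∉ r i} with hbad
  let P : (Fin M → U) → (Fin M → U) → Prop := fun A B =>
    ∃ i ∈ J, (∀ k, A k ∉ r i) ∧ t ≤ #{k | B k ∈ r i}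
  set Q : Finset ((Fin M → U) × (Fin M → U)) := {x | P x.1 x.2} with hQ
  set N : ℝ := (Fintype.card U : ℝ) ^ M with hN
  have hcardM : ((Fintype.card (Fin M → U) : ℕ) : ℝ) = N := by simp [hN]
  -- Double sampling: if `A` misses a dense range, at least half of all second samples hit that
  -- range `t` times.
  have h1 : (#bad : ℝ) * N ≤ 2 * #Q := by
    have hA : ∀ A ∈ bad, N ≤ 2 * #{B | P A B} := by
      intro A hA
      obtain ⟨i, hi, hAi⟩ := (mem_filter.1 hA).2
      have h2 := two_mul_card_rarely_hit_le (r i) δ M t (hr i hi) ht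
      have h3 : #{B : Fin M → U | #{k | B k ∈ r i} < t} +
          #{B : Fin M → U | ¬ #{k | B k ∈ r i} < t} = Fintype.card (Fin M → U) := by
        rw [card_filter_add_card_filter_not, card_univ]
      have h4 : #{B : Fin M → U | ¬ #{k | B k ∈ r i} < t} ≤ #{B | P A B} := by
        refine card_le_card fun B hB => ?_
        rw [mem_filter] at hB ⊢
        exact ⟨hB.1, i, hi, hAi, not_lt.1 hB.2⟩
      have h3' : (#{B : Fin M → U | #{k | B k ∈ r i} < t} : ℝ) +
          #{B : Fin M → U | ¬ #{k | B k ∈ r i} < t} = N := by rw [← hcardM]; exact_mod_cast h3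
      have h4' : (#{B : Fin M → U | ¬ #{k | B k ∈ r i} < t} : ℝ) ≤ #{B | P A B} := by
        exact_mod_cast h4
      linarith
    have hQc : #Q = ∑ A, #{B | P A B} := by
      rw [hQ, card_filter, Fintype.sum_prod_type]
      exact sum_congr rfl fun A _ => (card_filter _ _).symm
    calc (#bad : ℝ) * N = ∑ A ∈ bad, N := by rw [sum_const, nsmul_eq_mul]
      _ ≤ ∑ A ∈ bad, (2 * #{B | P A B} : ℝ) := sum_le_sum hA
      _ ≤ ∑ A, (2 * #{B | P A B} : ℝ) :=
          sum_le_sum_of_subset_of_nonneg (subset_univ _) fun _ _ _ => by positivity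
      _ = 2 * #Q := by rw [hQc, ← mul_sum]; push_cast; rfl
  -- Swapping coordinates permutes the pairs of samples, so `Q` may be counted by averaging over all
  -- swaps of a fixed pair. For a fixed pair only traces on at most `2M` points matter.
  let sw : (Fin M → Bool) → (Fin M → U) × (Fin M → U) → (Fin M → U) × (Fin M → U) :=
    fun σ x => (fun k => if σ k then x.2 k else x.1 k, fun k => if σ k then x.1 k else x.2 k)
  have hsw : ∀ σ x, sw σ (sw σ x) = x := by
    intro σ x
    ext k <;> simp only [sw] <;> split_ifs <;> rfl
  have h2 : ∀ σ, #{x | sw σ x ∈ Q} = #Q := by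
    intro σ
    refine card_bij' (fun x _ => sw σ x) (fun x _ => sw σ x) ?_ ?_ ?_ ?_
    · intro x hx; exact (mem_filter.1 hx).2
    · intro x hx; rw [mem_filter]; exact ⟨mem_univ _, by rwa [hsw]⟩
    · intro x _; exact hsw σ x
    · intro x _; exact hsw σ x
  have h3 : ∀ x, #{σ | sw σ x ∈ Q} * 2 ^ t ≤ (2 * M + 1) ^ d * 2 ^ M := by
    rintro ⟨A, B⟩
    set Y : Finset U := univ.image A ∪ univ.image B with hY
    have hYA : ∀ k, A k ∈ Y := fun k => mem_union_left _ (mem_image_of_mem _ (mem_univ _))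
    have hYB : ∀ k, B k ∈ Y := fun k => mem_union_right _ (mem_image_of_mem _ (mem_univ _))
    have hYc : #Y ≤ 2 * M := by
      refine (card_union_le _ _).trans ?_
      have h5 := card_image_le (s := univ) (f := A)
      have h6 := card_image_le (s := univ) (f := B)
      rw [card_univ, Fintype.card_fin] at h5 h6
      omega
    have hsub : ({σ | sw σ (A, B) ∈ Q} : Finset (Fin M → Bool)) ⊆
        (J.image fun i => r i ∩ Y).biUnion fun τ =>
          {σ : Fin M → Bool | (∀ k, (if σ k then B k else A k) ∉ τ) ∧
            t ≤ #{k | (if σ k then A k else B k) ∈ τ}} := by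
      intro σ hσ
      obtain ⟨i, hi, h5, h6⟩ := (mem_filter.1 (mem_filter.1 hσ).2).2
      rw [mem_biUnion]
      refine ⟨r i ∩ Y, mem_image_of_mem _ hi, mem_filter.2 ⟨mem_univ _, ?_, ?_⟩⟩
      · intro k hk
        exact h5 k (mem_inter.1 hk).1
      · refine h6.trans (card_le_card fun k hk => ?_)
        rw [mem_filter] at hk ⊢
        refine ⟨hk.1, mem_inter.2 ⟨hk.2, ?_⟩⟩
        split_ifs
        · exact hYA k
        · exact hYB k
    calc _ ≤ (∑ τ ∈ J.image fun i => r i ∩ Y,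
          #{σ : Fin M → Bool | (∀ k, (if σ k then B k else A k) ∉ τ) ∧
            t ≤ #{k | (if σ k then A k else B k) ∈ τ}}) * 2 ^ t :=
          Nat.mul_le_mul_right _ ((card_le_card hsub).trans card_biUnion_le)
      _ ≤ ∑ τ ∈ J.image fun i => r i ∩ Y, 2 ^ M := by
          rw [sum_mul]
          exact sum_le_sum fun τ _ => card_swaps_mul_le M t A B τ
      _ ≤ (2 * M + 1) ^ d * 2 ^ M := by
          rw [sum_const, smul_eq_mul]
          exact Nat.mul_le_mul_right _ ((htr Y).trans (Nat.pow_le_pow_left (by omega) d))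
  have h4 : 2 ^ M * #Q * 2 ^ t ≤
      Fintype.card ((Fin M → U) × (Fin M → U)) * ((2 * M + 1) ^ d * 2 ^ M) := by
    calc 2 ^ M * #Q * 2 ^ t = (∑ σ : Fin M → Bool, #{x | sw σ x ∈ Q}) * 2 ^ t := by
          rw [sum_congr rfl fun σ _ => h2 σ, sum_const, card_univ]; simp
      _ = (∑ x, #{σ | sw σ x ∈ Q}) * 2 ^ t := by
          simp only [card_filter]; rw [sum_comm]
      _ ≤ ∑ x : (Fin M → U) × (Fin M → U), (2 * M + 1) ^ d * 2 ^ M := by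
          rw [sum_mul]; exact sum_le_sum fun x _ => h3 x
      _ = _ := by rw [sum_const, card_univ, smul_eq_mul]
  have h5 : (#Q : ℝ) * 2 ^ t ≤ N * N * (2 * M + 1) ^ d := by
    have h6 : ((2 ^ M * #Q * 2 ^ t : ℕ) : ℝ) ≤
      ((Fintype.card ((Fin M → U) × (Fin M → U)) * ((2 * M + 1) ^ d * 2 ^ M) : ℕ) : ℝ) := by
      exact_mod_cast h4
    rw [Fintype.card_prod] at h6
    push_cast [hcardM] at h6
    have h7 : (0 : ℝ) < 2 ^ M := by positivity
    refine le_of_mul_le_mul_left ?_ h7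
    linarith
  -- Without any samples at all one cannot divide by their number.
  rcases (by positivity : (0 : ℝ) ≤ N).eq_or_lt with h0 | h0
  · have : #bad = 0 := by
      have h7 : #bad ≤ Fintype.card (Fin M → U) := card_le_univ _
      have h8 : (Fintype.card (Fin M → U) : ℝ) = 0 := by rw [hcardM, ← h0]
      have h9 : Fintype.card (Fin M → U) = 0 := by exact_mod_cast h8
      omega
    rw [this, ← h0]; simp
  · refine le_of_mul_le_mul_right ?_ h0
    have h8 : (0 : ℝ) < 2 ^ t := by positivity
    nlinarith

/-- The sample size factor that makes the failure probability at most `η`. -/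
lemma exists_sample_factor (d : ℕ) {β η : ℝ} (hβ : 0 < β) (hη : 0 < η) :
    ∃ c₀ : ℕ, 1 ≤ c₀ ∧ ∀ e : ℕ, 1 ≤ e → ∃ t : ℕ,
      (2 : ℝ) ^ t * Real.exp (-(β / (24 * e ^ 2) / 2 * (c₀ * e ^ 3 : ℕ))) ≤ 1 / 2 ∧
      2 * (2 * ((c₀ * e ^ 3 : ℕ) : ℝ) + 1) ^ d ≤ η * 2 ^ t := by
  set κ : ℝ := β / 48 with hκ
  have hκ0 : 0 < κ := by positivity
  have hb : 0 < κ * Real.log 2 := mul_pos hκ0 (Real.log_pos (by norm_num))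
  have hlit := (isLittleO_pow_exp_pos_mul_atTop (k := 3 * d) hb).bound
    (show 0 < η / (4 * 3 ^ d) by positivity)
  obtain ⟨y₀, hy₀⟩ := Filter.eventually_atTop.1 hlit
  -- With `y = c₀ e`, the expected number of hits is governed by `κ y`, while the number of traces
  -- is polynomial in `y`. Here `y ≥ y₀` makes the exponential win, and `κ y ≥ 3` gives the factor
  -- `1/2`, because `3 (1 - log 2) ≥ log 2`. A sample of size `c₀ e³` makes the exponent linear in
  -- `e`, so that no logarithm is needed.
  refine ⟨⌈max y₀ (3 / κ)⌉₊ + 1, by omega, fun e he => ?_⟩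
  set c₀ := ⌈max y₀ (3 / κ)⌉₊ + 1 with hc₀
  have hc : max y₀ (3 / κ) ≤ c₀ := by
    rw [hc₀]; push_cast
    exact (Nat.le_ceil _).trans (by linarith)
  have he1 : (1 : ℝ) ≤ e := by exact_mod_cast he
  have hc1 : (1 : ℝ) ≤ c₀ := by rw [hc₀]; push_cast; linarith [Nat.cast_nonneg (α := ℝ) ⌈max y₀ (3 / κ)⌉₊]
  set y : ℝ := c₀ * e with hy
  have hcy : (c₀ : ℝ) ≤ y := le_mul_of_one_le_right (by linarith) he1
  have hyy : y₀ ≤ y := (le_max_left _ _).trans (hc.trans hcy)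
  have hx3 : 3 ≤ κ * y := by
    have : 3 / κ ≤ y := (le_max_right _ _).trans (hc.trans hcy)
    rw [div_le_iff₀ hκ0] at this
    linarith
  have hx0 : 0 ≤ κ * y := by linarith
  have hexp : β / (24 * (e : ℝ) ^ 2) / 2 * ((c₀ * e ^ 3 : ℕ) : ℝ) = κ * y := by
    have : (e : ℝ) ≠ 0 := by linarith
    rw [hκ, hy]; push_cast; field_simp; ring
  refine ⟨⌊κ * y⌋₊, ?_, ?_⟩
  · rw [hexp]
    have h1 : (2 : ℝ) ^ ⌊κ * y⌋₊ ≤ Real.exp (Real.log 2 * (κ * y)) := by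
      rw [← Real.rpow_def_of_pos (by norm_num), ← Real.rpow_natCast]
      exact Real.rpow_le_rpow_of_exponent_le (by norm_num) (Nat.floor_le hx0)
    calc _ ≤ Real.exp (Real.log 2 * (κ * y)) * Real.exp (-(κ * y)) := by gcongr
      _ = Real.exp (Real.log 2 * (κ * y) + -(κ * y)) := (Real.exp_add _ _).symm
      _ ≤ Real.exp (-Real.log 2) := by
          rw [Real.exp_le_exp]
          have := Real.log_two_lt_d9
          nlinarith
      _ = 1 / 2 := by rw [Real.exp_neg, Real.exp_log (by norm_num)]; norm_num
  · have h1 : Real.exp (κ * Real.log 2 * y) ≤ 2 * 2 ^ ⌊κ * y⌋₊ := by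
      have : κ * Real.log 2 * y = Real.log 2 * (κ * y) := by ring
      rw [this, ← Real.rpow_def_of_pos (by norm_num), ← pow_succ', ← Real.rpow_natCast]
      refine Real.rpow_le_rpow_of_exponent_le (by norm_num) ?_
      push_cast
      exact (Nat.lt_floor_add_one _).le
    have h2 := hy₀ y hyy
    rw [Real.norm_of_nonneg (by positivity), Real.norm_of_nonneg (Real.exp_nonneg _)] at h2
    have h3 : 2 * ((c₀ * e ^ 3 : ℕ) : ℝ) + 1 ≤ 3 * y ^ 3 := by
      rw [hy]; push_cast
      have h4 : (1 : ℝ) ≤ c₀ ^ 2 := one_le_pow₀ hc1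
      have h5 : (1 : ℝ) ≤ e ^ 3 := one_le_pow₀ he1
      have h6 : (1 : ℝ) ≤ c₀ * e ^ 3 := one_le_mul_of_one_le_of_one_le hc1 h5
      calc 2 * ((c₀ : ℝ) * (e : ℝ) ^ 3) + 1 ≤ 3 * ((c₀ : ℝ) * (e : ℝ) ^ 3) * 1 := by linarith
        _ ≤ 3 * ((c₀ : ℝ) * (e : ℝ) ^ 3) * (c₀ : ℝ) ^ 2 := by gcongr
        _ = _ := by ring
    calc 2 * (2 * ((c₀ * e ^ 3 : ℕ) : ℝ) + 1) ^ d ≤ 2 * (3 * y ^ 3) ^ d := by gcongr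
      _ = 2 * 3 ^ d * y ^ (3 * d) := by rw [mul_pow, pow_mul]; ring
      _ ≤ 2 * 3 ^ d * (η / (4 * 3 ^ d) * Real.exp (κ * Real.log 2 * y)) := by gcongr
      _ = η / 2 * Real.exp (κ * Real.log 2 * y) := by field_simp; norm_num
      _ ≤ η / 2 * (2 * 2 ^ ⌊κ * y⌋₊) := by gcongr
      _ = _ := by ring

/-- Few samples miss the neighbourhood in `S` of some vertex with many neighbours in `S`. -/
theorem card_bad_samples_le [Fintype U] {n d e M t : ℕ} {β η : ℝ} (G : SimpleGraph (Fin n))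
    [DecidableRel G.Adj] (hd : G.nbhdVCDim ≤ d) (S : Finset (Fin n)) (hβ : 0 < β)
    (hS : β * n ≤ #S) (val : U → ℕ) (hval : ∀ u : Fin n, ∃ b, val b = u)
    (hU : Fintype.card U ≤ 2 * n) (he : 1 ≤ e)
    (ht : (2 : ℝ) ^ t * Real.exp (-(β / (24 * e ^ 2) / 2 * M)) ≤ 1 / 2)
    (hη : 2 * (2 * (M : ℝ) + 1) ^ d ≤ η * 2 ^ t) :
    (#{A : Fin M → U | ∃ v : Fin n, #S < 12 * e ^ 2 * #{u ∈ S | G.Adj v u} ∧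
      ∀ k, ∀ u ∈ S, G.Adj v u → val (A k) ≠ u} : ℝ) ≤ η * (Fintype.card U : ℝ) ^ M := by
  classical
  -- The ranges live on the codes `U` of numbers. Codes that do not denote a vertex are allowed;
  -- they at most halve the density, hence the constant 24 in place of 12.
  let r : Fin n → Finset U := fun v => {b | ∃ u ∈ S, G.Adj v u ∧ val b = u}
  let J : Finset (Fin n) := {v | #S < 12 * e ^ 2 * #{u ∈ S | G.Adj v u}}
  have hr : ∀ v ∈ J, β / (24 * e ^ 2) * Fintype.card U ≤ #(r v) := by
    intro v hv
    have h1 : #S < 12 * e ^ 2 * #{u ∈ S | G.Adj v u} := (mem_filter.1 hv).2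
    have h2 : #{u ∈ S | G.Adj v u} ≤ #(r v) := by
      choose b hb using hval
      refine card_le_card_of_injOn b ?_ ?_
      · intro u hu
        obtain ⟨h3, h4⟩ := mem_filter.1 hu
        exact mem_filter.2 ⟨mem_univ _, u, h3, h4, hb u⟩
      · intro u _ u' _ h
        exact Fin.ext (by rw [← hb u, ← hb u', h])
    have h3 : (#S : ℝ) ≤ 12 * e ^ 2 * #(r v) := by
      exact_mod_cast h1.le.trans (Nat.mul_le_mul_left _ h2)
    have h4 : (Fintype.card U : ℝ) ≤ 2 * n := by exact_mod_cast hU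
    have he1 : (1 : ℝ) ≤ e := by exact_mod_cast he
    rw [div_mul_eq_mul_div, div_le_iff₀ (by positivity)]
    nlinarith
  have htr : ∀ Y : Finset U, #(J.image fun i => r i ∩ Y) ≤ (#Y + 1) ^ d := by
    intro Y
    let 𝒜 : Finset (Finset (Fin n)) := univ.image fun v : Fin n => G.neighborFinset v
    -- The VC bound holds on vertices. The trace of a range on `Y` is determined by the trace of the
    -- neighbourhood on the vertices with a code in `Y`, through the map `g` below.
    let Y' : Finset (Fin n) := {u | ∃ b ∈ Y, val b = u}
    have hY' : #Y' ≤ #Y := by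
      have h1 : #(Y'.image fun u : Fin n => (u : ℕ)) ≤ #(Y.image val) := by
        refine card_le_card fun k hk => ?_
        obtain ⟨u, hu, rfl⟩ := mem_image.1 hk
        obtain ⟨b, hb, hbu⟩ := (mem_filter.1 hu).2
        exact mem_image.2 ⟨b, hb, hbu⟩
      rw [card_image_of_injective _ Fin.val_injective] at h1
      exact h1.trans card_image_le
    have h𝒜 : 𝒜.vcDim ≤ d := by
      unfold SimpleGraph.nbhdVCDim at hd
      convert hd
    let g : Finset (Fin n) → Finset U := fun s => {b ∈ Y | ∃ u ∈ s, u ∈ S ∧ val b = u}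
    have hsub : (J.image fun i => r i ∩ Y) ⊆ ((𝒜.image fun s => s ∩ Y').image g) := by
      intro τ hτ
      obtain ⟨v, -, rfl⟩ := mem_image.1 hτ
      refine mem_image.2 ⟨G.neighborFinset v ∩ Y',
        mem_image_of_mem _ (mem_image_of_mem _ (mem_univ _)), ?_⟩
      ext b
      simp only [g, r, Y', mem_filter, mem_inter, mem_univ, true_and, SimpleGraph.mem_neighborFinset]
      constructor
      · rintro ⟨h1, u, ⟨h2, -⟩, h3, h4⟩
        exact ⟨⟨u, h3, h2, h4⟩, h1⟩
      · rintro ⟨⟨u, h2, h3, h4⟩, h1⟩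
        exact ⟨h1, u, ⟨h3, b, h1, h4⟩, h2, h4⟩
    calc _ ≤ _ := card_le_card hsub
      _ ≤ _ := card_image_le
      _ ≤ (#Y' + 1) ^ d := card_traces_le 𝒜 h𝒜 Y'
      _ ≤ _ := Nat.pow_le_pow_left (by omega) d
  have hmain := card_non_nets_le J r d M t _ htr hr ht
  have hset : (univ.filter fun A : Fin M → U => ∃ v : Fin n,
      #S < 12 * e ^ 2 * #{u ∈ S | G.Adj v u} ∧ ∀ k, ∀ u ∈ S, G.Adj v u → val (A k) ≠ u) =
      univ.filter fun A : Fin M → U => ∃ i ∈ J, ∀ k, A k ∉ r i := by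
    refine filter_congr fun A _ => ?_
    simp only [J, r, mem_filter, mem_univ, true_and]
    refine exists_congr fun v => and_congr_right fun _ => forall_congr' fun k => ?_
    push Not
    rfl
  rw [hset]
  have h8 : (0 : ℝ) < 2 ^ t := by positivity
  have h9 : (0 : ℝ) ≤ (Fintype.card U : ℝ) ^ M := by positivity
  refine le_of_mul_le_mul_right ?_ h8
  have h10 : 2 * (2 * (M : ℝ) + 1) ^ d * (Fintype.card U : ℝ) ^ M ≤
      η * (Fintype.card U : ℝ) ^ M * 2 ^ t := by
    calc _ ≤ η * 2 ^ t * (Fintype.card U : ℝ) ^ M := by gcongr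
      _ = _ := by ring
  refine (le_of_eq ?_).trans (hmain.trans h10)
  congr!

end Net


namespace SimpleGraph

/-! ### Bipartite double covers, auctions and independent sets. -/

section Matching

open Finset

variable {V : Type*} {G : SimpleGraph V}

/-- `m` is the vertex cover number of the bipartite double cover of `G[W]`. -/
def IsCoverNumber (G : SimpleGraph V) (W : Finset V) (m : ℕ) : Prop :=
  (∀ A B, A ⊆ W → B ⊆ W → (∀ u ∈ A, ∀ v ∈ B, ¬ G.Adj u v) → #A + #B + m ≤ 2 * #W) ∧
  ∃ A B, A ⊆ W ∧ B ⊆ W ∧ (∀ u ∈ A, ∀ v ∈ B, ¬ G.Adj u v) ∧ #A + #B + m = 2 * #W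

/-- The two copies of an independent set are independent in the double cover. -/
lemma IsCoverNumber.two_mul_card_add_le {W I : Finset V} {m : ℕ} (h : G.IsCoverNumber W m)
    (hI : I ⊆ W) (hind : G.IsIndepSet I) : 2 * #I + m ≤ 2 * #W := by
  have := h.1 I I hI hI fun u hu v hv huv => hind hu hv huv.ne huv
  omega

/-- An optimal pair without deficit is `(W, W)`. No bipartiteness is needed, so this serves as the
certificate of every output. -/
lemma IsCoverNumber.isIndepSet {W : Finset V} (h : G.IsCoverNumber W 0) : G.IsIndepSet W := by
  obtain ⟨A, B, hA, hB, hAB, hc⟩ := h.2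
  have h1 := card_le_card hA
  have h2 := card_le_card hB
  obtain rfl := eq_of_subset_of_card_le hA (by omega)
  obtain rfl := eq_of_subset_of_card_le hB (by omega)
  exact fun u hu v hv _ => hAB u hu v hv

/-- In a bipartite graph the double cover determines the independence number. -/
lemma IsCoverNumber.exists_isIndepSet [DecidableEq V] {W : Finset V} {m : ℕ} (h : G.IsCoverNumber W m)
    (hχ : ∃ χ : V → Bool, ∀ u v, u ∈ W → v ∈ W → G.Adj u v → χ u ≠ χ v) :
    ∃ I ⊆ W, G.IsIndepSet (I : Set V) ∧ 2 * #I + m = 2 * #W := by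
  obtain ⟨χ, hχ⟩ := hχ
  obtain ⟨A, B, hA, hB, hAB, hc⟩ := h.2
  -- Take one colour class of `A` and the opposite one of `B`. The two choices of `b` give
  -- independent sets of total size `#A + #B`, neither of which can exceed half of it.
  have key : ∀ b : Bool, ∃ I ⊆ W, G.IsIndepSet (I : Set V) ∧
      #I = #(A.filter fun u => χ u = b) + #(B.filter fun u => ¬ χ u = b) := by
    intro b
    refine ⟨(A.filter fun u => χ u = b) ∪ (B.filter fun u => ¬ χ u = b),
      union_subset ((filter_subset _ _).trans hA) ((filter_subset _ _).trans hB), ?_, ?_⟩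
    · intro u hu v hv _ huv
      simp only [coe_union, coe_filter, Set.mem_union, Set.mem_ofPred_eq] at hu hv
      rcases hu with ⟨h1, h2⟩ | ⟨h1, h2⟩ <;> rcases hv with ⟨h3, h4⟩ | ⟨h3, h4⟩
      · exact hχ u v (hA h1) (hA h3) huv (h2.trans h4.symm)
      · exact hAB u h1 v h3 huv
      · exact hAB v h3 u h1 huv.symm
      · refine hχ u v (hB h1) (hB h3) huv ?_
        cases hu : χ u <;> cases hv : χ v <;> cases b <;> simp_all
    · rw [card_union_of_disjoint]
      rw [Finset.disjoint_left]
      intro u hu hu'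
      exact (mem_filter.1 hu').2 (mem_filter.1 hu).2
  obtain ⟨I, hI, hI', hIc⟩ := key true
  obtain ⟨J, hJ, hJ', hJc⟩ := key false
  have h1 := card_filter_add_card_filter_not (s := A) (fun u => χ u = true)
  have h2 := card_filter_add_card_filter_not (s := B) (fun u => χ u = true)
  simp only [Bool.not_eq_true, Bool.not_eq_false] at h1 h2 hIc hJc
  have h3 := h.two_mul_card_add_le hI hI'
  have h4 := h.two_mul_card_add_le hJ hJ'
  exact ⟨I, hI, hI', by omega⟩

/-- The state of the reduction of a bipartite graph to a maximum independent set: the vertices in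
`D` have been examined, and those still in `W` cannot be spared. -/
structure IsReduction (G : SimpleGraph V) (W D : Finset V) (m a : ℕ) : Prop where
  count : 2 * a + m = 2 * #W
  attained : ∃ I ⊆ W, G.IsIndepSet (I : Set V) ∧ #I = a
  forced : ∀ w ∈ W, w ∈ D → ∀ I ⊆ W, G.IsIndepSet (I : Set V) → #I = a → w ∈ I

/-- An independent set of size `a` that avoids `w` would lie in `W.erase w`, where the unchanged
cover number only leaves room for `a - 1` elements. -/
lemma IsReduction.keep [DecidableEq V] {W D : Finset V} {m a : ℕ} (h : G.IsReduction W D m a) {w : V} (hw : w ∈ W)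
    (hm : G.IsCoverNumber (W.erase w) m) : G.IsReduction W (insert w D) m a := by
  refine ⟨h.count, h.attained, fun z hz hzD I hI hind hIa => ?_⟩
  rcases mem_insert.1 hzD with rfl | hzD
  · by_contra hzI
    have h1 := hm.two_mul_card_add_le (subset_erase.2 ⟨hI, hzI⟩) hind
    rw [card_erase_of_mem hw] at h1
    have h2 := card_pos.2 ⟨z, hw⟩
    have := h.count
    omega
  · exact h.forced z hz hzD I hI hind hIa

/-- Deleting `w` lowers the independence number by at most one. If it dropped, the two counting
identities would give `m' = m`; so it stays the same. -/
lemma IsReduction.erase [DecidableEq V] {W D : Finset V} {m m' a : ℕ} (h : G.IsReduction W D m a)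
    (hW : G.IsCoverNumber W m) {w : V} (hw : w ∈ W) (hm : G.IsCoverNumber (W.erase w) m')
    (hne : m' ≠ m)
    (hχ : ∃ χ : V → Bool, ∀ u v, u ∈ W → v ∈ W → G.Adj u v → χ u ≠ χ v) :
    G.IsReduction (W.erase w) (insert w D) m' a := by
  obtain ⟨I, hI, hind, hc⟩ := hm.exists_isIndepSet
    (hχ.imp fun χ h u v hu hv => h u v (mem_of_mem_erase hu) (mem_of_mem_erase hv))
  have hcount := h.count
  have h1 := hW.two_mul_card_add_le (hI.trans (erase_subset w W)) hind
  obtain ⟨J, hJ, hJind, hJa⟩ := h.attained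
  have h2 := hm.two_mul_card_add_le (erase_subset_erase w hJ)
    (hJind.mono (by exact_mod_cast erase_subset w J))
  have h3 := pred_card_le_card_erase (s := J) (a := w)
  have h4 := card_pos.2 ⟨w, hw⟩
  have h5 := card_erase_of_mem hw
  have hIa : #I = a := by omega
  refine ⟨by omega, ⟨I, hI, hind, hIa⟩, fun z hz hzD K hK hKind hKa => ?_⟩
  rcases mem_insert.1 hzD with rfl | hzD
  · simp at hz
  · exact h.forced z (mem_of_mem_erase hz) hzD K (hK.trans (erase_subset w W)) hKind hKa

lemma IsReduction.insert_of_notMem [DecidableEq V] {W D : Finset V} {m a : ℕ} (h : G.IsReduction W D m a) {w : V}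
    (hw : w ∉ W) : G.IsReduction W (insert w D) m a := by
  refine ⟨h.count, h.attained, fun z hz hzD => ?_⟩
  rcases mem_insert.1 hzD with rfl | hzD
  · exact absurd hz hw
  · exact h.forced z hz hzD

/-- When every vertex has been examined, all of `W` is forced into one independent set, which is
therefore `W`. -/
lemma IsReduction.eq_zero [Fintype V] {W : Finset V} {m a : ℕ} (h : G.IsReduction W univ m a) :
    m = 0 ∧ #W = a := by
  obtain ⟨I, hI, hind, hIa⟩ := h.attained
  have : W ⊆ I := fun w hw => h.forced w hw (mem_univ _) I hI hind hIa
  have := card_le_card this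
  have := card_le_card hI
  have := h.count
  omega

/-- The invariants of an auction in which the vertices of one copy of `W` bid for those of the
other: `own v u` says that `u` holds `v`, at the given price. -/
structure IsAuction (G : SimpleGraph V) (W : Finset V) (price : V → ℕ) (own : V → V → Prop) :
    Prop where
  mem : ∀ v u, own v u → u ∈ W ∧ v ∈ W ∧ G.Adj u v
  left : ∀ v v' u, own v u → own v' u → v = v'
  right : ∀ v u u', own v u → own v u' → u = u'
  pos : ∀ v, 0 < price v ↔ ∃ u, own v u
  slack : ∀ v u, own v u → ∀ v' ∈ W, G.Adj u v' → price v ≤ price v' + 1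

/-- The bidder pays one more than the minimum over its neighbours, which is its slack condition. For
the other owners the right-hand sides only grow; the former owner of `v` loses it. -/
lemma IsAuction.bid [DecidableEq V] {W : Finset V} {price : V → ℕ} {own : V → V → Prop}
    (h : G.IsAuction W price own) {u v : V} (hu : u ∈ W) (hv : v ∈ W) (huv : G.Adj u v)
    (hfree : ∀ z, ¬ own z u) (hmin : ∀ z ∈ W, G.Adj u z → price v ≤ price z)
    {price' : V → ℕ} {own' : V → V → Prop}
    (hp : ∀ z, price' z = if z = v then price v + 1 else price z)
    (ho : ∀ z w, own' z w ↔ if z = v then w = u else own z w) :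
    G.IsAuction W price' own' where
  mem z w hzw := by
    rw [ho] at hzw
    split_ifs at hzw with hz
    · subst hz; subst hzw; exact ⟨hu, hv, huv⟩
    · exact h.mem z w hzw
  left z z' w h1 h2 := by
    rw [ho] at h1 h2
    split_ifs at h1 h2 with hz hz' hz'
    · exact hz.trans hz'.symm
    · subst h1; exact absurd h2 (hfree _)
    · subst h2; exact absurd h1 (hfree _)
    · exact h.left _ _ _ h1 h2
  right z w w' h1 h2 := by
    rw [ho] at h1 h2
    split_ifs at h1 h2 with hz
    · exact h1.trans h2.symm
    · exact h.right _ _ _ h1 h2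
  pos z := by
    rw [hp]
    simp only [ho]
    split_ifs with hz
    · simp
    · exact h.pos z
  slack z w hzw z' hz' hadj := by
    rw [ho] at hzw
    rw [hp, hp]
    split_ifs at hzw with hz
    · subst hzw
      have := hmin z' hz' hadj
      split_ifs <;> omega
    · have := h.slack z w hzw z' hz' hadj
      split_ifs with h1
      · subst h1; omega
      · omega

/-- When nobody can bid any more, the number of sold vertices is the vertex cover number. -/
lemma IsAuction.isCoverNumber [Fintype V] {W : Finset V} {price : V → ℕ} {own : V → V → Prop} {I : ℕ}
    (h : G.IsAuction W price own) (hI : Fintype.card V < I)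
    (hfin : ∀ u ∈ W, (∀ v, ¬ own v u) → ∀ v ∈ W, G.Adj u v → I ≤ price v) :
    G.IsCoverNumber W #{v | 0 < price v} := by
  classical
  set Z : Finset V := {v | 0 < price v} with hZ
  have hmemZ : ∀ v, v ∈ Z ↔ ∃ u, own v u := fun v => by rw [hZ, mem_filter, ← h.pos]; simp
  have hZW : Z ⊆ W := fun v hv => by
    obtain ⟨u, hu⟩ := (hmemZ v).1 hv
    exact (h.mem v u hu).2.1
  -- Weak duality: the sold vertices with their owners form a matching of the double cover. An edge
  -- of it has its owner outside `A` or its sold vertex outside `B`.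
  have hweak : ∀ A B, A ⊆ W → B ⊆ W → (∀ u ∈ A, ∀ v ∈ B, ¬ G.Adj u v) →
      #A + #B + #Z ≤ 2 * #W := by
    intro A B hA hB hAB
    choose! o ho using fun v (hv : v ∈ Z) => (hmemZ v).1 hv
    have h1 : #(Z.filter fun v => v ∈ B) + #(Z.filter fun v => ¬ v ∈ B) = #Z :=
      card_filter_add_card_filter_not _
    have h2 : #(Z.filter fun v => ¬ v ∈ B) ≤ #(W \ B) := card_le_card fun v hv => by
      rw [mem_filter] at hv
      exact mem_sdiff.2 ⟨hZW hv.1, hv.2⟩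
    have h3 : #(Z.filter fun v => v ∈ B) ≤ #(W \ A) := by
      refine card_le_card_of_injOn o (fun v hv => ?_) fun v hv v' hv' hvv => ?_
      · obtain ⟨h4, h5⟩ := mem_filter.1 hv
        obtain ⟨h6, -, h7⟩ := h.mem _ _ (ho v h4)
        exact mem_coe.2 (mem_sdiff.2 ⟨h6, fun h8 => hAB _ h8 v h5 h7⟩)
      · refine h.left _ _ _ (ho v (mem_filter.1 hv).1) ?_
        rw [hvv]
        exact ho v' (mem_filter.1 hv').1
    rw [card_sdiff_of_subset hA] at h3
    rw [card_sdiff_of_subset hB] at h2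
    have := card_le_card hA
    have := card_le_card hB
    omega
  refine ⟨hweak, ?_⟩
  -- There are `|V| + 1` candidates and at most `|V|` prices, so some `k` is not a price; moreover
  -- `k ≤ I`. The gap at `k` absorbs the slack of one in the prices.
  obtain ⟨k, hk, hkp⟩ : ∃ k ∈ Icc 1 (Fintype.card V + 1), k ∉ univ.image price := by
    by_contra! hno
    have h1 := card_le_card (show Icc 1 (Fintype.card V + 1) ⊆ univ.image price from hno)
    have h2 : #(univ.image price) ≤ Fintype.card V := card_image_le
    rw [Nat.card_Icc] at h1
    omega
  rw [mem_Icc] at hk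
  have hgap : ∀ v, k ≤ price v → k < price v := fun v hv =>
    lt_of_le_of_ne hv fun h => hkp (h ▸ mem_image_of_mem price (mem_univ v))
  set A : Finset V := W.filter fun u => ∀ v ∈ W, G.Adj u v → k < price v with hA
  set B : Finset V := W.filter fun v => ¬ k < price v with hB
  have hAB : ∀ u ∈ A, ∀ v ∈ B, ¬ G.Adj u v := fun u hu v hv huv =>
    (mem_filter.1 hv).2 ((mem_filter.1 hu).2 v (mem_filter.1 hv).1 huv)
  refine ⟨A, B, filter_subset _ _, filter_subset _ _, hAB, ?_⟩
  have h1 := hweak A B (filter_subset _ _) (filter_subset _ _) hAB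
  have h2 : #(W.filter fun v => k < price v) + #B = #W := card_filter_add_card_filter_not _
  have h3 : #A + #(W.filter fun u => ¬ ∀ v ∈ W, G.Adj u v → k < price v) = #W :=
    card_filter_add_card_filter_not _
  have h4 : #(Z.filter fun v => k < price v) + #(Z.filter fun v => ¬ k < price v) = #Z :=
    card_filter_add_card_filter_not _
  have h5 : Z.filter (fun v => k < price v) = W.filter fun v => k < price v := by
    ext v
    simp only [mem_filter (s := W), mem_filter (s := Z)]
    refine ⟨fun hv => ⟨hZW hv.1, hv.2⟩, fun hv => ⟨?_, hv.2⟩⟩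
    simp only [hZ, mem_filter, mem_univ, true_and]
    exact Nat.zero_lt_of_lt hv.2
  -- A vertex outside `A` has a neighbour priced below `k`. So it is not free, and by slack and the
  -- gap it holds a vertex priced below `k`. Owners being unique, the deficits of `A` and `B` are
  -- together at most the number of sold vertices.
  have h6 : #(W.filter fun u => ¬ ∀ v ∈ W, G.Adj u v → k < price v) ≤
      #(Z.filter fun v => ¬ k < price v) := by
    have key : ∀ u ∈ W.filter fun u => ¬ ∀ v ∈ W, G.Adj u v → k < price v,
        ∃ v, own v u ∧ ¬ k < price v := by
      intro u hu
      obtain ⟨huW, hu⟩ := mem_filter.1 hu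
      have hown : ∃ v, own v u := by
        by_contra! hno
        exact hu fun v hv huv => hgap v (by have := hfin u huW hno v hv huv; omega)
      obtain ⟨v, hv⟩ := hown
      refine ⟨v, hv, fun hkv => hu fun v' hv' huv' => hgap v' ?_⟩
      have := h.slack v u hv v' hv' huv'
      omega
    choose! o ho using key
    refine card_le_card_of_injOn o (fun u hu => ?_) fun u hu u' hu' huu => ?_
    · exact mem_coe.2 (mem_filter.2 ⟨(hmemZ _).2 ⟨u, (ho u hu).1⟩, (ho u hu).2⟩)
    · refine h.right _ _ _ (ho u hu).1 ?_
      rw [huu]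
      exact (ho u' hu').1
  rw [h5] at h4
  omega

end Matching

end SimpleGraph


/-! ### Structured programs: effect, cost and compilation. -/

namespace RAM

namespace Store

/-- Put `v` into register `x`. -/
def setReg (s : Store) (x v : ℕ) : Store := { s with reg := Function.update s.reg x v }

/-- Put `v` into bank `a` at address `i`. -/
def setMem (s : Store) (a i v : ℕ) : Store :=
  { s with mem := Function.update s.mem a (Function.update (s.mem a) i v) }

@[simp] lemma setReg_reg (s : Store) (x v y : ℕ) :
    (s.setReg x v).reg y = if y = x then v else s.reg y := by
  simp [setReg, Function.update_apply]

@[simp] lemma setReg_mem (s : Store) (x v : ℕ) : (s.setReg x v).mem = s.mem := rfl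

@[simp] lemma setReg_coins (s : Store) (x v : ℕ) : (s.setReg x v).coins = s.coins := rfl

@[simp] lemma setMem_reg (s : Store) (a i v : ℕ) : (s.setMem a i v).reg = s.reg := rfl

@[simp] lemma setMem_coins (s : Store) (a i v : ℕ) : (s.setMem a i v).coins = s.coins := rfl

lemma setMem_mem (s : Store) (a i v b j : ℕ) :
    (s.setMem a i v).mem b j = if b = a ∧ j = i then v else s.mem b j := by
  by_cases hb : b = a
  · subst hb; simp [setMem, Function.update_apply]
  · simp [setMem, hb]

lemma setMem_mem_of_ne (s : Store) {a b : ℕ} (i v : ℕ) (h : b ≠ a) :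
    (s.setMem a i v).mem b = s.mem b := by
  simp [setMem, h]

@[simp] lemma setReg_setReg (s : Store) (x v w : ℕ) : (s.setReg x v).setReg x w = s.setReg x w := by
  simp [setReg]

lemma setReg_self (s : Store) (x : ℕ) : s.setReg x (s.reg x) = s := by
  simp [setReg]

end Store

/-- Structured programs: the only loops are those that let a register `x` run downwards from
the content of a register `b`, exclusively, to `0`. -/
inductive Prog where
  | skip
  | assign (x : ℕ) (e : Expr)
  | store (a : ℕ) (addr e : Expr)
  | flip (x : ℕ)
  | seq (P Q : Prog)
  | ite (e : Expr) (P Q : Prog)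
  | loop (x b : ℕ) (P : Prog)

namespace Prog

/-- The translation into programs of the machine. -/
def compile : Prog → Cmd
  | skip => .skip
  | assign x e => .assign x e
  | store a i e => .store a i e
  | flip x => .flip x
  | seq P Q => .seq P.compile Q.compile
  | ite e P Q => .ite e P.compile Q.compile
  | loop x b P => .seq (.assign x (.reg b))
      (.loop (.reg x) (.seq (.assign x (.sub (.reg x) (.lit 1))) P.compile))

/-- Iterate a transformation of the data while register `x` runs downwards from `k`. -/
def iter (f : Store → Store) (x : ℕ) : ℕ → Store → Store
  | 0, s => s.setReg x 0
  | k + 1, s => iter f x k (f (s.setReg x k))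

/-- The number of steps of such an iteration. -/
def iterCost (f : Store → Store) (c : Store → ℕ) (x : ℕ) : ℕ → Store → ℕ
  | 0, _ => 1
  | k + 1, s => 3 + c (s.setReg x k) + iterCost f c x k (f (s.setReg x k))

/-- The effect of a program. -/
def den : Prog → Store → Store
  | skip, s => s
  | assign x e, s => s.setReg x (e.eval s)
  | store a i e, s => s.setMem a (i.eval s) (e.eval s)
  | flip x, s =>
      match s.coins with
      | [] => s
      | b :: bs => { s.setReg x b.toNat with coins := bs }
  | seq P Q, s => Q.den (P.den s)
  | ite e P Q, s => if e.eval s ≠ 0 then P.den s else Q.den s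
  | loop x b P, s => iter P.den x (s.reg b) s

/-- The number of steps of a program. -/
def cost : Prog → Store → ℕ
  | skip, _ => 1
  | assign _ _, _ => 1
  | store _ _ _, _ => 1
  | flip _, _ => 1
  | seq P Q, s => 1 + P.cost s + Q.cost (P.den s)
  | ite e P Q, s => 1 + if e.eval s ≠ 0 then P.cost s else Q.cost s
  | loop x b P, s => 2 + iterCost P.den P.cost x (s.reg b) (s.setReg x (s.reg b))

/-- Does the program write to register `y`? -/
def wr (y : ℕ) : Prog → Bool
  | skip => false
  | assign x _ => y == x
  | store _ _ _ => false
  | flip x => y == x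
  | seq P Q => P.wr y || Q.wr y
  | ite _ P Q => P.wr y || Q.wr y
  | loop x _ P => y == x || P.wr y

/-- Does the program write to bank `b`? -/
def wm (b : ℕ) : Prog → Bool
  | skip => false
  | assign _ _ => false
  | store a _ _ => b == a
  | flip _ => false
  | seq P Q => P.wm b || Q.wm b
  | ite _ P Q => P.wm b || Q.wm b
  | loop _ _ P => P.wm b

/-- The loops are bounded by registers in `R`, nothing is written to the registers in `R`, and
the loop counters are not written to in the body of the loop. -/
def std (R : ℕ → Bool) : Prog → Bool
  | skip => true
  | assign x _ => !R x
  | store _ _ _ => true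
  | flip x => !R x
  | seq P Q => P.std R && Q.std R
  | ite _ P Q => P.std R && Q.std R
  | loop x b P => !R x && R b && !P.wr x && P.std R

/-- Programs without coin flips. -/
def coinFree : Prog → Bool
  | skip => true
  | assign _ _ => true
  | store _ _ _ => true
  | flip _ => false
  | seq P Q => P.coinFree && Q.coinFree
  | ite _ P Q => P.coinFree && Q.coinFree
  | loop _ _ P => P.coinFree

/-- The size of a program. -/
def size : Prog → ℕ
  | skip => 1
  | assign _ _ => 1
  | store _ _ _ => 1
  | flip _ => 1
  | seq P Q => 1 + P.size + Q.size
  | ite _ P Q => 1 + P.size + Q.size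
  | loop _ _ P => 3 + P.size

/-- The nesting depth of the loops. -/
def depth : Prog → ℕ
  | skip => 0
  | assign _ _ => 0
  | store _ _ _ => 0
  | flip _ => 0
  | seq P Q => max P.depth Q.depth
  | ite _ P Q => max P.depth Q.depth
  | loop _ _ P => P.depth + 1

/-- Every round, and also the final exit, overwrites the counter before anything reads it. -/
lemma iter_setReg (f : Store → Store) (x k : ℕ) (s : Store) (v : ℕ) :
    iter f x k (s.setReg x v) = iter f x k s := by
  cases k <;> simp [iter]

lemma iter_induction {f : Store → Store} {x : ℕ} {p : Store → Prop}
    (hset : ∀ s v, p s → p (s.setReg x v)) (hf : ∀ s, p s → p (f s)) (k : ℕ) (s : Store)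
    (hs : p s) : p (iter f x k s) := by
  induction k generalizing s with
  | zero => exact hset s 0 hs
  | succ k ih => exact ih _ (hf _ (hset _ _ hs))

lemma den_reg {P : Prog} {y : ℕ} (h : P.wr y = false) (s : Store) :
    (P.den s).reg y = s.reg y := by
  induction P generalizing s with
  | skip => rfl
  | assign x e =>
    have : y ≠ x := by simpa [wr] using h
    simp [den, this]
  | store a i e => rfl
  | flip x =>
    have : y ≠ x := by simpa [wr] using h
    simp only [den]
    split <;> simp [this]
  | seq P Q hP hQ =>
    simp only [wr, Bool.or_eq_false_iff] at h
    simp only [den]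
    rw [hQ h.2, hP h.1]
  | ite e P Q hP hQ =>
    simp only [wr, Bool.or_eq_false_iff] at h
    simp only [den]
    split_ifs
    · exact hP h.1 s
    · exact hQ h.2 s
  | loop x b P hP =>
    simp only [wr, Bool.or_eq_false_iff, beq_eq_false_iff_ne] at h
    refine iter_induction (p := fun s' => s'.reg y = s.reg y) (fun s' v h' => ?_)
      (fun s' h' => (hP h.2 s').trans h') _ s rfl
    simp [h.1, h']

lemma den_mem {P : Prog} {a : ℕ} (h : P.wm a = false) (s : Store) :
    (P.den s).mem a = s.mem a := by
  induction P generalizing s with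
  | skip => rfl
  | assign x e => rfl
  | store b i e =>
    have : a ≠ b := by simpa [wm] using h
    exact s.setMem_mem_of_ne _ _ this
  | flip x =>
    simp only [den]
    split <;> rfl
  | seq P Q hP hQ =>
    simp only [wm, Bool.or_eq_false_iff] at h
    simp only [den]
    rw [hQ h.2, hP h.1]
  | ite e P Q hP hQ =>
    simp only [wm, Bool.or_eq_false_iff] at h
    simp only [den]
    split_ifs
    · exact hP h.1 s
    · exact hQ h.2 s
  | loop x b P hP =>
    exact iter_induction (p := fun s' => s'.mem a = s.mem a) (fun s' v h' => h')
      (fun s' h' => (hP h s').trans h') _ s rfl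

lemma wr_of_std {R : ℕ → Bool} {P : Prog} (h : P.std R = true) {y : ℕ} (hy : R y = true) :
    P.wr y = false := by
  induction P with
  | skip => rfl
  | assign x e =>
    simp only [wr, beq_eq_false_iff_ne]
    rintro rfl
    simp [std, hy] at h
  | store => rfl
  | flip x =>
    simp only [wr, beq_eq_false_iff_ne]
    rintro rfl
    simp [std, hy] at h
  | seq P Q hP hQ =>
    simp only [std, Bool.and_eq_true] at h
    simp [wr, hP h.1, hQ h.2]
  | ite e P Q hP hQ =>
    simp only [std, Bool.and_eq_true] at h
    simp [wr, hP h.1, hQ h.2]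
  | loop x b P hP =>
    simp only [std, Bool.and_eq_true, Bool.not_eq_true'] at h
    simp only [wr, Bool.or_eq_false_iff, beq_eq_false_iff_ne]
    refine ⟨?_, hP h.2⟩
    rintro rfl
    simp [hy] at h

lemma den_reg_of_std {R : ℕ → Bool} {P : Prog} (h : P.std R = true) {y : ℕ} (hy : R y = true)
    (s : Store) : (P.den s).reg y = s.reg y :=
  den_reg (wr_of_std h hy) s

/-- The agreement of two stores on everything that a loop with counter `x` and body `P` does not
write to. -/
structure Agree (P : Prog) (x : ℕ) (s₀ s : Store) : Prop where
  reg : ∀ y, y ≠ x → P.wr y = false → s.reg y = s₀.reg y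
  mem : ∀ a, P.wm a = false → s.mem a = s₀.mem a

/-- Loop invariants: `Inv k` holds when the counter has the value `k`. -/
theorem loop_inv {P : Prog} {x b : ℕ} {s₀ : Store} (Inv : ℕ → Store → Prop)
    (hset : ∀ k s v, Inv k s → Inv k (s.setReg x v)) (h₀ : Inv (s₀.reg b) s₀)
    (hstep : ∀ k < s₀.reg b, ∀ s, Agree P x s₀ s → s.reg x = k → Inv (k + 1) s →
      Inv k (P.den s)) :
    Inv 0 ((loop x b P).den s₀) := by
  have key : ∀ k ≤ s₀.reg b, ∀ s, Agree P x s₀ s → Inv k s → Inv 0 (iter P.den x k s) := by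
    intro k
    induction k with
    | zero => intro _ s _ h; exact hset _ _ _ h
    | succ k ih =>
      intro hk s hA h
      have hA' : Agree P x s₀ (s.setReg x k) :=
        ⟨fun y hy hw => by rw [Store.setReg_reg, if_neg hy]; exact hA.reg y hy hw, hA.mem⟩
      refine ih (by omega) _ ⟨fun y hy hw => ?_, fun a ha => ?_⟩
        (hstep k (by omega) _ hA' (by simp) (hset _ _ _ h))
      · rw [den_reg hw]; exact hA'.reg y hy hw
      · rw [den_mem ha]; exact hA'.mem a ha
  exact key _ le_rfl s₀ ⟨fun _ _ _ => rfl, fun _ _ => rfl⟩ h₀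

/-- An invariant which in one distinguished round is strengthened to something that persists. -/
theorem loop_hit {P : Prog} {x b : ℕ} {s₀ : Store} (Inv Hit : Store → Prop)
    (hset : ∀ s v, Inv s → Inv (s.setReg x v)) (hset' : ∀ s v, Hit s → Hit (s.setReg x v))
    (h₀ : Inv s₀) (hInv : ∀ s, Agree P x s₀ s → s.reg x < s₀.reg b → Inv s → Inv (P.den s))
    (hHit : ∀ s, Agree P x s₀ s → s.reg x < s₀.reg b → Inv s → Hit s → Hit (P.den s))
    {k : ℕ} (hk : k < s₀.reg b)
    (hnew : ∀ s, Agree P x s₀ s → s.reg x = k → Inv s → Hit (P.den s)) :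
    Hit ((loop x b P).den s₀) := by
  have := loop_inv (P := P) (x := x) (b := b) (s₀ := s₀)
    -- The counter runs downwards, so round `k` is over as soon as the counter is at most `k`.
    (fun m s => Inv s ∧ (m ≤ k → Hit s))
    (fun m s v h => ⟨hset s v h.1, fun hm => hset' s v (h.2 hm)⟩)
    ⟨h₀, fun h => absurd h (by omega)⟩
    (fun m hm s hA hx h => by
      refine ⟨hInv s hA (by omega) h.1, fun hmk => ?_⟩
      rcases Nat.lt_or_ge m k with h1 | h1
      · exact hHit s hA (by omega) h.1 (h.2 (by omega))
      · exact hnew s hA (by omega) h.1)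
  exact this.2 (Nat.zero_le _)

end Prog

/-- The program `P` turns the data `s` into `s'` in `t` steps. -/
def Exec (P : Cmd) (s s' : Store) (t : ℕ) : Prop :=
  ∀ K, step^[t] ⟨P :: K, s⟩ = ⟨K, s'⟩

lemma Exec.seq {P Q : Cmd} {s s' s'' : Store} {t t' : ℕ} (hP : Exec P s s' t)
    (hQ : Exec Q s' s'' t') : Exec (.seq P Q) s s'' (1 + t + t') := by
  intro K
  rw [show 1 + t + t' = t' + (t + 1) by omega, Function.iterate_add_apply,
    Function.iterate_succ_apply]
  simp only [step]
  rw [hP, hQ]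

lemma Exec.assign (x : ℕ) (e : Expr) (s : Store) :
    Exec (.assign x e) s (s.setReg x (e.eval s)) 1 := fun _ => rfl

lemma Exec.loop_zero {e : Expr} {P : Cmd} {s : Store} (h : e.eval s = 0) :
    Exec (.loop e P) s s 1 := by
  intro K
  simp [step, h]

lemma Exec.loop_succ {e : Expr} {P : Cmd} {s s' s'' : Store} {t t' : ℕ} (h : e.eval s ≠ 0)
    (hP : Exec P s s' t) (hL : Exec (.loop e P) s' s'' t') :
    Exec (.loop e P) s s'' (1 + t + t') := by
  intro K
  rw [show 1 + t + t' = t' + (t + 1) by omega, Function.iterate_add_apply,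
    Function.iterate_succ_apply]
  simp only [step, h, ne_eq, not_false_eq_true, if_true]
  rw [hP, hL]

lemma Exec.halted {P : Cmd} {s s' : Store} {t T : ℕ} (h : Exec P s s' t) (hT : t ≤ T) :
    P.run s T = ⟨[], s'⟩ := by
  have h1 : ∀ k, step^[k] ⟨[], s'⟩ = ⟨[], s'⟩ := by
    intro k
    induction k with
    | zero => rfl
    | succ k ih => rw [Function.iterate_succ_apply]; exact ih
  obtain ⟨k, rfl⟩ := Nat.exists_eq_add_of_le hT
  rw [Cmd.run, Nat.add_comm t k, Function.iterate_add_apply, h [], h1]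

namespace Prog

/-- A flip takes a step and at most one coin, so a supply as large as the cost never runs out. -/
lemma coins_le (P : Prog) (s : Store) : s.coins.length ≤ (P.den s).coins.length + P.cost s := by
  induction P generalizing s with
  | skip => simp [den]
  | assign x e => simp [den]
  | store a i e => simp [den]
  | flip x =>
    simp only [den, cost]
    split <;> rename_i h
    · simp [h]
    · simp [h]
  | seq P Q hP hQ =>
    have := hP s
    have := hQ (P.den s)
    simp only [den, cost]
    omega
  | ite e P Q hP hQ =>
    simp only [den, cost]
    split_ifs
    · have := hP s; omega
    · have := hQ s; omega
  | loop x b P hP =>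
    have key : ∀ k s', s'.coins.length ≤
        (iter P.den x k s').coins.length + iterCost P.den P.cost x k s' := by
      intro k
      induction k with
      | zero => intro s'; simp [iter]
      | succ k ih =>
        intro s'
        have h1 := hP (s'.setReg x k)
        have h2 := ih (P.den (s'.setReg x k))
        simp only [iter, iterCost, Store.setReg_coins] at h1 h2 ⊢
        omega
    have := key (s.reg b) (s.setReg x (s.reg b))
    rw [iter_setReg, Store.setReg_coins] at this
    simp only [den, cost]
    omega

/-- Without coins a flip blocks the machine but has no effect in the denotation; the alternative in
`hc` excludes this. -/
theorem exec_compile {R : ℕ → Bool} {P : Prog} (hstd : P.std R = true) (s : Store)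
    (hc : P.coinFree = true ∨ P.cost s ≤ s.coins.length) :
    Exec P.compile s (P.den s) (P.cost s) := by
  induction P generalizing s with
  | skip => exact fun _ => rfl
  | assign x e => exact fun _ => rfl
  | store a i e => exact fun _ => rfl
  | flip x =>
    intro K
    have hc : 1 ≤ s.coins.length := by simpa [coinFree, cost] using hc
    obtain ⟨reg, mem, coins⟩ := s
    cases coins with
    | nil => simp at hc
    | cons b bs => rfl
  | seq P Q hP hQ =>
    simp only [std, Bool.and_eq_true] at hstd
    simp only [coinFree, Bool.and_eq_true, cost] at hc
    refine Exec.seq (hP hstd.1 s ?_) (hQ hstd.2 _ ?_)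
    · exact hc.imp (·.1) fun h => by omega
    · exact hc.imp (·.2) fun h => by have := P.coins_le s; omega
  | ite e P Q hP hQ =>
    simp only [std, Bool.and_eq_true] at hstd
    simp only [coinFree, Bool.and_eq_true, cost] at hc
    intro K
    simp only [cost, den, compile]
    rw [Nat.add_comm, Function.iterate_add_apply, Function.iterate_one]
    simp only [step]
    split_ifs with he
    · exact hP hstd.1 s (hc.imp (·.1) fun h => by rw [if_pos he] at h; omega) K
    · exact hQ hstd.2 s (hc.imp (·.2) fun h => by rw [if_neg he] at h; omega) K
  | loop x b P hP =>
    simp only [std, Bool.and_eq_true, Bool.not_eq_true'] at hstd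
    have key : ∀ k s', s'.reg x = k →
        (P.coinFree = true ∨ iterCost P.den P.cost x k s' ≤ s'.coins.length) →
        Exec (.loop (.reg x) (.seq (.assign x (.sub (.reg x) (.lit 1))) P.compile)) s'
          (iter P.den x k s') (iterCost P.den P.cost x k s') := by
      intro k
      induction k with
      | zero =>
        intro s' hx _
        have : iter P.den x 0 s' = s' := by
          simp only [iter]
          rw [← hx, Store.setReg_self]
        rw [this]
        exact Exec.loop_zero hx
      | succ k ih =>
        intro s' hx hc'
        have h1 : (Expr.sub (.reg x) (.lit 1)).eval s' = k := by simp [Expr.eval, hx]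
        have h2 := Exec.assign x (.sub (.reg x) (.lit 1)) s'
        rw [h1] at h2
        have h3 := hP hstd.2 (s'.setReg x k) (hc'.imp id fun h => by
          simp only [iterCost] at h
          rw [Store.setReg_coins]; omega)
        have h4 := ih (P.den (s'.setReg x k)) (by rw [den_reg hstd.1.2]; simp)
          (hc'.imp id fun h => by
            have := P.coins_le (s'.setReg x k)
            simp only [iterCost, Store.setReg_coins] at h this
            omega)
        have h5 := Exec.loop_succ (e := .reg x) (by simp [Expr.eval, hx]) (h2.seq h3) h4
        simp only [iter, iterCost]
        convert h5 using 1
        omega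
    simp only [coinFree, cost] at hc
    have h1 := (Exec.assign x (.reg b) s).seq (key (s.reg b) (s.setReg x (s.reg b)) (by simp)
      (hc.imp id fun h => by rw [Store.setReg_coins]; omega))
    rw [iter_setReg] at h1
    simp only [cost, den, compile]
    convert h1 using 1

lemma coinFree_compile {P : Prog} (h : P.coinFree = true) : P.compile.CoinFree := by
  induction P with
  | skip => trivial
  | assign => trivial
  | store => trivial
  | flip => simp [coinFree] at h
  | seq P Q hP hQ =>
    simp only [coinFree, Bool.and_eq_true] at h
    exact ⟨hP h.1, hQ h.2⟩
  | ite e P Q hP hQ =>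
    simp only [coinFree, Bool.and_eq_true] at h
    exact ⟨hP h.1, hQ h.2⟩
  | loop x b P hP => exact ⟨trivial, trivial, hP h⟩

/-- The registers that bound loops are never written to, so all loops run at most `X` rounds
throughout, and each level of nesting costs one factor `X + 1`. -/
theorem cost_le {R : ℕ → Bool} {P : Prog} (hstd : P.std R = true) {X : ℕ} (s : Store)
    (hX : ∀ b, R b = true → s.reg b ≤ X) : P.cost s ≤ P.size * (X + 1) ^ P.depth := by
  have hpow : ∀ m, 1 ≤ (X + 1) ^ m := fun m => Nat.one_le_pow _ _ (by omega)
  have hmono : ∀ {m m'}, m ≤ m' → (X + 1) ^ m ≤ (X + 1) ^ m' := fun h =>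
    Nat.pow_le_pow_right (by omega) h
  induction P generalizing s with
  | skip => simp [cost, size, depth]
  | assign x e => simp [cost, size, depth]
  | store a i e => simp [cost, size, depth]
  | flip x => simp [cost, size, depth]
  | seq P Q hP hQ =>
    simp only [std, Bool.and_eq_true] at hstd
    have h1 := hP hstd.1 s hX
    have h2 := hQ hstd.2 (P.den s) fun b hb => by rw [den_reg_of_std hstd.1 hb]; exact hX b hb
    have h3 := Nat.mul_le_mul_left P.size (hmono (le_max_left P.depth Q.depth))
    have h4 := Nat.mul_le_mul_left Q.size (hmono (le_max_right P.depth Q.depth))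
    have h5 := hpow (max P.depth Q.depth)
    simp only [cost, size, depth, add_mul, one_mul]
    omega
  | ite e P Q hP hQ =>
    simp only [std, Bool.and_eq_true] at hstd
    have h1 := hP hstd.1 s hX
    have h2 := hQ hstd.2 s hX
    have h3 := Nat.mul_le_mul_left P.size (hmono (le_max_left P.depth Q.depth))
    have h4 := Nat.mul_le_mul_left Q.size (hmono (le_max_right P.depth Q.depth))
    have h5 := hpow (max P.depth Q.depth)
    simp only [cost, size, depth, add_mul, one_mul]
    split_ifs <;> omega
  | loop x b P hP =>
    simp only [std, Bool.and_eq_true, Bool.not_eq_true'] at hstd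
    set c := P.size * (X + 1) ^ P.depth with hc
    have key : ∀ k s', (∀ b, R b = true → s'.reg b ≤ X) →
        iterCost P.den P.cost x k s' ≤ 1 + k * (3 + c) := by
      intro k
      induction k with
      | zero => intro s' _; simp [iterCost]
      | succ k ih =>
        intro s' hs'
        have h1 : ∀ b, R b = true → (s'.setReg x k).reg b ≤ X := by
          intro b hb
          have : b ≠ x := by
            rintro rfl
            rw [hb] at hstd
            exact absurd hstd.1.1.1 (by simp)
          rw [Store.setReg_reg, if_neg this]
          exact hs' b hb
        have h2 := hP hstd.2 _ h1
        have h3 := ih (P.den (s'.setReg x k)) fun b hb => by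
          rw [den_reg_of_std hstd.2 hb]; exact h1 b hb
        simp only [iterCost, add_mul, one_mul]
        omega
    have h1 := key (s.reg b) (s.setReg x (s.reg b)) (by
      intro b' hb
      have : b' ≠ x := by
        rintro rfl
        rw [hb] at hstd
        exact absurd hstd.1.1.1 (by simp)
      rw [Store.setReg_reg, if_neg this]
      exact hX b' hb)
    have h2 : s.reg b * (3 + c) ≤ X * (3 + c) := Nat.mul_le_mul_right _ (hX b hstd.1.1.2)
    have h3 := hpow P.depth
    have h4 : (3 + P.size) * (X + 1) ^ (P.depth + 1) =
        (X + 1) * (3 * (X + 1) ^ P.depth) + (X + 1) * c := by rw [hc]; ring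
    have h5 : (X + 1) * 3 ≤ (X + 1) * (3 * (X + 1) ^ P.depth) := Nat.mul_le_mul_left _ (by omega)
    simp only [cost, size, depth]
    rw [h4]
    nlinarith

end Prog

end RAM


/-! ### Fixed-point iteration, and distances as its first use. -/

namespace RAM

namespace Prog

open SimpleGraph

/-! ### Repeated scans up to a fixed point -/

/-- A scan either changes nothing, and then everything is in order, or lowers a potential. -/
theorem scan_spec {σ : Type*} {P : Prog} {x b : ℕ} {s₀ : Store} (view : Store → σ)
    (Good : σ → Prop) (ok : ℕ → σ → Prop) (μ : σ → ℕ)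
    (hview : ∀ s v, view (s.setReg x v) = view s)
    (hstep : ∀ s, Agree P x s₀ s → s.reg x < s₀.reg b → Good (view s) →
      Good (view (P.den s)) ∧ ((view (P.den s) = view s ∧ ok (s.reg x) (view s)) ∨
        (μ (view (P.den s)) < μ (view s) ∧ ¬ ok (s.reg x) (view s))))
    (hgood : Good (view s₀)) :
    Good (view ((loop x b P).den s₀)) ∧
      ((view ((loop x b P).den s₀) = view s₀ ∧ ∀ k < s₀.reg b, ok k (view s₀)) ∨
        (μ (view ((loop x b P).den s₀)) < μ (view s₀) ∧ ¬ ∀ k < s₀.reg b, ok k (view s₀))) := by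
  have := loop_inv (P := P) (x := x) (b := b) (s₀ := s₀)
    (fun m s => Good (view s) ∧
      ((view s = view s₀ ∧ ∀ k < s₀.reg b, m ≤ k → ok k (view s₀)) ∨
        (μ (view s) < μ (view s₀) ∧ ¬ ∀ k < s₀.reg b, ok k (view s₀))))
    (fun m s v h => by rw [hview]; exact h)
    ⟨hgood, .inl ⟨rfl, fun k hk hk' => absurd hk (by omega)⟩⟩
    (fun m hm s hA hx h => by
      obtain ⟨h1, h2⟩ := hstep s hA (by omega) h.1
      refine ⟨h1, ?_⟩
      rcases h.2 with ⟨h3, h4⟩ | ⟨h3, h4⟩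
      · rcases h2 with ⟨h5, h6⟩ | ⟨h5, h6⟩
        · refine .inl ⟨h5.trans h3, fun k hk hmk => ?_⟩
          rcases hmk.eq_or_lt with rfl | hlt
          · rw [← h3, ← hx]; exact h6
          · exact h4 k hk hlt
        · rw [h3, hx] at h6
          exact .inr ⟨by rwa [h3] at h5, fun h => h6 (h m hm)⟩
      · rcases h2 with ⟨h5, -⟩ | ⟨h5, -⟩
        · exact .inr ⟨by rwa [h5], h4⟩
        · exact .inr ⟨h5.trans h3, h4⟩)
  exact ⟨this.1, this.2.imp (fun h => ⟨h.1, fun k hk => h.2 k hk (Nat.zero_le _)⟩) id⟩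

/-- Scans repeated sufficiently often reach a state in which everything is in order. -/
theorem repeat_spec {σ : Type*} {P : Prog} {x b : ℕ} {s₀ : Store} (view : Store → σ)
    (Good : σ → Prop) (ok : σ → Prop) (μ : σ → ℕ)
    (hview : ∀ s v, view (s.setReg x v) = view s)
    (hstep : ∀ s, Agree P x s₀ s → s.reg x < s₀.reg b → Good (view s) →
      Good (view (P.den s)) ∧ ((view (P.den s) = view s ∧ ok (view s)) ∨
        (μ (view (P.den s)) < μ (view s) ∧ ¬ ok (view s))))
    (hgood : Good (view s₀)) (hμ : μ (view s₀) < s₀.reg b) :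
    Good (view ((loop x b P).den s₀)) ∧ ok (view ((loop x b P).den s₀)) := by
  have := loop_inv (P := P) (x := x) (b := b) (s₀ := s₀)
    -- A round that finds a state in order leaves it alone, and any other round lowers the
    -- potential, which is smaller than the number of remaining rounds.
    (fun m s => Good (view s) ∧ (ok (view s) ∨ μ (view s) < m))
    (fun m s v h => by rw [hview]; exact h) ⟨hgood, .inr hμ⟩
    (fun m hm s hA hx h => by
      obtain ⟨h1, h2⟩ := hstep s hA (by omega) h.1
      refine ⟨h1, ?_⟩
      rcases h2 with ⟨h3, h4⟩ | ⟨h3, h4⟩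
      · exact .inl (h3 ▸ h4)
      · rcases h.2 with h5 | h5
        · exact absurd h5 h4
        · exact .inr (by omega))
  exact ⟨this.1, this.2.resolve_right (by omega)⟩

/-! ### The common environment -/

/-- Run `P` if the value of `e` is nonzero. -/
def when (e : Expr) (P : Prog) : Prog := ite e P skip

lemma den_when (e : Expr) (P : Prog) (s : Store) :
    (when e P).den s = if e.eval s ≠ 0 then P.den s else s := rfl

/-- The entry of the adjacency matrix. Bank 2 holds the addresses of the rows. -/
def adjE (u v : Expr) : Expr := .load 0 (.add (.load 2 u) v)

/-- The registers that bound the loops. -/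
def params (b : ℕ) : Bool := b == 0 || (Nat.blt 2 b && Nat.blt b 13)

/-- The data that are fixed during the search for independent sets. -/
structure Env {n : ℕ} (G : SimpleGraph (Fin n)) (M I : ℕ) (s : Store) : Prop where
  order : s.reg 0 = n
  sample : s.reg 6 = M
  guesses : s.reg 7 = 2 ^ M
  big : s.reg 8 = I
  rounds : s.reg 9 = I * I
  lt : n < I
  adj : ∀ u v : Fin n, s.mem 0 (s.mem 2 u + v) ≠ 0 ↔ G.Adj u v

variable {n M I : ℕ} {G : SimpleGraph (Fin n)} {s : Store}

lemma Env.of_eq (h : Env G M I s) {s' : Store} (hr : ∀ b, params b = true → s'.reg b = s.reg b)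
    (h0 : s'.mem 0 = s.mem 0) (h2 : s'.mem 2 = s.mem 2) : Env G M I s' where
  order := (hr 0 rfl).trans h.order
  sample := (hr 6 rfl).trans h.sample
  guesses := (hr 7 rfl).trans h.guesses
  big := (hr 8 rfl).trans h.big
  rounds := (hr 9 rfl).trans h.rounds
  lt := h.lt
  adj := by rw [h0, h2]; exact h.adj

lemma Env.den (h : Env G M I s) {P : Prog} (hP : P.std params = true) (h0 : P.wm 0 = false)
    (h2 : P.wm 2 = false) : Env G M I (P.den s) :=
  h.of_eq (fun _ hb => den_reg_of_std hP hb s) (den_mem h0 s) (den_mem h2 s)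

lemma Env.agree (h : Env G M I s) {P : Prog} {x : ℕ} {s' : Store} (hA : Agree P x s s')
    (hx : params x = false) (hP : P.std params = true) (h0 : P.wm 0 = false)
    (h2 : P.wm 2 = false) : Env G M I s' :=
  h.of_eq (fun b hb => hA.reg b (by rintro rfl; simp [hb] at hx) (wr_of_std hP hb))
    (hA.mem 0 h0) (hA.mem 2 h2)

/-- The set of vertices whose characteristic vector stands in bank `a`. -/
def vset (n a : ℕ) (s : Store) : Set (Fin n) := {v | s.mem a v ≠ 0}

lemma mem_vset {a : ℕ} {v : Fin n} : v ∈ vset n a s ↔ s.mem a v ≠ 0 := Iff.rfl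

/-! ### Distances -/

/-- Relax the edge from vertex `reg 31` to vertex `reg 32`, in the subgraph spanned by bank 5. -/
def relax (D : ℕ) : Prog :=
  when (.load 5 (.reg 31)) <| when (.load 5 (.reg 32)) <| when (adjE (.reg 31) (.reg 32)) <|
    when (.sub (.load D (.reg 32)) (.add (.load D (.reg 31)) (.lit 1))) <|
      store D (.reg 32) (.add (.load D (.reg 31)) (.lit 1))

/-- Compute in bank `D` the distances from the vertices satisfying `cond`. -/
def level (D : ℕ) (cond : Expr) : Prog :=
  seq (loop 30 0 (ite cond (store D (.reg 30) (.lit 0)) (store D (.reg 30) (.reg 8))))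
    (loop 30 9 (loop 31 0 (loop 32 0 (relax D))))

/-- The partial correctness of tentative distances. -/
structure IsPrelevel (H : SimpleGraph (Fin n)) (I : ℕ) (K : Set (Fin n)) (d : Fin n → ℕ) :
    Prop where
  le : ∀ v, d v ≤ I
  zero : ∀ v ∈ K, d v = 0
  walk : ∀ v, d v < I → ∃ k ∈ K, ∃ p : H.Walk k v, p.length = d v

lemma level_spec (hE : Env G M I s) {D : ℕ} (hD : D ≠ 0 ∧ D ≠ 2 ∧ D ≠ 5 ∧ D ≠ 7) {cond : Expr}
    {K : Set (Fin n)}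
    (hcond : ∀ (s' : Store) (v : Fin n), s'.reg 21 = s.reg 21 → s'.mem 7 = s.mem 7 →
      s'.reg 30 = v → (cond.eval s' ≠ 0 ↔ v ∈ K)) :
    (G.restrictTo (vset n 5 s)).IsLevel I K fun v => ((level D cond).den s).mem D v := by
  classical
  obtain ⟨hD0, hD2, hD5, hD7⟩ := hD
  have w0 : (relax D).wm 0 = false := by simp [relax, wm, when, hD0.symm]
  have w2 : (relax D).wm 2 = false := by simp [relax, wm, when, hD2.symm]
  have w5 : (relax D).wm 5 = false := by simp [relax, wm, when, hD5.symm]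
  set H := G.restrictTo (vset n 5 s) with hH
  set P₀ := ite cond (store D (.reg 30) (.lit 0)) (store D (.reg 30) (.reg 8)) with hP₀
  set s₁ := (loop 30 0 P₀).den s with hs₁
  have hE₁ : Env G M I s₁ := hE.den rfl (by simp [P₀, wm, hD0.symm]) (by simp [P₀, wm, hD2.symm])
  have h5 : s₁.mem 5 = s.mem 5 := den_mem (by simp [P₀, wm, hD5.symm]) s
  have hinit : ∀ v : Fin n, s₁.mem D v = if v ∈ K then 0 else I := by
    have := loop_inv (P := P₀) (x := 30) (b := 0) (s₀ := s)
      (fun m s' => ∀ v : Fin n, m ≤ v → s'.mem D v = if v ∈ K then 0 else I)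
      (fun m s' v h => h) (fun v hv => by rw [hE.order] at hv; omega)
      (fun m hm s' hA hx h v hv => by
        rw [hE.order] at hm
        have e8 : s'.reg 8 = I := (hA.reg 8 (by decide) rfl).trans hE.big
        have hc := hcond s' ⟨m, hm⟩ (hA.reg 21 (by decide) rfl)
          (hA.mem 7 (by simp [P₀, wm, hD7.symm])) hx
        have hval : (P₀.den s').mem D v =
            if (v : ℕ) = m then (if (⟨m, hm⟩ : Fin n) ∈ K then 0 else I) else s'.mem D v := by
          simp only [P₀, den, Expr.eval, hx]
          by_cases hmK : (⟨m, hm⟩ : Fin n) ∈ K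
          · rw [if_pos (hc.2 hmK), if_pos hmK, Store.setMem_mem]; simp
          · rw [if_neg (fun h => hmK (hc.1 h)), if_neg hmK, Store.setMem_mem, e8]; simp
        rw [hval]
        by_cases hvm : (v : ℕ) = m
        · rw [if_pos hvm, show v = ⟨m, hm⟩ from Fin.ext hvm]
        · rw [if_neg hvm, h v (by omega)])
    exact fun v => this v (Nat.zero_le _)
  let view : Store → Fin n → ℕ := fun s' v => s'.mem D v
  -- The redundant bounds on `u` and `v` give the condition the shape in which two nested scans
  -- deliver it.
  let ok : (Fin n → ℕ) → Prop := fun d => ∀ u, u < n → ∀ v, v < n →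
    ∀ (hu : u < n) (hv : v < n), H.Adj ⟨u, hu⟩ ⟨v, hv⟩ → d ⟨v, hv⟩ ≤ d ⟨u, hu⟩ + 1
  -- One relaxation. Tentative distances are always lengths of walks from `K`, unless they still
  -- have the initial value `I`.
  have hrelax : ∀ s', Env G M I s' → s'.mem 5 = s.mem 5 → s'.reg 31 < n → s'.reg 32 < n →
      IsPrelevel H I K (view s') → IsPrelevel H I K (view ((relax D).den s')) ∧
        ((view ((relax D).den s') = view s' ∧ ∀ (hu : s'.reg 31 < n) (hv : s'.reg 32 < n),
          H.Adj ⟨_, hu⟩ ⟨_, hv⟩ → view s' ⟨_, hv⟩ ≤ view s' ⟨_, hu⟩ + 1) ∨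
        (∑ v, view ((relax D).den s') v < ∑ v, view s' v ∧
          ¬ ∀ (hu : s'.reg 31 < n) (hv : s'.reg 32 < n),
          H.Adj ⟨_, hu⟩ ⟨_, hv⟩ → view s' ⟨_, hv⟩ ≤ view s' ⟨_, hu⟩ + 1)) := by
    intro s' hE' h5' hu hv hpre
    have hadj := hE'.adj ⟨_, hu⟩ ⟨_, hv⟩
    have hden : (relax D).den s' =
        if H.Adj ⟨_, hu⟩ ⟨_, hv⟩ ∧ s'.mem D (s'.reg 31) + 1 < s'.mem D (s'.reg 32) then
          s'.setMem D (s'.reg 32) (s'.mem D (s'.reg 31) + 1) else s' := by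
      simp only [relax, den_when, Expr.eval, adjE, den, h5', hH, restrictTo, mem_vset, ne_eq,
        Nat.sub_eq_zero_iff_le, not_le]
      simp only [ne_eq] at hadj
      split_ifs <;> tauto
    rw [hden]
    split_ifs with hc
    · obtain ⟨h1, h2⟩ := hc
      have hv' : view (s'.setMem D (s'.reg 32) (s'.mem D (s'.reg 31) + 1)) =
          Function.update (view s') ⟨_, hv⟩ (s'.mem D (s'.reg 31) + 1) := by
        funext z
        simp only [view, Store.setMem_mem, true_and, Function.update_apply, Fin.ext_iff]
      refine ⟨⟨fun z => ?_, fun z hz => ?_, fun z hz => ?_⟩, .inr ⟨?_, fun h => ?_⟩⟩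
      · rw [hv', Function.update_apply]
        split_ifs
        · have := hpre.le ⟨_, hv⟩
          simp only [view] at this
          omega
        · exact hpre.le z
      · rw [hv', Function.update_apply]
        split_ifs with hzv
        · have := hpre.zero z hz
          rw [hzv] at this
          simp only [view] at this
          omega
        · exact hpre.zero z hz
      · rw [hv', Function.update_apply] at hz ⊢
        split_ifs at hz ⊢ with hzv
        · obtain ⟨k, hk, p, hp⟩ := hpre.walk ⟨_, hu⟩ (by simp only [view]; omega)
          rw [hzv]
          exact ⟨k, hk, p.append (.cons h1 .nil), by simp [hp, view]⟩
        · exact hpre.walk z hz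
      · rw [hv']
        refine Finset.sum_lt_sum (fun z _ => ?_) ⟨⟨_, hv⟩, Finset.mem_univ _, ?_⟩
        · rw [Function.update_apply]
          split_ifs with hzv
          · rw [hzv]; simp only [view]; omega
          · exact le_rfl
        · rw [Function.update_self]; simp only [view]; omega
      · have := h hu hv h1
        simp only [view] at this
        omega
    · refine ⟨hpre, .inl ⟨rfl, fun hu hv h1 => ?_⟩⟩
      by_contra h2
      exact hc ⟨h1, by simp only [view] at h2; omega⟩
  -- The potential is the sum of the tentative distances. It starts at no more than `n * I < I * I`,
  -- the number of rounds in register 9.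
  have hfinal := repeat_spec (P := loop 31 0 (loop 32 0 (relax D))) (x := 30) (b := 9) (s₀ := s₁)
    view (IsPrelevel H I K) ok (fun d => ∑ v, d v) (fun _ _ => rfl) (by
      intro s' hA _ hg
      have hE' := hE₁.agree hA rfl rfl w0 w2
      have h5' : s'.mem 5 = s.mem 5 := (hA.mem 5 w5).trans h5
      have hscan := scan_spec (P := loop 32 0 (relax D)) (x := 31) (b := 0) (s₀ := s') view
        (IsPrelevel H I K) (fun u d => ∀ v, v < n → ∀ (hu : u < n) (hv : v < n),
          H.Adj ⟨u, hu⟩ ⟨v, hv⟩ → d ⟨v, hv⟩ ≤ d ⟨u, hu⟩ + 1)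
        (fun d => ∑ v, d v) (fun _ _ => rfl) (by
          intro s'' hA' hu hg'
          have hE'' := hE'.agree hA' rfl rfl w0 w2
          have h5'' : s''.mem 5 = s.mem 5 := (hA'.mem 5 w5).trans h5'
          have hscan := scan_spec (P := relax D) (x := 32) (b := 0) (s₀ := s'') view
            (IsPrelevel H I K) (fun v d => ∀ (hu : s''.reg 31 < n) (hv : v < n),
              H.Adj ⟨s''.reg 31, hu⟩ ⟨v, hv⟩ → d ⟨v, hv⟩ ≤ d ⟨s''.reg 31, hu⟩ + 1)
            (fun d => ∑ v, d v) (fun _ _ => rfl) (by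
              intro t hA'' hv hgt
              have h31 : t.reg 31 = s''.reg 31 := hA''.reg 31 (by decide) rfl
              have := hrelax t (hE''.agree hA'' rfl rfl w0 w2) ((hA''.mem 5 w5).trans h5'')
                (by rw [h31]; rwa [hE'.order] at hu) (by rwa [hE''.order] at hv) hgt
              simpa only [h31] using this) hg'
          rwa [hE''.order] at hscan) hg
      rwa [hE'.order] at hscan)
    ⟨fun v => by
        have := hinit v
        simp only [view]
        rw [this]; split_ifs <;> omega,
      fun v hv => by simp only [view]; rw [hinit, if_pos hv],
      fun v hv => by
        simp only [view] at hv ⊢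
        rw [hinit] at hv ⊢
        split_ifs at hv ⊢ with hvK
        · exact ⟨v, hvK, .nil, rfl⟩
        · omega⟩
    (by
      rw [hE₁.rounds]
      calc ∑ v, view s₁ v ≤ ∑ _v : Fin n, I := Finset.sum_le_sum fun v _ => by
            simp only [view]; rw [hinit]; split_ifs <;> omega
        _ = n * I := by simp
        _ < I * I := Nat.mul_lt_mul_of_pos_right hE.lt (Nat.zero_lt_of_lt hE.lt))
  exact ⟨hfinal.1.zero, fun u v huv => hfinal.2 u u.2 v v.2 u.2 v.2 huv, hfinal.1.walk⟩

end Prog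

end RAM


/-! ### Subroutines for banks, paths, digits and vertex sets. -/

namespace RAM

namespace Prog

open SimpleGraph

variable {n M I : ℕ} {G : SimpleGraph (Fin n)} {s : Store}

/-- Fill a bank cell by cell. -/
lemma fill_spec {P : Prog} {x b a : ℕ} {s : Store} (f : ℕ → ℕ)
    (hP : ∀ s', Agree P x s s' → s'.reg x < s.reg b →
      ∀ v, (P.den s').mem a v = if v = s'.reg x then f v else s'.mem a v) :
    ∀ v < s.reg b, ((loop x b P).den s).mem a v = f v := by
  have := loop_inv (P := P) (x := x) (b := b) (s₀ := s)
    (fun m s' => ∀ v < s.reg b, m ≤ v → s'.mem a v = f v)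
    (fun m s' v h => h) (fun v hv hv' => absurd hv (by omega))
    (fun m hm s' hA hx h v hv hmv => by
      rw [hP s' hA (by omega), hx]
      split_ifs with h1
      · rfl
      · exact h v hv (by omega))
  exact fun v hv => this v hv (Nat.zero_le _)

/-- For fillings that depend on the old content of the cell: the invariant also records that the
cells not yet reached are unchanged. -/
lemma fill_spec_of_eq {P : Prog} {x b a : ℕ} {s : Store} (f : ℕ → ℕ)
    (hP : ∀ s', Agree P x s s' → s'.reg x < s.reg b →
      s'.mem a (s'.reg x) = s.mem a (s'.reg x) →
      ∀ v, (P.den s').mem a v = if v = s'.reg x then f v else s'.mem a v) :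
    ∀ v < s.reg b, ((loop x b P).den s).mem a v = f v := by
  have := loop_inv (P := P) (x := x) (b := b) (s₀ := s)
    (fun m s' => (∀ v < s.reg b, m ≤ v → s'.mem a v = f v) ∧ ∀ v < m, s'.mem a v = s.mem a v)
    (fun m s' v h => h) ⟨fun v hv hv' => absurd hv (by omega), fun _ _ => rfl⟩
    (fun m hm s' hA hx h => by
      have hP' := hP s' hA (by omega) (h.2 _ (by omega))
      refine ⟨fun v hv hmv => ?_, fun v hv => ?_⟩
      · rw [hP', hx]
        split_ifs with h1
        · rfl
        · exact h.1 v hv (by omega)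
      · rw [hP', if_neg (by omega)]
        exact h.2 v (by omega))
  exact fun v hv => this.1 v hv (Nat.zero_le _)

/-- An expression that is nonzero if and only if `a` and `b` differ. -/
def neE (a b : Expr) : Expr := .add (.sub a b) (.sub b a)

lemma eval_neE (a b : Expr) (s : Store) : (neE a b).eval s ≠ 0 ↔ a.eval s ≠ b.eval s := by
  simp only [neE, Expr.eval]
  omega

/-! ### Shortest paths -/

/-- Move from vertex `reg 36` to vertex `reg 31` if that is one step closer to the source. -/
def descend : Prog :=
  when (.load 5 (.reg 31)) <| when (adjE (.reg 31) (.reg 36)) <|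
    ite (neE (.add (.load 6 (.reg 31)) (.lit 1)) (.load 6 (.reg 36))) skip
      (seq (assign 36 (.reg 31)) (store 7 (.reg 36) (.lit 1)))

/-- Mark in bank 7 the vertices of a shortest path from the source to vertex `reg x`. -/
def mark (x : ℕ) : Prog :=
  seq (assign 36 (.reg x)) (seq (store 7 (.reg 36) (.lit 1)) (loop 30 8 (loop 31 0 descend)))

lemma mark_spec (hE : Env G M I s) {r z : Fin n} {x : ℕ} (hx : s.reg x = z) {W : Set (Fin n)}
    (hW : vset n 5 s = W) {d : Fin n → ℕ} (hdd : d = fun v : Fin n => s.mem 6 v)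
    (hd : (G.restrictTo W).IsLevel I {r} d) (hz : d z < I) :
    ∃ p : (G.restrictTo W).Walk r z, p.length = d z ∧
      ∀ v : Fin n, v ∈ vset n 7 ((mark x).den s) ↔ v ∈ vset n 7 s ∨ v ∈ p.support := by
  classical
  subst hW
  have hd' : ∀ v : Fin n, s.mem 6 v = d v := fun v => by rw [hdd]
  set H := G.restrictTo (vset n 5 s) with hH
  -- `c` is the vertex reached so far on the way back from `z` to the source; precisely a shortest
  -- walk from `c` to `z` has been added to the marks.
  let Inv : Fin n → Store → Prop := fun c s' => s'.reg 36 = c ∧ d c < I ∧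
    ∃ q : H.Walk c z, q.length + d c = d z ∧
      ∀ v : Fin n, s'.mem 7 v ≠ 0 ↔ s.mem 7 v ≠ 0 ∨ v ∈ q.support
  set s₁ := (s.setReg 36 z).setMem 7 z 1 with hs₁
  have hden : (mark x).den s = (loop 30 8 (loop 31 0 descend)).den s₁ := by
    simp only [mark, den, Expr.eval, hx, hs₁, Store.setReg_reg, if_true]
  have hE₁ : Env G M I s₁ := hE.of_eq (fun b hb => by
      have : b ≠ 36 := by rintro rfl; simp [params] at hb
      simp [hs₁, this]) (Store.setMem_mem_of_ne _ _ _ (by decide))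
    (Store.setMem_mem_of_ne _ _ _ (by decide))
  have h5₁ : s₁.mem 5 = s.mem 5 := Store.setMem_mem_of_ne _ _ _ (by decide)
  have h6₁ : s₁.mem 6 = s.mem 6 := Store.setMem_mem_of_ne _ _ _ (by decide)
  have hpred : ∀ c : Fin n, 0 < d c → d c < I → ∃ u, H.Adj u c ∧ d u + 1 = d c := by
    intro c hc hcI
    obtain ⟨k, hk, p, hp⟩ := hd.walk c hcI
    have hk0 : d k = 0 := hd.zero k hk
    cases hq : p.reverse with
    | nil =>
      have := congrArg Walk.length hq
      rw [Walk.length_reverse, Walk.length_nil] at this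
      exact absurd hc (by have : p.length = d c := hp; omega)
    | @cons _ u _ huc q =>
      have h1 := congrArg Walk.length hq
      rw [Walk.length_reverse, Walk.length_cons] at h1
      have h2 : d u ≤ d k + q.reverse.length := hd.le_add_length q.reverse
      have h3 : d c ≤ d u + 1 := hd.step u c huc.symm
      rw [Walk.length_reverse] at h2
      have h4 : p.length = d c := hp
      exact ⟨u, huc.symm, by omega⟩
  have hstep : ∀ (s' : Store) (c : Fin n), Env G M I s' → s'.mem 5 = s.mem 5 →
      s'.mem 6 = s.mem 6 → Inv c s' → ∀ hu : s'.reg 31 < n,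
      ∃ c', Inv c' (descend.den s') ∧ ((c' = c ∧ ¬ (H.Adj ⟨_, hu⟩ c ∧ d ⟨_, hu⟩ + 1 = d c)) ∨
        d c' + 1 = d c) := by
    intro s' c hE' h5 h6 hInv hu
    obtain ⟨hc, hcI, q, hq, hv⟩ := hInv
    have hadj := hE'.adj ⟨_, hu⟩ c
    -- The program tests membership in bank 5 only for the new vertex. The current one has positive
    -- distance whenever it matters, and then it is the end of an edge of the restricted graph.
    have hcW : 0 < d c → s.mem 5 c ≠ 0 := by
      intro hc0
      obtain ⟨u, huc, -⟩ := hpred c hc0 hcI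
      exact huc.2.2
    have hden : descend.den s' = if H.Adj ⟨_, hu⟩ c ∧ d ⟨_, hu⟩ + 1 = d c then
        (s'.setReg 36 (s'.reg 31)).setMem 7 (s'.reg 31) 1 else s' := by
      have hne := eval_neE (.add (.load 6 (.reg 31)) (.lit 1)) (.load 6 (.reg 36)) s'
      simp only [Expr.eval, h6, hc] at hne
      rw [hd' c, show s.mem 6 (s'.reg 31) = d ⟨_, hu⟩ from hd' ⟨_, hu⟩] at hne
      simp only [descend, den_when, den]
      by_cases h : H.Adj ⟨_, hu⟩ c ∧ d ⟨_, hu⟩ + 1 = d c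
      · obtain ⟨⟨g1, g2, g4⟩, g3⟩ := h
        rw [if_pos (by simp only [Expr.eval, h5]; exact g2),
          if_pos (by simpa only [adjE, Expr.eval, hc] using hadj.2 g1),
          if_neg (fun g => hne.1 g g3), if_pos ⟨⟨g1, g2, g4⟩, g3⟩]
        simp [Expr.eval]
      · rw [if_neg h]
        split_ifs with g1 g2 g3
        · rfl
        · refine absurd ⟨⟨hadj.1 ?_, ?_, ?_⟩, ?_⟩ h
          · simpa only [adjE, Expr.eval, hc] using g2
          · simp only [Expr.eval, h5] at g1; exact g1
          · refine hcW ?_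
            by_contra g4
            exact g3 (hne.2 (by omega))
          · by_contra g4
            exact g3 (hne.2 g4)
        · rfl
        · rfl
    rw [hden]
    split_ifs with h
    · refine ⟨⟨_, hu⟩, ⟨by simp, by omega, .cons h.1 q, ?_, fun v => ?_⟩, .inr h.2⟩
      · rw [Walk.length_cons]; omega
      · rw [Store.setMem_mem, Walk.support_cons, List.mem_cons]
        simp only [true_and, Store.setReg_mem, Fin.ext_iff]
        split_ifs with h1
        · simp [h1]
        · rw [hv v]; tauto
    · exact ⟨c, ⟨hc, hcI, q, hq, hv⟩, .inl ⟨rfl, h⟩⟩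
  have hfinal := loop_inv (P := loop 31 0 descend) (x := 30) (b := 8) (s₀ := s₁)
    (fun m s' => ∃ c, Inv c s' ∧ d c ≤ m)
    (fun m s' v ⟨c, ⟨h1, h2⟩, h3⟩ => ⟨c, ⟨by simpa using h1, h2⟩, h3⟩)
    ⟨z, ⟨by simp [hs₁], hz, .nil, by simp, fun v => by
      simp only [hs₁, Store.setMem_mem, Store.setReg_mem, Walk.support_nil, List.mem_singleton,
        Fin.ext_iff, true_and]
      split_ifs with h1 <;> simp [h1]⟩, by rw [hE₁.big]; exact hz.le⟩
    (fun m hm s' hA _ ⟨c₀, hInv₀, hc₀⟩ => by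
      have hE' := hE₁.agree hA rfl rfl rfl rfl
      have h5' := (hA.mem 5 rfl).trans h5₁
      have h6' := (hA.mem 6 rfl).trans h6₁
      -- Within a sweep, either a step towards the source has been made, or no vertex scanned so far
      -- is a predecessor of `c`. The latter cannot last through a whole sweep, since a predecessor
      -- exists.
      have := loop_inv (P := descend) (x := 31) (b := 0) (s₀ := s')
        (fun k s'' => ∃ c, Inv c s'' ∧ (d c ≤ m ∨ (d c = m + 1 ∧
          ∀ u : Fin n, k ≤ u → ¬ (H.Adj u c ∧ d u + 1 = d c))))
        (fun m s' v ⟨c, ⟨h1, h2⟩, h3⟩ => ⟨c, ⟨by simpa using h1, h2⟩, h3⟩)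
        ⟨c₀, hInv₀, by
          rcases hc₀.eq_or_lt with h | h
          · exact .inr ⟨h, fun u hu => by rw [hE'.order] at hu; omega⟩
          · exact .inl (by omega)⟩
        (fun k hk s'' hA' hx' ⟨c, hInv, hc⟩ => by
          rw [hE'.order] at hk
          obtain ⟨c', h1, h2⟩ := hstep s'' c (hE'.agree hA' rfl rfl rfl rfl)
            ((hA'.mem 5 rfl).trans h5') ((hA'.mem 6 rfl).trans h6') hInv (by omega)
          refine ⟨c', h1, ?_⟩
          rcases h2 with ⟨rfl, h3⟩ | h3
          · refine hc.imp id fun ⟨h4, h5⟩ => ⟨h4, fun u hu => ?_⟩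
            rcases hu.eq_or_lt with hu | hu
            · have : u = ⟨s''.reg 31, by omega⟩ := Fin.ext (by simp only; omega)
              rw [this]; exact h3
            · exact h5 u hu
          · left; omega)
      obtain ⟨c, h1, h2⟩ := this
      refine ⟨c, h1, ?_⟩
      rcases h2 with h2 | ⟨h2, h3⟩
      · exact h2
      · obtain ⟨u, hu⟩ := hpred c (by omega) h1.2.1
        exact absurd hu (h3 u (Nat.zero_le _)))
  obtain ⟨c, ⟨-, hcI, q, hq, hv⟩, hc⟩ := hfinal
  obtain ⟨k, hk, p, hp⟩ := hd.walk c hcI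
  have hp0 : p.length = 0 := by
    have : p.length = d c := hp
    omega
  obtain rfl : k = r := hk
  obtain rfl := Walk.eq_of_length_eq_zero hp0
  refine ⟨q, by omega, fun v => ?_⟩
  rw [mem_vset, hden]
  exact hv v

/-- Mark in bank 7 the vertices of shortest paths from the source to vertices `reg 22`, `reg 23`. -/
def fork : Prog := seq (loop 30 0 (store 7 (.reg 30) (.lit 0))) (seq (mark 22) (mark 23))

lemma fork_spec (hE : Env G M I s) {r x y : Fin n} (hx : s.reg 22 = x) (hy : s.reg 23 = y)
    (hd : (G.restrictTo (vset n 5 s)).IsLevel I {r} fun v => s.mem 6 v) :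
    (G.restrictTo (vset n 5 s)).IsFork I (fun v => s.mem 6 v) r x y (vset n 7 (fork.den s)) := by
  intro hxI hyI
  set s₁ := (loop 30 0 (store 7 (.reg 30) (.lit 0))).den s with hs₁
  have hE₁ : Env G M I s₁ := hE.den rfl rfl rfl
  have h5 : s₁.mem 5 = s.mem 5 := den_mem rfl s
  have h6 : s₁.mem 6 = s.mem 6 := den_mem rfl s
  have h7 : ∀ v : Fin n, s₁.mem 7 v = 0 := fun v =>
    fill_spec (a := 7) (fun _ => 0) (fun s' _ _ v => by simp [den, Expr.eval, Store.setMem_mem]) v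
      (by rw [hE.order]; exact v.2)
  obtain ⟨p, hp, hpv⟩ := mark_spec hE₁ (x := 22) (z := x) ((den_reg rfl s).trans hx)
    (W := vset n 5 s) (by unfold vset; rw [h5]) (by rw [h6]) hd hxI
  set s₂ := (mark 22).den s₁ with hs₂
  have h5' : s₂.mem 5 = s.mem 5 := (den_mem rfl s₁).trans h5
  have h6' : s₂.mem 6 = s.mem 6 := (den_mem rfl s₁).trans h6
  obtain ⟨q, hq, hqv⟩ := mark_spec (s := s₂) (hE₁.den (P := mark 22) rfl rfl rfl) (x := 23) (z := y)
    (((den_reg rfl s₁).trans (den_reg rfl s)).trans hy) (W := vset n 5 s)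
    (by unfold vset; rw [h5']) (by rw [h6']) hd hyI
  refine ⟨p, q, hp, hq, fun v => ?_⟩
  have h8 : v ∉ vset n 7 s₁ := by simp [mem_vset, h7 v]
  have h9 := hpv v
  have h10 := hqv v
  simp only [fork, den] at h9 h10 ⊢
  tauto

/-! ### Numbers in base `b` -/

/-- Write the digits of `reg x` in the given base into bank `a`, the last digit at the end. -/
def digits (a x b : ℕ) (base : Expr) : Prog :=
  seq (assign 36 (.reg x)) <| loop 30 6 <| seq (assign 37 (.lit 0)) <|
    seq (loop 31 b (when (.sub (.add (.reg 36) (.lit 1)) base)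
      (seq (assign 36 (.sub (.reg 36) base)) (assign 37 (.add (.reg 37) (.lit 1)))))) <|
    seq (store a (.reg 30) (.reg 36)) (assign 36 (.reg 37))

/-- Division is repeated subtraction, with register `b` as a bound for the number of subtractions.
The condition on `b` keeps it apart from the scratch registers; the base may be the number of
vertices. -/
lemma digits_spec {a x b : ℕ} {base : Expr} {B : ℕ} (hB : 0 < B)
    (hbase : ∀ s' : Store, s'.reg 0 = s.reg 0 → base.eval s' = B) (hb : b < 13)
    (hx : s.reg x ≤ s.reg b) :
    ∀ i < s.reg 6, ((digits a x b base).den s).mem a i = s.reg x / B ^ (s.reg 6 - 1 - i) % B := by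
  set z := s.reg x with hz
  set D : Prog := when (.sub (.add (.reg 36) (.lit 1)) base)
      (seq (assign 36 (.sub (.reg 36) base)) (assign 37 (.add (.reg 37) (.lit 1)))) with hD
  have hdiv : ∀ s' : Store, s'.reg 0 = s.reg 0 → s'.reg 36 ≤ s'.reg b → s'.reg 37 = 0 →
      ((loop 31 b D).den s').reg 36 = s'.reg 36 % B ∧
      ((loop 31 b D).den s').reg 37 = s'.reg 36 / B := by
    intro s' h0 hle h37
    have := loop_inv (P := D) (x := 31) (b := b) (s₀ := s')
      (fun k t => t.reg 36 + B * t.reg 37 = s'.reg 36 ∧ (t.reg 36 < B ∨ t.reg 36 ≤ k))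
      (fun k t v h => by simpa using h) ⟨by rw [h37]; simp, .inr hle⟩
      (fun k _ t hA _ ⟨h1, h2⟩ => by
        have hbt := hbase t ((hA.reg 0 (by decide) rfl).trans h0)
        have hbt' := hbase (t.setReg 36 (t.reg 36 - B)) (by
          simp only [Store.setReg_reg]; exact (hA.reg 0 (by decide) rfl).trans h0)
        simp only [hD, den_when, den, Expr.eval, hbt]
        split_ifs with h3
        · simp only [Store.setReg_reg, if_true, Nat.reduceEqDiff, if_false]
          refine ⟨?_, by omega⟩
          rw [Nat.mul_add]; omega
        · exact ⟨h1, by omega⟩)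
    obtain ⟨h1, h2⟩ := this
    have h3 : ((loop 31 b D).den s').reg 36 < B := by omega
    constructor
    · rw [← h1, Nat.add_mul_mod_self_left, Nat.mod_eq_of_lt h3]
    · rw [← h1, Nat.add_mul_div_left _ _ hB, Nat.div_eq_of_lt h3, zero_add]
  set P : Prog := seq (assign 37 (.lit 0)) (seq (loop 31 b D)
    (seq (store a (.reg 30) (.reg 36)) (assign 36 (.reg 37)))) with hP
  have hmain := loop_inv (P := P) (x := 30) (b := 6) (s₀ := s.setReg 36 z)
    (fun k t => k ≤ s.reg 6 → t.reg 36 = z / B ^ (s.reg 6 - k) ∧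
      ∀ i < s.reg 6, k ≤ i → t.mem a i = z / B ^ (s.reg 6 - 1 - i) % B)
    (fun k t v h => by simpa using h)
    (fun _ => ⟨by simp, fun i hi hi' => by simp at hi'; omega⟩)
    (fun k hk t hA hx' h hk' => by
      simp only [Store.setReg_reg, Nat.reduceEqDiff, if_false] at hk
      obtain ⟨h1, h2⟩ := h hk
      have h0 : t.reg 0 = s.reg 0 := (hA.reg 0 (by decide) rfl).trans (by simp)
      have hbt : t.reg b = s.reg b := by
        have hb1 : b ≠ 30 := by omega
        have hb2 : b ≠ 31 := by omega
        have hb3 : b ≠ 36 := by omega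
        have hb4 : b ≠ 37 := by omega
        refine (hA.reg b hb1 ?_).trans (by simp [hb3])
        simp [hP, hD, wr, when, hb2, hb3, hb4]
      obtain ⟨h3, h4⟩ := hdiv (t.setReg 37 0) (by simpa using h0) (by
        simp only [Store.setReg_reg, Nat.reduceEqDiff, if_false]
        rw [if_neg (show b ≠ 37 by omega), hbt, h1]
        exact (Nat.div_le_self _ _).trans hx) (by simp)
      simp only [Store.setReg_reg, Nat.reduceEqDiff, if_false] at h3 h4
      have h30 : ((loop 31 b D).den (t.setReg 37 0)).reg 30 = k := by
        rw [den_reg (by simp [hD, wr, when])]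
        simp [hx']
      have hma : ((loop 31 b D).den (t.setReg 37 0)).mem a = t.mem a :=
        den_mem (by simp [hD, wm, when]) _
      have e1 : P.den t = ((((loop 31 b D).den (t.setReg 37 0)).setMem a k
          (((loop 31 b D).den (t.setReg 37 0)).reg 36)).setReg 36
          (((loop 31 b D).den (t.setReg 37 0)).reg 37)) := by
        rw [← h30]; rfl
      refine ⟨?_, fun i hi hki => ?_⟩
      · rw [e1, Store.setReg_reg, if_pos rfl, h4, h1, Nat.div_div_eq_div_mul, ← pow_succ]
        congr 2; omega
      · have hres : (P.den t).mem a i = if i = k then z / B ^ (s.reg 6 - (k + 1)) % B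
            else t.mem a i := by
          rw [e1, Store.setReg_mem, Store.setMem_mem, hma, h3, h1]
          simp
        rw [hres]
        split_ifs with hik
        · subst hik; rw [show s.reg 6 - (i + 1) = s.reg 6 - 1 - i by omega]
        · exact h2 i hi (by omega))
  have hfin := (hmain (Nat.zero_le _)).2
  exact fun i hi => hfin i hi (Nat.zero_le _)

/-- Positional notation is a bijection, so a loop over all numbers goes through all subsets or all
samples. -/
lemma exists_digits (b M : ℕ) (g : ℕ → ℕ) (hg : ∀ i < M, g i < b) :
    ∃ z < b ^ M, ∀ i < M, z / b ^ (M - 1 - i) % b = g i := by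
  -- `finFunctionFinEquiv` takes the least significant digit first, the program stores it last.
  let f : Fin M → Fin b := fun i => ⟨g (M - 1 - i), hg _ (by omega)⟩
  refine ⟨finFunctionFinEquiv f, (finFunctionFinEquiv f).2, fun i hi => ?_⟩
  have h1 := congrArg Fin.val (congrFun (Equiv.symm_apply_apply finFunctionFinEquiv f)
    ⟨M - 1 - i, by omega⟩)
  refine Eq.trans ?_ (h1.trans ?_)
  · rfl
  · exact congrArg g (by simp only; omega)

/-! ### Subgraphs -/

/-- Put into bank 5 the vertices that are not adjacent to a selected member of the sample. -/
def buildRest : Prog :=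
  seq (loop 30 0 (store 5 (.reg 30) (.lit 1))) <| loop 31 6 <| when (.load 4 (.reg 31)) <|
    loop 30 0 (when (adjE (.load 3 (.reg 31)) (.reg 30)) (store 5 (.reg 30) (.lit 0)))

lemma buildRest_spec (hE : Env G M I s) (v : Fin n) :
    v ∈ vset n 5 (buildRest.den s) ↔
      ∀ i < M, s.mem 4 i ≠ 0 → s.mem 0 (s.mem 2 (s.mem 3 i) + v) = 0 := by
  set s₁ := (loop 30 0 (store 5 (.reg 30) (.lit 1))).den s with hs₁
  have h5 : ∀ v : Fin n, s₁.mem 5 v = 1 := fun v =>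
    fill_spec (a := 5) (fun _ => 1) (fun s' _ _ v => by simp [den, Expr.eval, Store.setMem_mem]) v
      (by rw [hE.order]; exact v.2)
  have h3 : s₁.mem 3 = s.mem 3 := den_mem rfl s
  have h2 : s₁.mem 2 = s.mem 2 := den_mem rfl s
  have h0 : s₁.mem 0 = s.mem 0 := den_mem rfl s
  have h4 : s₁.mem 4 = s.mem 4 := den_mem rfl s
  set Q : Prog := when (adjE (.load 3 (.reg 31)) (.reg 30)) (store 5 (.reg 30) (.lit 0)) with hQ
  have h6 : s₁.reg 6 = M := (den_reg rfl s).trans hE.sample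
  have h00 : s₁.reg 0 = n := (den_reg rfl s).trans hE.order
  have := loop_inv (P := when (.load 4 (.reg 31)) (loop 30 0 Q)) (x := 31) (b := 6) (s₀ := s₁)
    (fun k t => ∀ v : Fin n, t.mem 5 v ≠ 0 ↔
      ∀ i < M, k ≤ i → s.mem 4 i ≠ 0 → s.mem 0 (s.mem 2 (s.mem 3 i) + v) = 0)
    (fun _ _ _ h => h) (fun v => by
      rw [h5 v, h6]
      simp only [ne_eq, one_ne_zero, not_false_eq_true, true_iff]
      intro i hi hi'; omega)
    (fun k hk t hA hx h v => by
      have g0 := (hA.mem 0 rfl).trans h0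
      have g2 := (hA.mem 2 rfl).trans h2
      have g3 := (hA.mem 3 rfl).trans h3
      have g4 := (hA.mem 4 rfl).trans h4
      have g00 : t.reg 0 = n := (hA.reg 0 (by decide) rfl).trans h00
      have hin : ((loop 30 0 Q).den t).mem 5 v =
          if s.mem 0 (s.mem 2 (s.mem 3 k) + v) ≠ 0 then 0 else t.mem 5 v :=
        fill_spec_of_eq (fun v => if s.mem 0 (s.mem 2 (s.mem 3 k) + v) ≠ 0 then 0 else t.mem 5 v)
          (fun t' hA' _ hu v => by
            have e0 := (hA'.mem 0 rfl).trans g0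
            have e2 := (hA'.mem 2 rfl).trans g2
            have e3 := (hA'.mem 3 rfl).trans g3
            have e31 : t'.reg 31 = k := (hA'.reg 31 (by decide) rfl).trans hx
            simp only [hQ, den_when, adjE, Expr.eval, den, e0, e2, e3, e31]
            by_cases hv : v = t'.reg 30
            · subst hv
              rw [if_pos rfl]
              split_ifs
              · rw [Store.setMem_mem]; simp
              · exact hu
            · rw [if_neg hv]
              split_ifs
              · rw [Store.setMem_mem]; simp [hv]
              · rfl) v (by rw [g00]; exact v.2)
      have hk' : k < M := by omega
      simp only [den_when, Expr.eval, g4, hx]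
      split_ifs with h4k
      · rw [hin]
        split_ifs with hadj
        · simp only [ne_eq, not_true_eq_false, false_iff]
          exact fun g => hadj (g k hk' le_rfl h4k)
        · rw [h v]
          refine ⟨fun g i hi hki => ?_, fun g i hi hki => g i hi (by omega)⟩
          rcases hki.eq_or_lt with rfl | hki
          · exact fun _ => not_not.1 hadj
          · exact g i hi hki
      · rw [h v]
        refine ⟨fun g i hi hki => ?_, fun g i hi hki => g i hi (by omega)⟩
        rcases hki.eq_or_lt with rfl | hki
        · exact fun g' => absurd g' h4k
        · exact g i hi hki)
  rw [mem_vset]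
  refine (this v).trans ⟨fun g i hi => g i hi (Nat.zero_le _), fun g i hi _ => g i hi⟩

/-- Put into bank 9 the vertices of bank 5 outside of two layers. -/
def buildCore : Prog :=
  loop 30 0 <| ite (.load 5 (.reg 30))
    (ite (neE (.load 6 (.reg 30)) (.reg 25))
      (ite (neE (.load 8 (.reg 30)) (.reg 24)) (store 9 (.reg 30) (.lit 1))
        (store 9 (.reg 30) (.lit 0)))
      (store 9 (.reg 30) (.lit 0)))
    (store 9 (.reg 30) (.lit 0))

lemma buildCore_spec (hE : Env G M I s) (v : Fin n) :
    v ∈ vset n 9 (buildCore.den s) ↔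
      v ∈ vset n 5 s ∧ s.mem 6 v ≠ s.reg 25 ∧ s.mem 8 v ≠ s.reg 24 := by
  classical
  have := fill_spec (s := s) (a := 9) (b := 0) (x := 30)
    (fun v => if s.mem 5 v ≠ 0 ∧ s.mem 6 v ≠ s.reg 25 ∧ s.mem 8 v ≠ s.reg 24 then 1 else 0)
    (P := ite (.load 5 (.reg 30))
    (ite (neE (.load 6 (.reg 30)) (.reg 25))
      (ite (neE (.load 8 (.reg 30)) (.reg 24)) (store 9 (.reg 30) (.lit 1))
        (store 9 (.reg 30) (.lit 0)))
      (store 9 (.reg 30) (.lit 0)))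
    (store 9 (.reg 30) (.lit 0))) (fun t hA _ v => by
      have e5 := hA.mem 5 rfl
      have e6 := hA.mem 6 rfl
      have e8 := hA.mem 8 rfl
      have e25 := hA.reg 25 (by decide) rfl
      have e24 := hA.reg 24 (by decide) rfl
      simp only [den, eval_neE, Expr.eval, e5, e6, e8, e25, e24]
      by_cases hv : v = t.reg 30
      · subst hv
        rw [if_pos rfl]
        split_ifs <;> simp_all [Store.setMem_mem]
      · rw [if_neg hv]
        split_ifs <;> simp [Store.setMem_mem, hv]) v (by rw [hE.order]; exact v.2)
  rw [mem_vset, buildCore, this]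
  simp [mem_vset]

end Prog

end RAM


/-! ### The auction and the extraction of an independent set. -/

namespace RAM

namespace Prog

open SimpleGraph Finset

variable {n M I : ℕ} {G : SimpleGraph (Fin n)} {s : Store}

/-- The set of vertices whose characteristic vector stands in bank `a`, as a finite set. -/
def fset (n a : ℕ) (s : Store) : Finset (Fin n) := univ.filter fun v : Fin n => s.mem a v ≠ 0

lemma mem_fset {a : ℕ} {v : Fin n} : v ∈ fset n a s ↔ s.mem a v ≠ 0 := by simp [fset]

lemma fset_congr {a : ℕ} {s' : Store} (h : s.mem a = s'.mem a) : fset n a s = fset n a s' := by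
  unfold fset; rw [h]

@[simp] lemma fset_setReg (s : Store) (a x v : ℕ) : fset n a (s.setReg x v) = fset n a s := rfl

/-- Count the vertices in bank `a` into register `x`. -/
def count (a x : ℕ) : Prog :=
  seq (assign x (.lit 0)) (loop 30 0 (when (.load a (.reg 30)) (assign x (.add (.reg x) (.lit 1)))))

lemma count_spec (hn : s.reg 0 = n) {a x : ℕ} (hx : x ≠ 0) (hx' : x ≠ 30) :
    ((count a x).den s).reg x = #(fset n a s) := by
  have := loop_inv (P := when (.load a (.reg 30)) (assign x (.add (.reg x) (.lit 1)))) (x := 30)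
    (b := 0) (s₀ := s.setReg x 0)
    (fun k t => t.reg x = #((fset n a s).filter fun v : Fin n => k ≤ (v : ℕ)))
    (fun k t v h => by simpa [hx'] using h)
    (by
      simp only [Store.setReg_reg, if_true, if_neg hx.symm, hn]
      symm
      rw [card_eq_zero, filter_eq_empty_iff]
      exact fun v _ => by have := v.2; omega)
    (fun k hk t hA hk' h => by
      simp only [Store.setReg_reg, if_neg hx.symm, hn] at hk
      have ha : t.mem a = s.mem a := hA.mem a rfl
      have hsplit : (fset n a s).filter (fun v : Fin n => k ≤ (v : ℕ)) =
          if s.mem a k ≠ 0 then insert ⟨k, hk⟩ ((fset n a s).filter fun v : Fin n => k + 1 ≤ (v : ℕ))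
          else (fset n a s).filter fun v : Fin n => k + 1 ≤ (v : ℕ) := by
        ext v
        split_ifs with h1
        · simp only [mem_filter, mem_insert, mem_fset, Fin.ext_iff]
          constructor
          · rintro ⟨h2, h3⟩
            rcases h3.eq_or_lt with h3 | h3
            · exact .inl h3.symm
            · exact .inr ⟨h2, h3⟩
          · rintro (h2 | ⟨h2, h3⟩)
            · rw [h2]; exact ⟨h1, le_rfl⟩
            · exact ⟨h2, by omega⟩
        · simp only [mem_filter, mem_fset]
          refine ⟨fun ⟨h2, h3⟩ => ⟨h2, ?_⟩, fun ⟨h2, h3⟩ => ⟨h2, by omega⟩⟩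
          rcases h3.eq_or_lt with h3 | h3
          · exact absurd (h3 ▸ h2) h1
          · exact h3
      rw [hsplit]
      simp only [den_when, Expr.eval, ha, hk', den]
      split_ifs with h1
      · rw [Store.setReg_reg, if_pos rfl, h, card_insert_of_notMem (by simp)]
      · exact h)
  rw [show (count a x).den s = _ from rfl]
  simp only [count, den, Expr.eval] at this ⊢
  rw [this]
  simp

/-! ### The auction -/

/-- Look for the cheapest neighbour of vertex `reg 31` in bank 9. -/
def search : Prog :=
  loop 32 0 <| when (.load 9 (.reg 32)) <| when (adjE (.reg 31) (.reg 32)) <|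
    when (.sub (.reg 36) (.load 10 (.reg 32))) <|
      seq (assign 36 (.load 10 (.reg 32))) (assign 37 (.reg 32))

/-- The running minimum starts at `I`, so a neighbour of price `I` is never chosen and no price
exceeds `I`. -/
lemma search_spec (hE : Env G M I s) {u : Fin n} (hu : s.reg 31 = u) (h36 : s.reg 36 = I) :
    (∀ v ∈ fset n 9 s, G.Adj u v → (search.den s).reg 36 ≤ s.mem 10 v) ∧
      ((search.den s).reg 36 = I ∨ (search.den s).reg 36 < I ∧ ∃ v ∈ fset n 9 s, G.Adj u v ∧
        (search.den s).reg 37 = v ∧ s.mem 10 v = (search.den s).reg 36) := by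
  have := loop_inv (P := when (.load 9 (.reg 32)) <| when (adjE (.reg 31) (.reg 32)) <|
    when (.sub (.reg 36) (.load 10 (.reg 32))) <|
      seq (assign 36 (.load 10 (.reg 32))) (assign 37 (.reg 32))) (x := 32) (b := 0) (s₀ := s)
    (fun k t => (∀ v ∈ fset n 9 s, G.Adj u v → k ≤ v → t.reg 36 ≤ s.mem 10 v) ∧
      (t.reg 36 = I ∨ t.reg 36 < I ∧ ∃ v ∈ fset n 9 s, G.Adj u v ∧
        t.reg 37 = v ∧ s.mem 10 v = t.reg 36))
    (fun k t v h => by simpa using h)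
    ⟨fun v _ _ hv => by rw [hE.order] at hv; omega, .inl h36⟩
    (fun k hk t hA hk' h => by
      obtain ⟨h1, h2⟩ := h
      rw [hE.order] at hk
      have h9 := hA.mem 9 rfl
      have h10 := hA.mem 10 rfl
      have h31 := (hA.reg 31 (by decide) rfl).trans hu
      have hadj := (hE.agree hA rfl rfl rfl rfl).adj u ⟨k, hk⟩
      have hcase : ∀ x, (x ≤ s.mem 10 k ∨ s.mem 9 k = 0 ∨ ¬ G.Adj u ⟨k, hk⟩) → x ≤ t.reg 36 →
          ∀ v ∈ fset n 9 s, G.Adj u v → k ≤ v → x ≤ s.mem 10 v := by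
        intro x hx hxt v hv huv hkv
        rcases hkv.eq_or_lt with rfl | hlt
        · rcases hx with hx | hx | hx
          · exact hx
          · exact absurd hx (mem_fset.1 hv)
          · exact absurd huv hx
        · exact hxt.trans (h1 v hv huv hlt)
      simp only [den_when, den, Expr.eval, h9, h10, adjE, h31, hk']
      simp only [ne_eq] at hadj
      split_ifs with g1 g2 g3
      · simp only [Store.setReg_reg, if_true, hk']
        simp only [Nat.reduceEqDiff, if_false]
        refine ⟨hcase _ (.inl le_rfl) (by omega), .inr ⟨?_, ⟨k, hk⟩, mem_fset.2 g1, hadj.1 g2, ?_⟩⟩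
        · rcases h2 with h2 | h2 <;> omega
        · simp
      · exact ⟨hcase _ (.inl (by omega)) le_rfl, h2⟩
      · exact ⟨hcase _ (.inr (.inr fun g => g2 (hadj.2 g))) le_rfl, h2⟩
      · exact ⟨hcase _ (.inr (.inl (not_not.1 g1))) le_rfl, h2⟩)
  exact ⟨fun v hv huv => this.1 v hv huv (Nat.zero_le _), this.2⟩

/-- Let vertex `reg 31` bid for its cheapest neighbour if it does not hold any vertex. -/
def bid : Prog :=
  when (.load 9 (.reg 31)) <| when (.sub (.lit 1) (.load 12 (.add (.reg 31) (.lit 1)))) <|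
    seq (assign 36 (.reg 8)) <| seq search <| when (.sub (.reg 8) (.reg 36)) <|
      seq (store 12 (.load 11 (.reg 37)) (.lit 0)) <|
      seq (store 11 (.reg 37) (.add (.reg 31) (.lit 1))) <|
      seq (store 12 (.add (.reg 31) (.lit 1)) (.lit 1)) <|
      store 10 (.reg 37) (.add (.reg 36) (.lit 1))

/-- Determine the number of vertices that can be sold. -/
def auction : Prog :=
  seq (loop 30 0 (seq (store 10 (.reg 30) (.lit 0)) <| seq (store 11 (.reg 30) (.lit 0)) <|
    store 12 (.add (.reg 30) (.lit 1)) (.lit 0))) <|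
  seq (loop 30 9 (loop 31 0 bid)) (count 10 27)

/-- The invariants of the auction as stored in the machine: prices, owners, and whether a vertex
holds another one. -/
structure IsMarket (G : SimpleGraph (Fin n)) (I : ℕ) (W : Finset (Fin n)) (m : ℕ → ℕ → ℕ) :
    Prop where
  auction : G.IsAuction W (fun v => m 10 v) fun v u => m 11 v = u + 1
  le : ∀ v : Fin n, m 10 v ≤ I
  has : ∀ u : Fin n, m 12 (u + 1) ≠ 0 ↔ ∃ v : Fin n, m 11 v = u + 1

/-- Vertex `k` cannot bid. -/
def Content (G : SimpleGraph (Fin n)) (I : ℕ) (W : Finset (Fin n)) (k : ℕ) (m : ℕ → ℕ → ℕ) :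
    Prop :=
  ∀ hk : k < n, ⟨k, hk⟩ ∈ W → m 12 (k + 1) = 0 → ∀ v ∈ W, G.Adj ⟨k, hk⟩ v → I ≤ m 10 v

lemma bid_spec (hE : Env G M I s) (hu : s.reg 31 < n) (hm : IsMarket G I (fset n 9 s) s.mem) :
    IsMarket G I (fset n 9 s) (bid.den s).mem ∧
      (((bid.den s).mem = s.mem ∧ Content G I (fset n 9 s) (s.reg 31) s.mem) ∨
        (∑ v : Fin n, (I - (bid.den s).mem 10 v) < ∑ v : Fin n, (I - s.mem 10 v) ∧
          ¬ Content G I (fset n 9 s) (s.reg 31) s.mem)) := by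
  set u : Fin n := ⟨s.reg 31, hu⟩ with hudef
  set s₁ := search.den (s.setReg 36 (s.reg 8)) with hs₁
  have hE₀ : Env G M I (s.setReg 36 (s.reg 8)) :=
    hE.of_eq (fun b hb => by
      have : b ≠ 36 := by rintro rfl; simp [params] at hb
      simp [this]) rfl rfl
  have hmem : s₁.mem = s.mem := funext fun a => (den_mem (by simp [search, wm, when]) _)
  have h31 : s₁.reg 31 = s.reg 31 := (den_reg rfl _).trans (by simp)
  have h8 : s₁.reg 8 = I := (den_reg rfl _).trans (by simp [hE.big])
  have hsearch := search_spec hE₀ (u := u) (by simp [hudef]) (by simp [hE.big])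
  rw [← hs₁, show fset n 9 (s.setReg 36 (s.reg 8)) = fset n 9 s from rfl, Store.setReg_mem]
    at hsearch
  obtain ⟨hmin, hfound⟩ := hsearch
  -- Holders are stored shifted by one, with 0 for an unsold vertex. Clearing the flag of the former
  -- holder of an unsold vertex therefore hits address 0, which belongs to no vertex.
  have hden : bid.den s = if s.mem 9 u ≠ 0 ∧ s.mem 12 (u + 1) = 0 then
      if s₁.reg 36 < I then
        (((s₁.setMem 12 (s.mem 11 (s₁.reg 37)) 0).setMem 11 (s₁.reg 37) (u + 1)).setMem 12 (u + 1)
          1).setMem 10 (s₁.reg 37) (s₁.reg 36 + 1)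
      else s₁ else s := by
    simp only [bid, den_when, den, Expr.eval, ← hs₁, hmem, h31, h8, hudef, Store.setMem_reg]
    by_cases g1 : s.mem 9 (s.reg 31) = 0
    · simp [g1]
    by_cases g2 : s.mem 12 (s.reg 31 + 1) = 0
    · by_cases g3 : s₁.reg 36 < I
      · rw [if_pos g1, if_pos (by omega), if_pos (by omega), if_pos ⟨g1, g2⟩, if_pos g3]
      · rw [if_pos g1, if_pos (by omega), if_neg (by omega), if_pos ⟨g1, g2⟩, if_neg g3]
    · rw [if_pos g1, if_neg (by omega), if_neg (fun g => g2 g.2)]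
  rw [hden]
  split_ifs with g1 g2
  · obtain ⟨g1, g3⟩ := g1
    obtain ⟨v, hvW, huv, hv37, hvp⟩ : ∃ v ∈ fset n 9 s, G.Adj u v ∧ s₁.reg 37 = v ∧
        s.mem 10 v = s₁.reg 36 := by
      rcases hfound with h | h
      · omega
      · exact h.2
    have hfree : ∀ z : Fin n, ¬ s.mem 11 z = u + 1 := by
      intro z hz
      exact (hm.has u).2 ⟨z, hz⟩ g3
    rw [hv37, ← hvp]
    set m' := ((((s₁.setMem 12 (s.mem 11 v) 0).setMem 11 v (u + 1)).setMem 12 (u + 1) 1).setMem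
      10 v (s.mem 10 v + 1)).mem with hm'
    have e10 : ∀ z : Fin n, m' 10 z = if z = v then s.mem 10 v + 1 else s.mem 10 z := fun z => by
      simp [hm', Store.setMem_mem, hmem, Fin.ext_iff]
    have e11 : ∀ z : Fin n, m' 11 z = if z = v then (u : ℕ) + 1 else s.mem 11 z := fun z => by
      simp [hm', Store.setMem_mem, hmem, Fin.ext_iff]
    have e12 : ∀ z : Fin n, m' 12 (z + 1) = if z = u then 1 else
        if (z : ℕ) + 1 = s.mem 11 v then 0 else s.mem 12 (z + 1) := fun z => by
      simp [hm', Store.setMem_mem, hmem, Fin.ext_iff]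
    refine ⟨⟨hm.auction.bid (mem_fset.2 g1) hvW huv hfree (fun z hz huz => ?_) e10 (fun z w => ?_),
      fun z => ?_, fun z => ?_⟩, .inr ⟨?_, fun h => ?_⟩⟩
    · rw [hvp]; exact hmin z hz huz
    · rw [e11]
      split_ifs
      · rw [Fin.ext_iff]; omega
      · rfl
    · rw [e10]
      split_ifs
      · omega
      · exact hm.le z
    · rw [e12]
      split_ifs with k1 k2
      · subst k1
        simp only [ne_eq, one_ne_zero, not_false_eq_true, true_iff]
        exact ⟨v, by rw [e11, if_pos rfl]⟩
      · simp only [ne_eq, not_true_eq_false, false_iff]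
        rintro ⟨y, hy⟩
        rw [e11] at hy
        split_ifs at hy with k3
        · exact k1 (Fin.ext (by omega))
        · exact k3 (hm.auction.left y v z hy k2.symm)
      · rw [hm.has]
        refine exists_congr fun y => ?_
        rw [e11]
        split_ifs with k3
        · subst k3
          refine ⟨fun h => absurd h.symm k2, fun h => absurd (Fin.ext (by omega)) k1⟩
        · rfl
    · refine sum_lt_sum (fun z _ => ?_) ⟨v, mem_univ _, ?_⟩
      · rw [e10]
        split_ifs with k1
        · subst k1; omega
        · exact le_rfl
      · rw [e10, if_pos rfl]; omega
    · have := h hu (mem_fset.2 g1) g3 v hvW huv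
      omega
  · rw [hmem]
    refine ⟨hm, .inl ⟨rfl, fun hk _ _ v hv huv => ?_⟩⟩
    have := hmin v hv huv
    omega
  · refine ⟨hm, .inl ⟨rfl, fun hk h1 h2 => absurd ⟨mem_fset.1 h1, h2⟩ g1⟩⟩

lemma auction_spec (hE : Env G M I s) :
    G.IsCoverNumber (fset n 9 s) ((auction.den s).reg 27) := by
  set s₁ := (loop 30 0 (seq (store 10 (.reg 30) (.lit 0)) <| seq (store 11 (.reg 30) (.lit 0)) <|
    store 12 (.add (.reg 30) (.lit 1)) (.lit 0))).den s with hs₁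
  set s₂ := (loop 30 9 (loop 31 0 bid)).den s₁ with hs₂
  have hE₁ : Env G M I s₁ := hE.den rfl rfl rfl
  have hE₂ : Env G M I s₂ := hE₁.den rfl rfl rfl
  have h9 : s₁.mem 9 = s.mem 9 := den_mem rfl s
  have hinit : ∀ v : Fin n, s₁.mem 10 v = 0 ∧ s₁.mem 11 v = 0 ∧ s₁.mem 12 (v + 1) = 0 := by
    have := loop_inv (P := seq (store 10 (.reg 30) (.lit 0)) <|
        seq (store 11 (.reg 30) (.lit 0)) <| store 12 (.add (.reg 30) (.lit 1)) (.lit 0))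
      (x := 30) (b := 0) (s₀ := s)
      (fun k t => ∀ v : Fin n, k ≤ v → t.mem 10 v = 0 ∧ t.mem 11 v = 0 ∧ t.mem 12 (v + 1) = 0)
      (fun k t v h => h) (fun v hv => by rw [hE.order] at hv; omega)
      (fun k hk t hA hk' h v hv => by
        simp only [den, Expr.eval, Store.setMem_mem, Store.setMem_reg, hk']
        rcases hv.eq_or_lt with rfl | hv
        · simp
        · have := h v hv
          simp [this])
    exact fun v => this v (Nat.zero_le _)
  -- Every bid raises a price that is below `I`, so the total distance of the prices from `I` bounds
  -- the number of bids.
  have hfinal := repeat_spec (P := loop 31 0 bid) (x := 30) (b := 9) (s₀ := s₁) Store.mem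
    (IsMarket G I (fset n 9 s)) (fun m => ∀ k < n, Content G I (fset n 9 s) k m)
    (fun m => ∑ v : Fin n, (I - m 10 v)) (fun _ _ => rfl) (by
      intro s' hA _ hg
      have hE' := hE₁.agree hA rfl rfl rfl rfl
      have h9' : s'.mem 9 = s.mem 9 := (hA.mem 9 rfl).trans h9
      have hscan := scan_spec (P := bid) (x := 31) (b := 0) (s₀ := s') Store.mem
        (IsMarket G I (fset n 9 s)) (Content G I (fset n 9 s))
        (fun m => ∑ v : Fin n, (I - m 10 v)) (fun _ _ => rfl) (by
          intro t hA' hu hgt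
          have ht : fset n 9 t = fset n 9 s := fset_congr ((hA'.mem 9 rfl).trans h9')
          have := bid_spec (hE'.agree hA' rfl rfl rfl rfl) (by rwa [hE'.order] at hu)
            (by rwa [ht])
          rwa [ht] at this) hg
      rwa [hE'.order] at hscan)
    ⟨⟨fun v u h => by rw [(hinit v).2.1] at h; omega,
      fun v _ u h => by rw [(hinit v).2.1] at h; omega,
      fun v u _ h => by rw [(hinit v).2.1] at h; omega,
      fun v => by simp [(hinit v).1, (hinit v).2.1],
      fun v u h => by rw [(hinit v).2.1] at h; omega⟩,
      fun v => by simp [(hinit v).1],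
      fun u => by simp [(hinit u).2.2, fun v : Fin n => (hinit v).2.1]⟩
    (by
      rw [hE₁.rounds]
      calc ∑ v : Fin n, (I - s₁.mem 10 v) ≤ ∑ _v : Fin n, I := sum_le_sum fun v _ => by omega
        _ = n * I := by simp
        _ < I * I := Nat.mul_lt_mul_of_pos_right hE.lt (Nat.zero_lt_of_lt hE.lt))
  obtain ⟨hm, hc⟩ := hfinal
  have hcount : (auction.den s).reg 27 = #{v : Fin n | 0 < s₂.mem 10 v} := by
    rw [show auction.den s = (count 10 27).den s₂ from rfl, count_spec hE₂.order (by decide)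
      (by decide)]
    simp only [fset, Nat.pos_iff_ne_zero]
  rw [hcount]
  refine hm.auction.isCoverNumber (by simpa using hE.lt) fun u hu hfree v hv huv => ?_
  refine hc u u.2 u.2 hu ?_ v hv huv
  by_contra h
  obtain ⟨v, hv⟩ := (hm.has u).1 h
  exact hfree v hv

/-! ### From a bipartite graph to a maximum independent set -/

/-- Remove vertex `reg 33` from bank 9 if that makes the cover number smaller. -/
def pruneStep : Prog :=
  when (.load 9 (.reg 33)) <| seq (store 9 (.reg 33) (.lit 0)) <| seq auction <|
    ite (neE (.reg 27) (.reg 28)) (assign 28 (.reg 27)) (store 9 (.reg 33) (.lit 1))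

/-- Reduce the set in bank 9 to a maximum independent set of the graph that it spans, if that is
bipartite. -/
def prune : Prog := seq auction (seq (assign 28 (.reg 27)) (loop 33 0 pruneStep))

/-- The cover number in register 28 stays correct for every graph. Only the reduction invariant
needs a 2-colouring. -/
lemma pruneStep_spec (hE : Env G M I s) (hu : s.reg 33 < n)
    (hm : G.IsCoverNumber (fset n 9 s) (s.reg 28)) :
    G.IsCoverNumber (fset n 9 (pruneStep.den s)) ((pruneStep.den s).reg 28) ∧
      fset n 9 (pruneStep.den s) ⊆ fset n 9 s ∧
      ∀ D a, (∃ χ : Fin n → Bool, ∀ u v, u ∈ fset n 9 s → v ∈ fset n 9 s → G.Adj u v → χ u ≠ χ v) →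
        G.IsReduction (fset n 9 s) D (s.reg 28) a →
        G.IsReduction (fset n 9 (pruneStep.den s)) (insert ⟨s.reg 33, hu⟩ D)
          ((pruneStep.den s).reg 28) a := by
  set s₁ := s.setMem 9 (s.reg 33) 0 with hs₁
  set s₂ := auction.den s₁ with hs₂
  have hE₁ : Env G M I s₁ := hE.of_eq (fun _ _ => rfl) (Store.setMem_mem_of_ne _ _ _ (by decide))
    (Store.setMem_mem_of_ne _ _ _ (by decide))
  have hcov := auction_spec hE₁
  rw [← hs₂] at hcov
  have h28 : s₂.reg 28 = s.reg 28 := den_reg (P := auction) rfl s₁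
  have h33 : s₂.reg 33 = s.reg 33 := den_reg (P := auction) rfl s₁
  have h9 : s₂.mem 9 = s₁.mem 9 := den_mem (P := auction) rfl s₁
  have hW₁ : fset n 9 s₁ = (fset n 9 s).erase ⟨s.reg 33, hu⟩ := by
    ext v
    simp only [mem_fset, hs₁, Store.setMem_mem, true_and, mem_erase, ne_eq, Fin.ext_iff]
    split_ifs with h <;> simp [h]
  have hden : pruneStep.den s = if s.mem 9 (s.reg 33) ≠ 0 then
      if s₂.reg 27 ≠ s.reg 28 then s₂.setReg 28 (s₂.reg 27) else s₂.setMem 9 (s.reg 33) 1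
      else s := by
    have := eval_neE (.reg 27) (.reg 28) s₂
    simp only [Expr.eval, h28] at this
    simp only [pruneStep, den_when, den, Expr.eval, ← hs₁, ← hs₂, h33]
    split_ifs <;> tauto
  rw [hden]
  split_ifs with g1 g2
  · have hw : (⟨s.reg 33, hu⟩ : Fin n) ∈ fset n 9 s := mem_fset.2 g1
    have hW : fset n 9 (s₂.setReg 28 (s₂.reg 27)) = (fset n 9 s).erase ⟨s.reg 33, hu⟩ := by
      rw [← hW₁]; exact fset_congr h9
    rw [hW, Store.setReg_reg, if_pos rfl]
    rw [hW₁] at hcov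
    exact ⟨hcov, erase_subset _ _, fun D a hχ hred => hred.erase hm hw hcov g2 hχ⟩
  · have hw : (⟨s.reg 33, hu⟩ : Fin n) ∈ fset n 9 s := mem_fset.2 g1
    have hW : fset n 9 (s₂.setMem 9 (s.reg 33) 1) = fset n 9 s := by
      ext v
      simp only [mem_fset, Store.setMem_mem, true_and, h9, hs₁]
      split_ifs with h
      · simp [h, g1]
      · rfl
    rw [hW, Store.setMem_reg, h28]
    rw [hW₁, not_not.1 g2] at hcov
    exact ⟨hm, Subset.rfl, fun D a _ hred => hred.keep hw hcov⟩
  · exact ⟨hm, Subset.rfl, fun D a _ hred => hred.insert_of_notMem fun h => g1 (mem_fset.1 h)⟩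

lemma prune_spec (hE : Env G M I s) :
    G.IsCoverNumber (fset n 9 (prune.den s)) ((prune.den s).reg 28) ∧
      ((∃ χ : Fin n → Bool, ∀ u v, u ∈ fset n 9 s → v ∈ fset n 9 s → G.Adj u v → χ u ≠ χ v) →
        (prune.den s).reg 28 = 0 ∧ ∀ J ⊆ fset n 9 s, G.IsIndepSet (J : Set (Fin n)) →
          #J ≤ #(fset n 9 (prune.den s))) := by
  classical
  set s₁ := (auction.den s).setReg 28 ((auction.den s).reg 27) with hs₁
  have hE₁ : Env G M I s₁ := (hE.den (P := auction) rfl rfl rfl).of_eq (fun b hb => by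
    have : b ≠ 28 := by rintro rfl; simp [params] at hb
    simp [hs₁, this]) rfl rfl
  have hW₁ : fset n 9 s₁ = fset n 9 s := fset_congr (den_mem (P := auction) rfl s)
  have hm₁ : G.IsCoverNumber (fset n 9 s) (s₁.reg 28) := by
    simpa [hs₁] using auction_spec hE
  have hden : prune.den s = (loop 33 0 pruneStep).den s₁ := rfl
  rw [hden]
  -- `hyp` is instantiated twice: by `False` to obtain the certificate without any assumption, and
  -- by `True` in the bipartite case.
  have hfinal : ∀ a, ∀ hyp : Prop, (hyp → G.IsReduction (fset n 9 s) ∅ (s₁.reg 28) a) →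
      (hyp → ∃ χ : Fin n → Bool, ∀ u v, u ∈ fset n 9 s → v ∈ fset n 9 s → G.Adj u v →
        χ u ≠ χ v) →
      G.IsCoverNumber (fset n 9 ((loop 33 0 pruneStep).den s₁))
        (((loop 33 0 pruneStep).den s₁).reg 28) ∧
      (hyp → G.IsReduction (fset n 9 ((loop 33 0 pruneStep).den s₁)) univ
        (((loop 33 0 pruneStep).den s₁).reg 28) a) := by
    intro a hyp hred hχ
    have := loop_inv (P := pruneStep) (x := 33) (b := 0) (s₀ := s₁)
      (fun k t => fset n 9 t ⊆ fset n 9 s ∧ G.IsCoverNumber (fset n 9 t) (t.reg 28) ∧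
        (hyp → G.IsReduction (fset n 9 t) (univ.filter fun v : Fin n => k ≤ v) (t.reg 28) a))
      (fun k t v h => by simpa using h)
      ⟨by rw [hW₁], by rwa [hW₁], fun hy => by
        rw [hW₁, hE₁.order, filter_eq_empty_iff.2 fun v _ => by omega]
        exact hred hy⟩
      (fun k hk t hA hk' h => by
        rw [hE₁.order] at hk
        obtain ⟨h1, h2, h3⟩ := h
        obtain ⟨h4, h5, h6⟩ := pruneStep_spec (hE₁.agree hA rfl rfl rfl rfl) (by omega) h2
        refine ⟨h5.trans h1, h4, fun hy => ?_⟩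
        obtain ⟨χ, hχ⟩ := hχ hy
        have h7 := h6 _ a ⟨χ, fun u v hu hv => hχ u v (h1 hu) (h1 hv)⟩ (h3 hy)
        convert h7 using 1
        ext v
        simp only [mem_filter, mem_univ, true_and, mem_insert, Fin.ext_iff, hk']
        omega)
    refine ⟨this.2.1, fun hy => ?_⟩
    have h := this.2.2 hy
    rwa [filter_true_of_mem fun v _ => Nat.zero_le _] at h
  refine ⟨(hfinal 0 False False.elim False.elim).1, fun hχ => ?_⟩
  obtain ⟨J, hJW, hJ, hJc⟩ := hm₁.exists_isIndepSet hχ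
  obtain ⟨h1, h2⟩ := ((hfinal #J True (fun _ => ⟨hJc, ⟨J, hJW, hJ, rfl⟩, fun w _ hw => by
    simp at hw⟩) fun _ => hχ).2 trivial).eq_zero
  refine ⟨h1, fun K hK hKi => ?_⟩
  have := hm₁.two_mul_card_add_le hK hKi
  omega

/-- Bank 1 holds an independent set, and its size is in register 26. -/
structure OutInv (G : SimpleGraph (Fin n)) (s : Store) : Prop where
  indep : G.IsIndepSet (fset n 1 s : Set (Fin n))
  card : #(fset n 1 s) = s.reg 26

/-- If the set in bank 9 is independent and larger than that in bank 1, replace the latter. -/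
def update : Prog :=
  when (.sub (.lit 1) (.reg 28)) <| seq (count 9 38) <| when (.sub (.reg 38) (.reg 26)) <|
    seq (assign 26 (.reg 38)) (loop 30 0 (store 1 (.reg 30) (.load 9 (.reg 30))))

/-- Only a set of cover number zero is copied to the output, so the output is independent whatever
the search has been fed with. -/
lemma update_spec (hE : Env G M I s) (ho : OutInv G s)
    (hm : G.IsCoverNumber (fset n 9 s) (s.reg 28)) :
    OutInv G (update.den s) ∧ s.reg 26 ≤ (update.den s).reg 26 ∧
      (s.reg 28 = 0 → #(fset n 9 s) ≤ (update.den s).reg 26) := by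
  set s₁ := (count 9 38).den s with hs₁
  have h38 : s₁.reg 38 = #(fset n 9 s) := count_spec hE.order (by decide) (by decide)
  have h26 : s₁.reg 26 = s.reg 26 := den_reg (P := count 9 38) rfl s
  have h0 : s₁.reg 0 = n := (den_reg (P := count 9 38) rfl s).trans hE.order
  have h1 : s₁.mem 1 = s.mem 1 := den_mem (P := count 9 38) rfl s
  have h9 : s₁.mem 9 = s.mem 9 := den_mem (P := count 9 38) rfl s
  set s₂ := s₁.setReg 26 (s₁.reg 38) with hs₂
  set s₃ := (loop 30 0 (store 1 (.reg 30) (.load 9 (.reg 30)))).den s₂ with hs₃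
  have hden : update.den s = if s.reg 28 = 0 then
      if s.reg 26 < #(fset n 9 s) then s₃ else s₁ else s := by
    have : update.den s = if 1 - s.reg 28 ≠ 0 then
      if s₁.reg 38 - s₁.reg 26 ≠ 0 then s₃ else s₁ else s := rfl
    rw [this, h38, h26]
    split_ifs <;> first | rfl | omega
  rw [hden]
  split_ifs with g1 g2
  · have hf : fset n 1 s₃ = fset n 9 s := by
      ext v
      have : s₃.mem 1 v = s.mem 9 v := fill_spec (a := 1) (b := 0) (x := 30) (s := s₂)
        (fun v => s.mem 9 v) (fun t hA _ v => by
          have : t.mem 9 = s.mem 9 := (hA.mem 9 rfl).trans h9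
          simp only [den, Expr.eval, this, Store.setMem_mem, true_and]
          split_ifs with h
          · rw [h]
          · rfl) v (by simp [hs₂, h0])
      rw [mem_fset, mem_fset, this]
    have h26' : s₃.reg 26 = #(fset n 9 s) :=
      (den_reg rfl s₂).trans (by simp [hs₂, h38])
    refine ⟨⟨?_, ?_⟩, by omega, fun _ => h26'.ge⟩
    · rw [hf]
      rw [g1] at hm
      exact hm.isIndepSet
    · rw [hf, h26']
  · have hf : fset n 1 s₁ = fset n 1 s := fset_congr h1
    exact ⟨⟨by rw [hf]; exact ho.indep, by rw [hf, h26]; exact ho.card⟩, h26.ge, fun _ => by omega⟩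
  · exact ⟨ho, le_rfl, fun h => absurd h g1⟩

end Prog

end RAM


/-! ### The nested search over guesses, triples and layers. -/

namespace RAM

namespace Prog

open SimpleGraph Finset

variable {n M I : ℕ} {G : SimpleGraph (Fin n)} {s : Store}

/-- The program keeps the output independent and does not make it smaller. -/
def Sound (G : SimpleGraph (Fin n)) (M I : ℕ) (P : Prog) : Prop :=
  ∀ s, Env G M I s → OutInv G s → OutInv G (P.den s) ∧ s.reg 26 ≤ (P.den s).reg 26

lemma OutInv.of_eq (h : OutInv G s) {s' : Store} (h1 : s'.mem 1 = s.mem 1)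
    (h26 : s'.reg 26 = s.reg 26) : OutInv G s' := by
  have : fset n 1 s' = fset n 1 s := fset_congr h1
  exact ⟨by rw [this]; exact h.indep, by rw [this, h26]; exact h.card⟩

lemma OutInv.setReg (h : OutInv G s) {x : ℕ} (hx : x ≠ 26) (v : ℕ) : OutInv G (s.setReg x v) :=
  h.of_eq rfl (by simp [hx.symm])

lemma sound_of_wr {P : Prog} (h1 : P.wm 1 = false) (h26 : P.wr 26 = false) : Sound G M I P :=
  fun s _ ho => ⟨ho.of_eq (den_mem h1 s) (den_reg h26 s), (den_reg h26 s).ge⟩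

/-- The program does not change the data that are fixed during the search. -/
def tame (P : Prog) : Bool := P.std params && !P.wm 0 && !P.wm 2

lemma Env.den_tame (h : Env G M I s) {P : Prog} (hP : P.tame = true) : Env G M I (P.den s) := by
  simp only [tame, Bool.and_eq_true, Bool.not_eq_true'] at hP
  exact h.den hP.1.1 hP.1.2 hP.2

lemma Env.agree_tame (h : Env G M I s) {P : Prog} {x : ℕ} {s' : Store} (hA : Agree P x s s')
    (hx : params x = false) (hP : P.tame = true) : Env G M I s' := by
  simp only [tame, Bool.and_eq_true, Bool.not_eq_true'] at hP
  exact h.agree hA hx hP.1.1 hP.1.2 hP.2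

lemma Sound.seq {P Q : Prog} (hP : Sound G M I P) (hQ : Sound G M I Q) (ht : P.tame = true) :
    Sound G M I (P.seq Q) := fun s hE ho => by
  obtain ⟨h1, h2⟩ := hP s hE ho
  obtain ⟨h3, h4⟩ := hQ _ (hE.den_tame ht) h1
  exact ⟨h3, h2.trans h4⟩

/-- A loop over a sound program attains whatever one of its rounds attains. -/
lemma Sound.loop_hit {P : Prog} (hP : Sound G M I P) (ht : P.tame = true) {x b k : ℕ}
    (hx : params x = false) (hx' : x ≠ 26) (hE : Env G M I s) (ho : OutInv G s) {p : ℕ → Prop}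
    (hp : Monotone p) (hk : k < s.reg b)
    (hnew : ∀ t, Agree P x s t → Env G M I t → OutInv G t → t.reg x = k → p ((P.den t).reg 26)) :
    p (((loop x b P).den s).reg 26) := by
  refine Prog.loop_hit (OutInv G) (fun t => p (t.reg 26)) (fun t v h => h.setReg hx' v)
    (fun t v h => by simpa [hx'.symm] using h) ho
    (fun t hA _ h => (hP t (hE.agree_tame hA hx ht) h).1)
    (fun t hA _ h hh => hp (hP t (hE.agree_tame hA hx ht) h).2 hh) hk
    (fun t hA hk' h => hnew t hA (hE.agree_tame hA hx ht) h hk')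

lemma Sound.loop {P : Prog} (hP : Sound G M I P) (ht : P.tame = true) {x b : ℕ}
    (hx : params x = false) (hx' : x ≠ 26) : Sound G M I (loop x b P) := fun s hE ho =>
  loop_inv (P := P) (x := x) (b := b) (s₀ := s)
    (fun _ t => OutInv G t ∧ s.reg 26 ≤ t.reg 26)
    (fun _ t v h => ⟨h.1.setReg hx' v, by simpa [hx'.symm] using h.2⟩) ⟨ho, le_rfl⟩
    (fun _ _ t hA _ h => by
      obtain ⟨h1, h2⟩ := hP t (hE.agree_tame hA hx ht) h.1
      exact ⟨h1, h.2.trans h2⟩)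

/-- Examine the vertices of bank 5 outside of layer `reg 25` of bank 6 and layer `reg 24` of
bank 8. -/
def examine : Prog := seq buildCore (seq prune update)

lemma examine_sound : Sound G M I examine := fun s hE ho => by
  have hE₁ : Env G M I (buildCore.den s) := hE.den_tame rfl
  have ho₁ : OutInv G (buildCore.den s) := ho.of_eq (den_mem rfl s) (den_reg rfl s)
  have hE₂ : Env G M I (prune.den (buildCore.den s)) := hE₁.den_tame rfl
  have ho₂ : OutInv G (prune.den (buildCore.den s)) := ho₁.of_eq (den_mem rfl _) (den_reg rfl _)
  obtain ⟨h1, h2, -⟩ := update_spec hE₂ ho₂ (prune_spec hE₁).1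
  refine ⟨h1, le_trans (le_of_eq ?_) h2⟩
  rw [den_reg (P := prune) rfl, den_reg (P := buildCore) rfl]

lemma examine_spec (hE : Env G M I s) (ho : OutInv G s)
    (hχ : ∃ χ : Fin n → Bool, ∀ u v,
      u ∈ {z | z ∈ vset n 5 s ∧ s.mem 6 z ≠ s.reg 25 ∧ s.mem 8 z ≠ s.reg 24} →
      v ∈ {z | z ∈ vset n 5 s ∧ s.mem 6 z ≠ s.reg 25 ∧ s.mem 8 z ≠ s.reg 24} →
      G.Adj u v → χ u ≠ χ v) {J : Finset (Fin n)} (hJ : G.IsIndepSet (J : Set (Fin n)))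
    (hJW : ∀ v ∈ J, v ∈ vset n 5 s ∧ s.mem 6 v ≠ s.reg 25 ∧ s.mem 8 v ≠ s.reg 24) :
    #J ≤ (examine.den s).reg 26 := by
  have hE₁ : Env G M I (buildCore.den s) := hE.den_tame rfl
  have ho₁ : OutInv G (buildCore.den s) := ho.of_eq (den_mem rfl s) (den_reg rfl s)
  have hE₂ : Env G M I (prune.den (buildCore.den s)) := hE₁.den_tame rfl
  have ho₂ : OutInv G (prune.den (buildCore.den s)) := ho₁.of_eq (den_mem rfl _) (den_reg rfl _)
  obtain ⟨h1, h2⟩ := prune_spec hE₁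
  obtain ⟨-, -, h3⟩ := update_spec hE₂ ho₂ h1
  have hmem : ∀ v, v ∈ fset n 9 (buildCore.den s) ↔
      v ∈ vset n 5 s ∧ s.mem 6 v ≠ s.reg 25 ∧ s.mem 8 v ≠ s.reg 24 := fun v => by
    rw [mem_fset]; exact buildCore_spec hE v
  obtain ⟨h4, h5⟩ := h2 (hχ.imp fun χ h u v hu hv => h u v ((hmem u).1 hu) ((hmem v).1 hv))
  exact (h5 J (fun v hv => (hmem v).2 (hJW v hv)) hJ).trans (h3 h4)

/-- Examine the complements of all pairs of layers. -/
def scanLayers : Prog := loop 24 8 (loop 25 8 examine)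

lemma scanLayers_sound : Sound G M I scanLayers :=
  (examine_sound.loop rfl rfl (by decide)).loop rfl rfl (by decide)

/-- An expression that is nonzero if and only if registers 30 and 21 agree. -/
def isSource : Expr := .sub (.lit 1) (neE (.reg 30) (.reg 21))

/-- Take the layers around vertex `reg 21`, and those around the shortest paths from there to
vertices `reg 22` and `reg 23`. -/
def forTriple : Prog :=
  seq (level 6 isSource) (seq fork (seq (level 8 (.load 7 (.reg 30))) scanLayers))

lemma forTriple_sound : Sound G M I forTriple :=
  (sound_of_wr rfl rfl).seq ((sound_of_wr rfl rfl).seq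
    ((sound_of_wr rfl rfl).seq scanLayers_sound rfl) rfl) rfl

/-- Examine all triples of vertices. -/
def scanTriples : Prog := loop 21 0 (loop 22 0 (loop 23 0 forTriple))

lemma scanTriples_sound : Sound G M I scanTriples :=
  ((forTriple_sound.loop rfl rfl (by decide)).loop rfl rfl (by decide)).loop rfl rfl (by decide)

/-- The nested loops meet the triple and the layers of `exists_good_layers` in some round. The
vertices of `S` off the two layers then form an independent set in a bipartite graph, and the
maximum found there is no smaller. -/
lemma scanTriples_spec (hE : Env G M I s) (ho : OutInv G s) (hG : G.iocp ≤ 1) {e : ℕ} (he : 1 ≤ e)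
    (hI : n + 6 * e < I) [DecidableRel G.Adj] {S : Finset (Fin n)}
    (hS : G.IsIndepSet (S : Set (Fin n))) (hSW : ∀ v ∈ S, v ∈ vset n 5 s)
    (hlight : ∀ v ∈ vset n 5 s, 12 * e ^ 2 * #(S.filter fun u => G.Adj v u) ≤ #S) :
    e * #S ≤ e * (scanTriples.den s).reg 26 + #S := by
  classical
  rcases Nat.eq_zero_or_pos n with rfl | hn
  · rw [show #S = 0 by rw [card_eq_zero]; exact eq_empty_of_isEmpty S]; simp
  have : Nonempty (Fin n) := ⟨⟨0, hn⟩⟩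
  obtain ⟨r, x, y, hgood⟩ := exists_good_layers hG S (vset n 5 s) he (by simpa using hI) hlight
  -- Monotone in the size of the output, so what the right round attains survives all later rounds.
  have hp : Monotone fun m => e * #S ≤ e * m + #S := fun a b hab h =>
    h.trans (by have := Nat.mul_le_mul_left e hab; omega)
  refine Sound.loop_hit ((forTriple_sound.loop rfl rfl (by decide)).loop rfl rfl (by decide)) rfl
    (k := r) rfl (by decide) hE ho hp (by rw [hE.order]; exact r.2) fun t₁ hA₁ hE₁ ho₁ hr => ?_
  refine Sound.loop_hit (forTriple_sound.loop rfl rfl (by decide)) rfl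
    (k := x) rfl (by decide) hE₁ ho₁ hp (by rw [hE₁.order]; exact x.2) fun t₂ hA₂ hE₂ ho₂ hx => ?_
  refine Sound.loop_hit forTriple_sound rfl
    (k := y) rfl (by decide) hE₂ ho₂ hp (by rw [hE₂.order]; exact y.2) fun t hA₃ hEt hot hy => ?_
  have hr : t.reg 21 = r := (hA₃.reg 21 (by decide) rfl).trans
    ((hA₂.reg 21 (by decide) rfl).trans hr)
  have hx : t.reg 22 = x := (hA₃.reg 22 (by decide) rfl).trans hx
  have h5 : t.mem 5 = s.mem 5 := (hA₃.mem 5 rfl).trans ((hA₂.mem 5 rfl).trans (hA₁.mem 5 rfl))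
  have hW : vset n 5 t = vset n 5 s := by unfold vset; rw [h5]
  set u₁ := (level 6 isSource).den t with hu₁
  set u₂ := fork.den u₁ with hu₂
  set u₃ := (level 8 (.load 7 (.reg 30))).den u₂ with hu₃
  have hEu₁ : Env G M I u₁ := hEt.den_tame rfl
  have hEu₂ : Env G M I u₂ := hEu₁.den_tame rfl
  have hEu₃ : Env G M I u₃ := hEu₂.den_tame rfl
  have hou₃ : OutInv G u₃ := ((hot.of_eq (s' := u₁) (den_mem rfl _) (den_reg rfl _)).of_eq
    (s' := u₂) (den_mem rfl _) (den_reg rfl _)).of_eq (den_mem rfl _) (den_reg rfl _)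
  have hW₁ : vset n 5 u₁ = vset n 5 s := by
    rw [← hW]; unfold vset; rw [show u₁.mem 5 = t.mem 5 from den_mem rfl _]
  have hW₂ : vset n 5 u₂ = vset n 5 s := by
    rw [← hW₁]; unfold vset; rw [show u₂.mem 5 = u₁.mem 5 from den_mem rfl _]
  have hW₃ : vset n 5 u₃ = vset n 5 s := by
    rw [← hW₂]; unfold vset; rw [show u₃.mem 5 = u₂.mem 5 from den_mem rfl _]
  have h6₂ : u₂.mem 6 = u₁.mem 6 := den_mem rfl _
  have h6₃ : u₃.mem 6 = u₁.mem 6 := (den_mem rfl _).trans h6₂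
  have hd₁ : (G.restrictTo (vset n 5 s)).IsLevel I {r} fun v : Fin n => u₁.mem 6 v := by
    rw [← hW]
    refine level_spec hEt (by decide) fun s' v h21 _ h30 => ?_
    have h := eval_neE (.reg 30) (.reg 21) s'
    simp only [Expr.eval, h30, h21, hr, Set.mem_singleton_iff, Fin.ext_iff, isSource] at h ⊢
    omega
  have hK : (G.restrictTo (vset n 5 s)).IsFork I (fun v : Fin n => u₁.mem 6 v) r x y
      (vset n 7 u₂) := by
    rw [← hW₁] at hd₁ ⊢
    exact fork_spec hEu₁ ((den_reg rfl _).trans hx) ((den_reg rfl _).trans hy) hd₁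
  have hd₂ : (G.restrictTo (vset n 5 s)).IsLevel I (vset n 7 u₂) fun v : Fin n => u₃.mem 8 v := by
    rw [← hW₂]
    refine level_spec hEu₂ (by decide) fun s' v _ h7 h30 => ?_
    simp only [Expr.eval, h30, h7, mem_vset]
  obtain ⟨j, hj, a, ha, hχ, hcount⟩ := hgood _ hd₁ _ hK _ hd₂
  change e * #S ≤ e * (scanLayers.den u₃).reg 26 + #S
  refine Sound.loop_hit (examine_sound.loop rfl rfl (by decide)) rfl
    (k := j) rfl (by decide) hEu₃ hou₃ hp (by rw [hEu₃.big]; exact hj) fun w₁ hB₁ hF₁ hq₁ hj' => ?_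
  refine Sound.loop_hit examine_sound rfl
    (k := a) rfl (by decide) hF₁ hq₁ hp (by rw [hF₁.big]; exact ha) fun w hB₂ hF hq ha' => ?_
  have hj' : w.reg 24 = j := (hB₂.reg 24 (by decide) rfl).trans hj'
  have h5w : w.mem 5 = u₃.mem 5 := (hB₂.mem 5 rfl).trans (hB₁.mem 5 rfl)
  have h6w : w.mem 6 = u₁.mem 6 := ((hB₂.mem 6 rfl).trans (hB₁.mem 6 rfl)).trans h6₃
  have h8w : w.mem 8 = u₃.mem 8 := (hB₂.mem 8 rfl).trans (hB₁.mem 8 rfl)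
  have hWw : vset n 5 w = vset n 5 s := by rw [← hW₃]; unfold vset; rw [h5w]
  have hex := examine_spec hF hq (by rw [hWw, h6w, h8w, hj', ha']; exact hχ)
    (J := S.filter fun u => ¬ (u₁.mem 6 u = a ∨ u₃.mem 8 u = j))
    (hS.mono (by exact_mod_cast filter_subset _ S)) (fun v hv => by
      rw [Finset.mem_filter, not_or] at hv
      rw [hWw, h6w, h8w, hj', ha']
      exact ⟨hSW v hv.1, hv.2⟩)
  have hsum := card_filter_add_card_filter_not (s := S) fun u => u₁.mem 6 u = a ∨ u₃.mem 8 u = j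
  have h1 := Nat.mul_le_mul_left e hex
  rw [← hsum, Nat.mul_add]
  rw [← hsum] at hcount
  omega

/-- Select a part of the sample according to the binary digits of register 20, and search in the
rest of the graph. -/
def guess : Prog := seq (digits 4 20 7 (.lit 2)) (seq buildRest scanTriples)

lemma guess_sound : Sound G M I guess :=
  (sound_of_wr rfl rfl).seq ((sound_of_wr rfl rfl).seq scanTriples_sound rfl) rfl

/-- Search with every part of the sample. -/
def searchAll : Prog := loop 20 7 guess

lemma searchAll_sound : Sound G M I searchAll := guess_sound.loop rfl rfl (by decide)

/-- In the round that selects exactly the members of the sample lying in `S`, no vertex of `S` is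
removed, and any vertex with many neighbours in `S` is adjacent to a selected one and goes. -/
lemma searchAll_spec (hE : Env G M I s) (ho : OutInv G s) (hG : G.iocp ≤ 1) {e : ℕ} (he : 1 ≤ e)
    (hI : n + 6 * e < I) [DecidableRel G.Adj] {S : Finset (Fin n)}
    (hS : G.IsIndepSet (S : Set (Fin n)))
    (hhit : ∀ v, #S < 12 * e ^ 2 * #(S.filter fun u => G.Adj v u) →
      ∃ i < M, ∃ u ∈ S, G.Adj v u ∧ s.mem 3 i = u) :
    e * #S ≤ e * (searchAll.den s).reg 26 + #S := by
  classical
  obtain ⟨z, hz, hzd⟩ := exists_digits 2 M (fun i => if ∃ u ∈ S, s.mem 3 i = u then 1 else 0)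
    (fun i _ => by split_ifs <;> omega)
  have hp : Monotone fun m => e * #S ≤ e * m + #S := fun a b hab h =>
    h.trans (by have := Nat.mul_le_mul_left e hab; omega)
  refine guess_sound.loop_hit rfl (k := z) rfl (by decide) hE ho hp (by rw [hE.guesses]; exact hz)
    fun t hA hEt hot hzt => ?_
  have h3 : t.mem 3 = s.mem 3 := hA.mem 3 rfl
  set t₁ := (digits 4 20 7 (.lit 2)).den t with ht₁
  have hE₁ : Env G M I t₁ := hEt.den_tame rfl
  have ho₁ : OutInv G t₁ := hot.of_eq (den_mem rfl _) (den_reg rfl _)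
  have h4 : ∀ i < M, t₁.mem 4 i = if ∃ u ∈ S, s.mem 3 i = u then 1 else 0 := by
    intro i hi
    rw [← hzd i hi, ht₁, digits_spec (B := 2) (by omega) (fun _ _ => rfl) (by omega)
      (by rw [hzt, hEt.guesses]; omega) i (by rw [hEt.sample]; exact hi), hzt, hEt.sample]
  have h3₁ : t₁.mem 3 = s.mem 3 := (den_mem rfl _).trans h3
  have hrest : ∀ v : Fin n, v ∈ vset n 5 (buildRest.den t₁) ↔
      ∀ i < M, ∀ u ∈ S, s.mem 3 i = u → ¬ G.Adj u v := by
    intro v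
    rw [buildRest_spec hE₁]
    refine forall₂_congr fun i hi => ?_
    rw [h4 i hi, h3₁]
    constructor
    · intro h u hu hiu huv
      rw [if_pos ⟨u, hu, hiu⟩, hiu] at h
      exact (hE₁.adj u v).2 huv (h one_ne_zero)
    · intro h h1
      have : ∃ u ∈ S, s.mem 3 i = u := by
        by_contra h2
        rw [if_neg h2] at h1
        exact h1 rfl
      obtain ⟨u, hu, hiu⟩ := this
      rw [hiu]
      by_contra h2
      exact h u hu hiu ((hE₁.adj u v).1 h2)
  refine scanTriples_spec (s := buildRest.den t₁) (hE₁.den_tame rfl)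
    (ho₁.of_eq (den_mem rfl _) (den_reg rfl _)) hG he hI hS (fun v hv => ?_) (fun v hv => ?_)
  · rw [hrest]
    exact fun i _ u hu _ huv => hS hu hv huv.ne huv
  · by_contra hlt
    obtain ⟨i, hi, u, hu, hvu, hiu⟩ := hhit v (by omega)
    exact (hrest v).1 hv i hi u hu hiu hvu.symm

end Prog

end RAM


/-! ### Computing the parameters of the search from the input. -/

namespace RAM

namespace Prog

open SimpleGraph Finset

variable {n M I : ℕ} {G : SimpleGraph (Fin n)} {s : Store}

lemma den_coins {P : Prog} (h : P.coinFree = true) (s : Store) : (P.den s).coins = s.coins := by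
  induction P generalizing s with
  | skip => rfl
  | assign x e => rfl
  | store a i e => rfl
  | flip x => simp [coinFree] at h
  | seq P Q hP hQ =>
    simp only [coinFree, Bool.and_eq_true] at h
    simp only [den]
    rw [hQ h.2, hP h.1]
  | ite e P Q hP hQ =>
    simp only [coinFree, Bool.and_eq_true] at h
    simp only [den]
    split_ifs
    · exact hP h.1 s
    · exact hQ h.2 s
  | loop x b P hP =>
    exact iter_induction (p := fun s' => s'.coins = s.coins) (fun s' v h' => h')
      (fun s' h' => (hP h s').trans h') _ s rfl

/-- The program `P` turns the data `s` into `s'` in at most `K * (X + 1) ^ 12` steps. -/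
def Runs (K X : ℕ) (P : Cmd) (s s' : Store) : Prop := ∃ t ≤ K * (X + 1) ^ 12, Exec P s s' t

lemma Runs.seq {K K' X : ℕ} {P Q : Cmd} {s s' s'' : Store} (h : Runs K X P s s')
    (h' : Runs K' X Q s' s'') : Runs (1 + K + K') X (.seq P Q) s s'' := by
  obtain ⟨t, ht, hP⟩ := h
  obtain ⟨t', ht', hQ⟩ := h'
  refine ⟨1 + t + t', ?_, hP.seq hQ⟩
  have : 1 ≤ (X + 1) ^ 12 := Nat.one_le_pow _ _ (by omega)
  rw [add_mul, add_mul]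
  omega

lemma cost_le_of_depth {P : Prog} (R : ℕ → Bool) (hstd : P.std R = true) (hd : P.depth ≤ 12) {X : ℕ}
    (hX : ∀ b, R b = true → s.reg b ≤ X) : P.cost s ≤ P.size * (X + 1) ^ 12 :=
  (cost_le hstd s hX).trans (Nat.mul_le_mul_left _ (Nat.pow_le_pow_right (by omega) hd))

lemma runs_compile {P : Prog} (R : ℕ → Bool) (hstd : P.std R = true) (hd : P.depth ≤ 12) {X : ℕ}
    (hX : ∀ b, R b = true → s.reg b ≤ X)
    (hc : P.coinFree = true ∨ P.size * (X + 1) ^ 12 ≤ s.coins.length) :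
    Runs P.size X P.compile s (P.den s) :=
  ⟨P.cost s, cost_le_of_depth R hstd hd hX,
    exec_compile hstd s (hc.imp id ((cost_le_of_depth R hstd hd hX).trans ·))⟩

/-! ### The parameters of the search -/

/-- Put into register 3 the quotient of registers 2 and 1, rounded up. -/
def ceilDiv : Cmd :=
  .seq (.assign 30 (.reg 2)) <| .loop (.reg 30) <|
    .seq (.assign 30 (.sub (.reg 30) (.reg 1))) (.assign 3 (.add (.reg 3) (.lit 1)))

/-- The number of rounds is the quotient `e`, however large the two numbers are. As `q` is not
bounded in terms of `ε`, it must not bound a loop; hence a bare machine program with a while loop.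
-/
lemma exec_ceilDiv (s : Store) (hp : 0 < s.reg 1) : ∃ (e : ℕ) (s' : Store),
    Exec ceilDiv s s' (4 * e + 3) ∧ s.reg 2 ≤ e * s.reg 1 ∧ e * s.reg 1 < s.reg 2 + s.reg 1 ∧
    s'.reg 3 = s.reg 3 + e ∧ (∀ b, b ≠ 3 → b ≠ 30 → s'.reg b = s.reg b) ∧ s'.mem = s.mem ∧
    s'.coins = s.coins := by
  have key : ∀ y (t : Store), t.reg 30 = y → 0 < t.reg 1 → ∃ (e : ℕ) (s' : Store),
      Exec (.loop (.reg 30) (.seq (.assign 30 (.sub (.reg 30) (.reg 1)))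
        (.assign 3 (.add (.reg 3) (.lit 1))))) t s' (4 * e + 1) ∧ y ≤ e * t.reg 1 ∧
      e * t.reg 1 < y + t.reg 1 ∧
      s'.reg 3 = t.reg 3 + e ∧ (∀ b, b ≠ 3 → b ≠ 30 → s'.reg b = t.reg b) ∧ s'.mem = t.mem ∧
      s'.coins = t.coins := by
    intro y
    induction y using Nat.strong_induction_on with
    | _ y ih =>
      intro t hy hp
      rcases Nat.eq_zero_or_pos y with rfl | hy0
      · exact ⟨0, t, Exec.loop_zero hy, by simp, by simpa using hp, rfl, fun _ _ _ => rfl, rfl, rfl⟩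
      · have h1 := (Exec.assign 30 (.sub (.reg 30) (.reg 1)) t).seq
          (Exec.assign 3 (.add (.reg 3) (.lit 1)) _)
        simp only [Expr.eval, hy, Store.setReg_reg, Nat.reduceEqDiff, if_false] at h1
        obtain ⟨e, s', h2, h3, h4, h5, h6, h7, h8⟩ := ih (y - t.reg 1) (by omega)
          ((t.setReg 30 (y - t.reg 1)).setReg 3 (t.reg 3 + 1)) (by simp) (by simpa using hp)
        have h9 : (Expr.reg 30).eval t ≠ 0 := by simp only [Expr.eval]; omega
        simp only [Store.setReg_reg, OfNat.one_ne_ofNat, if_false, if_true] at h3 h4 h5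
        refine ⟨e + 1, s', ?_, ?_, ?_, by omega, fun b hb hb' => ?_, h7, h8⟩
        · convert Exec.loop_succ h9 h1 h2 using 1
          omega
        · rw [add_mul]; omega
        · rw [add_mul]
          -- In the last round the subtraction may be truncated; then no further round follows.
          by_cases h : t.reg 1 ≤ y
          · omega
          · rw [show y - t.reg 1 = 0 by omega, zero_add] at h4
            have : e = 0 := by
              by_contra he
              have := Nat.le_mul_of_pos_left (t.reg 1) (Nat.pos_of_ne_zero he)
              omega
            rw [this]; omega
        · rw [h6 b hb hb']; simp [hb, hb']
  obtain ⟨e, s', h1, h2, h3, h4, h5, h6, h7⟩ := key (s.reg 2) (s.setReg 30 (s.reg 2)) (by simp)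
    (by simpa using hp)
  simp only [Store.setReg_reg, OfNat.one_ne_ofNat, if_false, Nat.reduceEqDiff] at h2 h3 h4
  refine ⟨e, s', ?_, h2, h3, h4, fun b hb hb' => by rw [h5 b hb hb']; simp [hb'], h6, h7⟩
  rw [show 4 * e + 3 = 1 + 1 + (4 * e + 1) by omega]
  exact (Exec.assign 30 (.reg 2) s).seq h1

/-- A multiple of an expression. -/
def mulLit (c : ℕ) (x : Expr) : Expr :=
  match c with
  | 0 => .lit 0
  | c + 1 => .add (mulLit c x) x

lemma eval_mulLit (c : ℕ) (x : Expr) (s : Store) : (mulLit c x).eval s = c * x.eval s := by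
  induction c with
  | zero => simp [mulLit, Expr.eval]
  | succ c ih => simp [mulLit, Expr.eval, ih, add_mul]

/-- Add to register `y` the product of registers `z` and `b`. -/
def addMul (y z b : ℕ) : Prog := loop 30 b (assign y (.add (.reg y) (.reg z)))

lemma addMul_spec (s : Store) {y z b : ℕ} (hy : y ≠ 30) (hz : z ≠ 30) (hyz : z ≠ y) :
    ((addMul y z b).den s).reg y = s.reg y + s.reg b * s.reg z := by
  have := loop_inv (P := assign y (.add (.reg y) (.reg z))) (x := 30) (b := b) (s₀ := s)
    (fun k t => t.reg y + k * s.reg z = s.reg y + s.reg b * s.reg z)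
    (fun k t v h => by simpa [hy] using h) rfl
    (fun k _ t hA _ h => by
      have hz' : t.reg z = s.reg z := hA.reg z hz (by simp [wr, hyz])
      simp only [den, Expr.eval, Store.setReg_reg, if_true, hz']
      rw [add_mul] at h
      omega)
  simpa [addMul] using this

/-- The square of register 3. -/
def setupSquare : Prog := addMul 4 3 3

/-- The cube of register 3, the size of the sample, and a number that serves as infinity. -/
def setupCube (c : ℕ) : Prog :=
  seq (addMul 5 3 4) <| seq (assign 6 (mulLit c (.reg 5))) <|
    assign 8 (.add (.reg 0) (.add (mulLit 6 (.reg 3)) (.lit 1)))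

/-- Put the addresses of the rows of the adjacency matrix into bank 2. -/
def setupRows : Prog :=
  seq (assign 36 (.lit 0)) <| loop 30 0 <|
    seq (store 2 (.sub (.reg 0) (.add (.reg 30) (.lit 1))) (.reg 36))
      (assign 36 (.add (.reg 36) (.reg 0)))

/-- The counter runs downwards, but the row written to is `n - (counter + 1)`, so that row addresses
arise by adding `n` each time and no multiplication is needed. -/
lemma setupRows_spec (s : Store) : ∀ i < s.reg 0, (setupRows.den s).mem 2 i = i * s.reg 0 := by
  have := loop_inv (P := seq (store 2 (.sub (.reg 0) (.add (.reg 30) (.lit 1))) (.reg 36))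
      (assign 36 (.add (.reg 36) (.reg 0)))) (x := 30) (b := 0) (s₀ := s.setReg 36 0)
    (fun k t => k ≤ s.reg 0 → t.reg 36 = (s.reg 0 - k) * s.reg 0 ∧
      ∀ i < s.reg 0 - k, t.mem 2 i = i * s.reg 0)
    (fun k t v h => by simpa using h) (by simp)
    (fun k hk t hA hk' h hk'' => by
      simp only [Store.setReg_reg, OfNat.zero_ne_ofNat, if_false] at hk
      obtain ⟨h1, h2⟩ := h hk
      have h0 : t.reg 0 = s.reg 0 := (hA.reg 0 (by decide) rfl).trans (by simp)
      have h3 : s.reg 0 - k = s.reg 0 - (k + 1) + 1 := by omega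
      simp only [den, Expr.eval, Store.setReg_reg, if_true, Store.setMem_reg, Store.setReg_mem, h0,
        h1, hk']
      refine ⟨by rw [h3, add_mul, one_mul], fun i hi => ?_⟩
      rw [Store.setMem_mem]
      split_ifs with h4
      · rw [h4.2]
      · exact h2 i (by omega))
  exact fun i hi => (this (Nat.zero_le _)).2 i hi

/-- The number of parts of the sample, the number of rounds, and the addresses of the rows. -/
def setupRounds : Prog :=
  seq (assign 7 (.lit 1)) <| seq (loop 30 6 (assign 7 (.add (.reg 7) (.reg 7)))) <|
    seq (addMul 9 8 8) setupRows

/-- All the data that do not depend on the sample. -/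
def setup (c : ℕ) : Cmd :=
  .seq ceilDiv (.seq setupSquare.compile (.seq (setupCube c).compile setupRounds.compile))

/-- The state after the setup. -/
structure Prepared (G : SimpleGraph (Fin n)) (c e : ℕ) (l : List Bool) (s : Store) : Prop where
  env : Env G (c * e ^ 3) (n + 6 * e + 1) s
  prec : s.reg 3 = e
  sq : s.reg 4 = e ^ 2
  cube : s.reg 5 = e ^ 3
  zero : ∀ b, 9 < b → b < 30 → s.reg b = 0
  out : ∀ v, s.mem 1 v = 0
  coins : s.coins = l

lemma setupRounds_spec (h6 : s.reg 6 = M) (h8 : s.reg 8 = I) (h9 : s.reg 9 = 0) :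
    (setupRounds.den s).reg 7 = 2 ^ M ∧ (setupRounds.den s).reg 9 = I * I ∧
      ∀ i < s.reg 0, (setupRounds.den s).mem 2 i = i * s.reg 0 := by
  set s₁ := (loop 30 6 (assign 7 (.add (.reg 7) (.reg 7)))).den (s.setReg 7 1) with hs₁
  set s₂ := (addMul 9 8 8).den s₁ with hs₂
  have hden : setupRounds.den s = setupRows.den s₂ := rfl
  have h7 : s₁.reg 7 = 2 ^ M := by
    have := loop_inv (P := assign 7 (.add (.reg 7) (.reg 7))) (x := 30) (b := 6)
      (s₀ := s.setReg 7 1) (fun k t => t.reg 7 * 2 ^ k = 2 ^ M)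
      (fun k t v h => by simpa using h) (by simp [h6])
      (fun k _ t _ _ h => by
        simp only [den, Expr.eval, Store.setReg_reg, if_true]
        rw [← h, pow_succ]; ring)
    simpa using this
  have h8₁ : s₁.reg 8 = I := (den_reg rfl _).trans (by simpa using h8)
  have h9₁ : s₁.reg 9 = 0 := (den_reg rfl _).trans (by simpa using h9)
  have h0₁ : s₁.reg 0 = s.reg 0 := (den_reg rfl _).trans (by simp)
  have h0₂ : s₂.reg 0 = s.reg 0 := (den_reg rfl _).trans h0₁
  refine ⟨?_, ?_, fun i hi => ?_⟩
  · rw [hden, den_reg (P := setupRows) rfl, hs₂, den_reg (P := addMul 9 8 8) rfl, h7]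
  · rw [hden, den_reg (P := setupRows) rfl, hs₂, addMul_spec _ (by decide) (by decide) (by decide),
      h8₁, h9₁, zero_add]
  · rw [hden, setupRows_spec s₂ i (by rw [h0₂]; exact hi), h0₂]

/-- An address determines row and column, as the column is smaller than `n`. -/
lemma input_adj (G : SimpleGraph (Fin n)) (p q : ℕ) (l : List Bool) (u v : Fin n) :
    (input G p q l).mem 0 (u * n + v) ≠ 0 ↔ G.Adj u v := by
  have hn : 0 < n := Nat.zero_lt_of_lt u.2
  simp only [input, true_and, ne_eq, ite_eq_right_iff, one_ne_zero, imp_false, not_not]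
  constructor
  · rintro ⟨i, j, hij, h⟩
    have h1 : (u : ℕ) = i := by
      have := congrArg (· / n) hij
      simp only [mul_comm _ n] at this
      rwa [Nat.mul_add_div hn, Nat.mul_add_div hn, Nat.div_eq_of_lt v.2, Nat.div_eq_of_lt j.2,
        add_zero, add_zero] at this
    rw [h1] at hij
    rwa [Fin.ext h1, show v = j from Fin.ext (by omega)]
  · exact fun h => ⟨u, v, rfl, h⟩

lemma setup_spec (G : SimpleGraph (Fin n)) (c : ℕ) {p q e : ℕ} (hp : 0 < p) (hq : q ≤ e * p)
    (hq' : e * p < q + p) (l : List Bool) :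
    ∃ s, Prepared G c e l s ∧
      ∀ X, e ^ 2 ≤ X → c * e ^ 3 ≤ X → n + 6 * e + 1 ≤ X → Runs 50 X (setup c) (input G p q l) s := by
  obtain ⟨e', s₁, hex, h1, h2, h3, h4, h5, h6⟩ := exec_ceilDiv (input G p q l) (by simpa [input])
  -- The two inequalities determine the rounded quotient.
  obtain rfl : e = e' := by
    simp only [input, OfNat.ofNat_ne_zero, if_false, OfNat.ofNat_ne_one, if_true, one_ne_zero]
      at h1 h2
    have g1 : e' < e + 1 := lt_of_mul_lt_mul_right (a := p) (by rw [add_mul]; omega) hp.le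
    have g2 : e < e' + 1 := lt_of_mul_lt_mul_right (a := p) (by rw [add_mul]; omega) hp.le
    omega
  have hreg : ∀ b, b ≠ 3 → b ≠ 30 → s₁.reg b = (input G p q l).reg b := h4
  replace h3 : s₁.reg 3 = e := by rw [h3]; simp [input]
  set s₂ := setupSquare.den s₁ with hs₂
  set s₃ := (setupCube c).den s₂ with hs₃
  set s₄ := setupRounds.den s₃ with hs₄
  have e1 : ∀ b, b ≠ 4 → b ≠ 30 → s₂.reg b = s₁.reg b := fun b hb hb' =>
    den_reg (by simp [setupSquare, addMul, wr, hb, hb']) _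
  have e2 : ∀ b, b ≠ 5 → b ≠ 6 → b ≠ 8 → b ≠ 30 → s₃.reg b = s₂.reg b := fun b h5 h6 h8 h30 =>
    den_reg (by simp [setupCube, addMul, wr, h5, h6, h8, h30]) _
  have e3 : ∀ b, b ≠ 7 → b ≠ 9 → b ≠ 30 → b ≠ 36 → s₄.reg b = s₃.reg b :=
    fun b h7 h9 h30 h36 =>
      den_reg (by simp [setupRounds, setupRows, addMul, wr, h7, h9, h30, h36]) _
  have r3₂ : s₂.reg 3 = e := (e1 3 (by decide) (by decide)).trans h3
  have r3₃ : s₃.reg 3 = e := (e2 3 (by decide) (by decide) (by decide) (by decide)).trans r3₂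
  have r3 : s₄.reg 3 = e := (e3 3 (by decide) (by decide) (by decide) (by decide)).trans r3₃
  have r4₂ : s₂.reg 4 = e ^ 2 := by
    rw [hs₂, setupSquare, addMul_spec _ (by decide) (by decide) (by decide), h3,
      hreg 4 (by decide) (by decide)]
    simp [input, sq]
  have r4₃ : s₃.reg 4 = e ^ 2 := (e2 4 (by decide) (by decide) (by decide) (by decide)).trans r4₂
  have r4 : s₄.reg 4 = e ^ 2 := (e3 4 (by decide) (by decide) (by decide) (by decide)).trans r4₃
  have r0₁ : s₁.reg 0 = n := by rw [hreg 0 (by decide) (by decide)]; simp [input]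
  have r0₂ : s₂.reg 0 = n := (e1 0 (by decide) (by decide)).trans r0₁
  have r0₃ : s₃.reg 0 = n := (e2 0 (by decide) (by decide) (by decide) (by decide)).trans r0₂
  have r0 : s₄.reg 0 = n := (e3 0 (by decide) (by decide) (by decide) (by decide)).trans r0₃
  have hmul : ((addMul 5 3 4).den s₂).reg 5 = e ^ 3 := by
    rw [addMul_spec _ (by decide) (by decide) (by decide), r3₂, r4₂, e1 5 (by decide) (by decide),
      hreg 5 (by decide) (by decide)]
    simp only [input, OfNat.ofNat_ne_zero, if_false, OfNat.ofNat_ne_one, Nat.reduceEqDiff]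
    ring
  have hs₃' : s₃ = (((addMul 5 3 4).den s₂).setReg 6 (c * e ^ 3)).setReg 8 (n + 6 * e + 1) := by
    have g0 : ((addMul 5 3 4).den s₂).reg 0 = n := (den_reg rfl _).trans r0₂
    have g3 : ((addMul 5 3 4).den s₂).reg 3 = e := (den_reg rfl _).trans r3₂
    have g : s₃ = (((addMul 5 3 4).den s₂).setReg 6 ((mulLit c (.reg 5)).eval
      ((addMul 5 3 4).den s₂))).setReg 8 ((Expr.add (.reg 0) (.add (mulLit 6 (.reg 3)) (.lit 1))).eval
      (((addMul 5 3 4).den s₂).setReg 6 ((mulLit c (.reg 5)).eval ((addMul 5 3 4).den s₂)))) := rfl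
    rw [g, eval_mulLit]
    simp only [Expr.eval, eval_mulLit, hmul, Store.setReg_reg, g0, g3,
      OfNat.zero_ne_ofNat, if_false, Nat.reduceEqDiff, add_assoc]
  have r5₃ : s₃.reg 5 = e ^ 3 := by rw [hs₃']; simpa using hmul
  have r5 : s₄.reg 5 = e ^ 3 := (e3 5 (by decide) (by decide) (by decide) (by decide)).trans r5₃
  have r6₃ : s₃.reg 6 = c * e ^ 3 := by rw [hs₃']; simp
  have r6 : s₄.reg 6 = c * e ^ 3 := (e3 6 (by decide) (by decide) (by decide) (by decide)).trans r6₃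
  have r8₃ : s₃.reg 8 = n + 6 * e + 1 := by rw [hs₃']; simp
  have r8 : s₄.reg 8 = n + 6 * e + 1 :=
    (e3 8 (by decide) (by decide) (by decide) (by decide)).trans r8₃
  have r9₃ : s₃.reg 9 = 0 := by
    rw [e2 9 (by decide) (by decide) (by decide) (by decide), e1 9 (by decide) (by decide),
      hreg 9 (by decide) (by decide)]
    simp [input]
  obtain ⟨r7, r9, rows⟩ := setupRounds_spec r6₃ r8₃ r9₃
  have hmem : ∀ a, a ≠ 2 → s₄.mem a = (input G p q l).mem a := fun a ha => by
    rw [hs₄, den_mem (by simp [setupRounds, setupRows, addMul, wm, ha]), hs₃,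
      den_mem (by simp [setupCube, addMul, wm]), hs₂, den_mem (by simp [setupSquare, addMul, wm]),
      h5]
  refine ⟨s₄, ⟨⟨r0, r6, r7, r8, r9, by omega, fun u v => ?_⟩, r3, r4, r5,
    fun b hb hb' => ?_, fun v => ?_, ?_⟩, fun X hX hX' hX'' => ?_⟩
  · rw [rows u (by rw [r0₃]; exact u.2), hmem 0 (by decide), r0₃]
    exact input_adj G p q l u v
  · rw [e3 b (by omega) (by omega) (by omega) (by omega),
      e2 b (by omega) (by omega) (by omega) (by omega), e1 b (by omega) (by omega),
      hreg b (by omega) (by omega)]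
    simp only [input]
    rw [if_neg (by omega), if_neg (by omega), if_neg (by omega)]
  · rw [hmem 1 (by decide)]; simp [input]
  · rw [hs₄, den_coins rfl, hs₃, den_coins rfl, hs₂, den_coins rfl, h6]; rfl
  · have hrun₁ : Runs 7 X ceilDiv (input G p q l) s₁ := by
      refine ⟨_, ?_, hex⟩
      have : X + 1 ≤ (X + 1) ^ 12 := Nat.le_self_pow (by decide) _
      refine le_trans ?_ (Nat.mul_le_mul_left 7 this)
      omega
    have hrun₂ : Runs setupSquare.size X setupSquare.compile s₁ s₂ :=
      runs_compile (fun b => b == 3) rfl (by decide) (fun b hb => by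
        rw [beq_iff_eq] at hb; rw [hb, h3]; omega) (.inl rfl)
    have hrun₃ : Runs (setupCube c).size X (setupCube c).compile s₂ s₃ :=
      runs_compile (P := setupCube c) (fun b => b == 4) rfl (show 1 ≤ 12 by decide) (fun b hb => by
        rw [beq_iff_eq] at hb; rw [hb, r4₂]; omega) (.inl rfl)
    have hrun₄ : Runs setupRounds.size X setupRounds.compile s₃ s₄ :=
      runs_compile (fun b => b == 0 || b == 6 || b == 8) rfl (by decide) (fun b hb => by
        simp only [Bool.or_eq_true, beq_iff_eq] at hb
        rcases hb with (rfl | rfl) | rfl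
        · rw [r0₃]; omega
        · rw [r6₃]; exact hX'
        · rw [r8₃]; exact hX'') (.inl rfl)
    obtain ⟨t, ht, h⟩ := hrun₁.seq (hrun₂.seq (hrun₃.seq hrun₄))
    exact ⟨t, ht.trans (Nat.mul_le_mul_right _ (show 42 ≤ 50 by decide)), h⟩

lemma Prepared.outInv {c e : ℕ} {l : List Bool} (h : Prepared G c e l s) : OutInv G s := by
  have : fset n 1 s = ∅ := by
    ext v; simp [mem_fset, h.out v]
  exact ⟨by simp [this], by rw [this, h.zero 26 (by decide) (by decide)]; rfl⟩

/-- The largest loop bounds are the number of guesses and the number of rounds. Registers above 9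
that may bound later loops are still zero. -/
lemma Prepared.params_le {c e : ℕ} (hc : 1 ≤ c) {l : List Bool} (h : Prepared G c e l s) {X : ℕ}
    (hX : 2 ^ (c * e ^ 3) ≤ X) (hX' : (n + 6 * e + 1) * (n + 6 * e + 1) ≤ X) (b : ℕ)
    (hb : params b = true) : s.reg b ≤ X := by
  have h1 : e ^ 3 ≤ X := (Nat.le_mul_of_pos_left _ hc).trans (Nat.lt_two_pow_self.le.trans hX)
  have h2 : n + 6 * e + 1 ≤ X := (Nat.le_mul_self _).trans hX'
  have h3 : e ^ 2 ≤ X := by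
    rcases Nat.eq_zero_or_pos e with rfl | he
    · simp
    · exact (Nat.pow_le_pow_right he (by decide)).trans h1
  have h4 : c * e ^ 3 ≤ X := Nat.lt_two_pow_self.le.trans hX
  by_cases h9 : 9 < b
  · by_cases h30 : b < 30
    · rw [h.zero b h9 h30]; exact Nat.zero_le _
    · simp only [params, Bool.or_eq_true, beq_iff_eq, Bool.and_eq_true, Nat.blt_eq] at hb
      omega
  · rw [not_lt] at h9
    interval_cases b
    · rw [h.env.order]; omega
    · simp [params] at hb
    · simp [params] at hb
    · rw [h.prec]; omega
    · rw [h.sq]; exact h3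
    · rw [h.cube]; exact h1
    · rw [h.env.sample]; exact h4
    · rw [h.env.guesses]; exact hX
    · rw [h.env.big]; exact h2
    · rw [h.env.rounds]; exact hX'

end Prog

end RAM


/-! ### The randomized and the deterministic program. -/

namespace RAM

namespace Prog

open SimpleGraph Finset

variable {n M I : ℕ} {G : SimpleGraph (Fin n)} {s : Store}

/-! ### A random sample -/

/-- The binary logarithm of the number of vertices, rounded up. -/
def bitLength : Prog :=
  seq (assign 36 (.lit 1)) <| loop 30 0 <| when (.sub (.reg 0) (.reg 36)) <|
    seq (assign 36 (.add (.reg 36) (.reg 36))) (assign 10 (.add (.reg 10) (.lit 1)))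

lemma bitLength_spec (h10 : s.reg 10 = 0) : (bitLength.den s).reg 10 = Nat.clog 2 (s.reg 0) := by
  have := loop_inv (P := when (.sub (.reg 0) (.reg 36)) <|
      seq (assign 36 (.add (.reg 36) (.reg 36))) (assign 10 (.add (.reg 10) (.lit 1))))
    (x := 30) (b := 0) (s₀ := s.setReg 36 1)
    -- The second clause makes the exponent minimal. The third one shows that `n` rounds suffice, as
    -- every round either is idle at a sufficient power or raises the exponent.
    (fun k t => t.reg 36 = 2 ^ t.reg 10 ∧ (t.reg 10 = 0 ∨ 2 ^ (t.reg 10 - 1) < s.reg 0) ∧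
      (s.reg 0 ≤ 2 ^ t.reg 10 ∨ s.reg 0 ≤ t.reg 10 + k))
    (fun k t v h => by simpa using h) (by simp [h10])
    (fun k hk t hA _ h => by
      have h0 : t.reg 0 = s.reg 0 := (hA.reg 0 (by decide) rfl).trans (by simp)
      obtain ⟨h1, h2, h3⟩ := h
      simp only [den_when, Expr.eval, h0, h1, den]
      split_ifs with h4
      · simp only [Store.setReg_reg, if_true, Nat.reduceEqDiff, if_false, h1]
        refine ⟨by rw [pow_succ]; omega, .inr ?_, .inr ?_⟩
        · rw [Nat.add_sub_cancel]; omega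
        · omega
      · exact ⟨h1, h2, .inl (by omega)⟩)
  change _ ∧ _ at this
  obtain ⟨-, h2, h3⟩ := this
  change ((bitLength.den s).reg 10 = 0 ∨ 2 ^ ((bitLength.den s).reg 10 - 1) < s.reg 0) at h2
  change (s.reg 0 ≤ 2 ^ (bitLength.den s).reg 10 ∨ s.reg 0 ≤ (bitLength.den s).reg 10 + 0) at h3
  set L := (bitLength.den s).reg 10
  apply le_antisymm
  · rcases h2 with h2 | h2
    · omega
    · have := (Nat.lt_clog_iff_pow_lt (b := 2) (by decide)).2 h2
      omega
  · refine (Nat.clog_le_iff_le_pow (by decide)).2 (h3.elim id fun h => ?_)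
    exact h.trans Nat.lt_two_pow_self.le

/-- The number with given binary digits. -/
def bitVal (f : ℕ → Bool) : ℕ → ℕ
  | 0 => 0
  | j + 1 => bitVal f j + bitVal f j + (f j).toNat

lemma bitVal_congr {f g : ℕ → Bool} {L : ℕ} (h : ∀ j < L, f j = g j) : bitVal f L = bitVal g L := by
  induction L with
  | zero => rfl
  | succ L ih => simp only [bitVal]; rw [ih fun j hj => h j (by omega), h L (by omega)]

lemma exists_bitVal {L u : ℕ} (hu : u < 2 ^ L) : ∃ f, bitVal f L = u := by
  induction L generalizing u with
  | zero => exact ⟨fun _ => false, by simp at hu; simp [bitVal, hu]⟩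
  | succ L ih =>
    rw [pow_succ] at hu
    obtain ⟨f, hf⟩ := ih (u := u / 2) (by omega)
    refine ⟨Function.update f L (decide (u % 2 = 1)), ?_⟩
    simp only [bitVal, Function.update_self]
    rw [bitVal_congr (g := f) fun j hj => Function.update_of_ne (by omega) _ _, hf]
    by_cases h : u % 2 = 1
    · simp [h]; omega
    · simp [h]; omega

/-- Read a number with `reg 10` binary digits. -/
def readNumber : Prog :=
  loop 31 10 (seq (flip 37) (assign 36 (.add (.add (.reg 36) (.reg 36)) (.reg 37))))

lemma readNumber_spec {l : List Bool} {m : ℕ} (h36 : s.reg 36 = 0) (hl : s.coins = l.drop m)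
    (hlen : m + s.reg 10 ≤ l.length) :
    (readNumber.den s).reg 36 = bitVal (fun j => l.getD (m + j) false) (s.reg 10) ∧
      (readNumber.den s).coins = l.drop (m + s.reg 10) := by
  have := loop_inv (P := seq (flip 37) (assign 36 (.add (.add (.reg 36) (.reg 36)) (.reg 37))))
    (x := 31) (b := 10) (s₀ := s)
    (fun k t => k ≤ s.reg 10 →
      t.reg 36 = bitVal (fun j => l.getD (m + j) false) (s.reg 10 - k) ∧
      t.coins = l.drop (m + (s.reg 10 - k)))
    (fun k t v h => by simpa using h) (by simp [h36, hl, bitVal])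
    (fun k hk t _ _ h _ => by
      obtain ⟨h1, h2⟩ := h (by omega)
      have h3 : s.reg 10 - k = s.reg 10 - (k + 1) + 1 := by omega
      set j := s.reg 10 - (k + 1) with hj
      have h4 : m + j < l.length := by omega
      rw [List.drop_eq_getElem_cons h4] at h2
      simp only [den, h2, Expr.eval, h3, bitVal, Store.setReg_coins, Store.setReg_reg, if_true,
        Nat.reduceEqDiff, if_false, h1]
      refine ⟨?_, by rw [add_assoc]⟩
      rw [List.getD_eq_getElem _ _ h4])
  obtain ⟨h1, h2⟩ := this (Nat.zero_le _)
  exact ⟨h1, h2⟩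

/-- Fill the sample with random numbers. -/
def fillSample : Prog :=
  loop 30 6 (seq (assign 36 (.lit 0)) (seq readNumber (store 3 (.reg 30) (.reg 36))))

lemma fillSample_spec (hlen : s.reg 6 * s.reg 10 ≤ s.coins.length) :
    ∀ i < s.reg 6, (fillSample.den s).mem 3 i =
      bitVal (fun j => s.coins.getD ((s.reg 6 - 1 - i) * s.reg 10 + j) false) (s.reg 10) := by
  set L := s.reg 10 with hL
  have := loop_inv (P := seq (assign 36 (.lit 0)) (seq readNumber (store 3 (.reg 30) (.reg 36))))
    (x := 30) (b := 6) (s₀ := s)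
    (fun k t => k ≤ s.reg 6 → t.coins = s.coins.drop ((s.reg 6 - k) * L) ∧
      ∀ i < s.reg 6, k ≤ i → t.mem 3 i =
        bitVal (fun j => s.coins.getD ((s.reg 6 - 1 - i) * L + j) false) L)
    (fun k t v h => by simpa using h)
    (fun _ => ⟨by simp, fun i hi hi' => by omega⟩)
    (fun k hk t hA hk' h _ => by
      obtain ⟨h1, h2⟩ := h hk
      have h10 : t.reg 10 = L := hA.reg 10 (by decide) rfl
      have h3 : s.reg 6 - k = s.reg 6 - 1 - k + 1 := by omega
      have h4 : (s.reg 6 - k) * L ≤ s.reg 6 * L := Nat.mul_le_mul_right _ (Nat.sub_le _ _)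
      rw [h3, add_mul, one_mul] at h4
      obtain ⟨h5, h6⟩ := readNumber_spec (s := t.setReg 36 0) (l := s.coins)
        (m := (s.reg 6 - 1 - k) * L) (by simp)
        (by rw [Store.setReg_coins, h1]; congr 2; omega)
        (by simp only [Store.setReg_reg, Nat.reduceEqDiff, if_false, h10]; omega)
      simp only [Store.setReg_reg, Nat.reduceEqDiff, if_false, h10] at h5 h6
      have h7 : (readNumber.den (t.setReg 36 0)).reg 30 = k := (den_reg rfl _).trans (by simp [hk'])
      have h8 : (readNumber.den (t.setReg 36 0)).mem 3 = t.mem 3 := den_mem rfl _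
      have hden : (seq (assign 36 (.lit 0)) (seq readNumber (store 3 (.reg 30) (.reg 36)))).den t =
          (readNumber.den (t.setReg 36 0)).setMem 3 k
            ((readNumber.den (t.setReg 36 0)).reg 36) := by
        rw [← h7]; rfl
      rw [hden, Store.setMem_coins, h6, h5]
      refine ⟨by rw [h3, add_mul, one_mul], fun i hi hki => ?_⟩
      rw [Store.setMem_mem, h8]
      split_ifs with h9
      · rw [h9.2]
      · exact h2 i hi (by omega))
  exact fun i hi => (this (Nat.zero_le _)).2 i hi (Nat.zero_le _)

/-- Search with a random sample. -/
def randomized (c : ℕ) : Cmd :=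
  .seq (setup c) (.seq bitLength.compile (.seq fillSample.compile searchAll.compile))

/-- A constant factor in the running time. -/
def randomizedFactor : ℕ := 53 + bitLength.size + fillSample.size + searchAll.size

/-- `X` bounds every loop. Coins are consumed only while the sample is filled, so they need to cover
only the cost of that part. The sample is filled from its last cell down, hence the block `M - 1 -
i` of coins for cell `i`, where `M` is the sample size. -/
theorem randomized_spec (G : SimpleGraph (Fin n)) {c : ℕ} (hc : 1 ≤ c) {p q e : ℕ} (hp : 0 < p)
    (hq : q ≤ e * p) (hq' : e * p < q + p) {l : List Bool} {X : ℕ} (hX : 2 ^ (c * e ^ 3) ≤ X)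
    (hX' : (n + 6 * e + 1) * (n + 6 * e + 1) ≤ X)
    (hl : fillSample.size * (X + 1) ^ 12 ≤ l.length) :
    c * e ^ 3 * Nat.clog 2 n ≤ l.length ∧
    ∃ s', Runs randomizedFactor X (randomized c) (input G p q l) s' ∧
      G.IsIndepSet (fset n 1 s' : Set (Fin n)) ∧
      (G.iocp ≤ 1 → 1 ≤ e → ∀ [DecidableRel G.Adj] (S : Finset (Fin n)),
        G.IsIndepSet (S : Set (Fin n)) →
        (∀ v, #S < 12 * e ^ 2 * #(S.filter fun u => G.Adj v u) →
          ∃ i < c * e ^ 3, ∃ u ∈ S, G.Adj v u ∧ bitVal (fun j => l.getD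
            ((c * e ^ 3 - 1 - i) * Nat.clog 2 n + j) false) (Nat.clog 2 n) = u) →
        e * #S ≤ e * #(fset n 1 s') + #S) := by
  obtain ⟨s₁, hprep, hrun₁⟩ := setup_spec G c hp hq hq' l
  have hpar := hprep.params_le hc hX hX'
  have hE₁ := hprep.env
  set s₂ := bitLength.den s₁ with hs₂
  set s₃ := fillSample.den s₂ with hs₃
  have h10 : s₂.reg 10 = Nat.clog 2 n := by
    rw [hs₂, bitLength_spec (hprep.zero 10 (by decide) (by decide)), hE₁.order]
  have hreg : ∀ b, b ≠ 10 → params b = true → s₂.reg b = s₁.reg b := by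
    intro b hb hb'
    refine den_reg ?_ _
    have h30 : b ≠ 30 := by rintro rfl; simp [params] at hb'
    have h36 : b ≠ 36 := by rintro rfl; simp [params] at hb'
    simp [bitLength, when, wr, hb, h30, h36]
  have h6 : s₂.reg 6 = c * e ^ 3 := (hreg 6 (by decide) rfl).trans hE₁.sample
  have hE₂ : Env G (c * e ^ 3) (n + 6 * e + 1) s₂ :=
    ⟨(hreg 0 (by decide) rfl).trans hE₁.order, h6, (hreg 7 (by decide) rfl).trans hE₁.guesses,
      (hreg 8 (by decide) rfl).trans hE₁.big, (hreg 9 (by decide) rfl).trans hE₁.rounds, hE₁.lt,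
      by rw [hs₂, den_mem rfl, den_mem rfl]; exact hE₁.adj⟩
  have hE₃ : Env G (c * e ^ 3) (n + 6 * e + 1) s₃ := hE₂.den_tame rfl
  have ho₃ : OutInv G s₃ := (hprep.outInv.of_eq (s' := s₂) (den_mem rfl _) (den_reg rfl _)).of_eq
    (den_mem rfl _) (den_reg rfl _)
  have hlog : Nat.clog 2 n ≤ X :=
    ((Nat.clog_le_iff_le_pow (by decide)).2 Nat.lt_two_pow_self.le).trans (by nlinarith)
  have hpar₂ : ∀ b, params b = true → s₂.reg b ≤ X := by
    intro b hb
    by_cases hb' : b = 10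
    · rw [hb', h10]; exact hlog
    · rw [hreg b hb' hb]; exact hpar b hb
  have hcoins : s₂.coins = l := (den_coins rfl _).trans hprep.coins
  have hlen : c * e ^ 3 * Nat.clog 2 n ≤ l.length := by
    refine le_trans ?_ hl
    have h1 : c * e ^ 3 ≤ X + 1 := (Nat.lt_two_pow_self.le.trans hX).trans (Nat.le_succ _)
    calc c * e ^ 3 * Nat.clog 2 n ≤ (X + 1) * (X + 1) :=
          Nat.mul_le_mul h1 (hlog.trans (Nat.le_succ _))
      _ = (X + 1) ^ 2 := (sq _).symm
      _ ≤ (X + 1) ^ 12 := Nat.pow_le_pow_right (by omega) (by decide)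
      _ ≤ fillSample.size * (X + 1) ^ 12 := Nat.le_mul_of_pos_left _ (by decide)
  refine ⟨hlen, searchAll.den s₃, ?_, ?_, fun hG he _ S hS hhit => ?_⟩
  · have r1 := hrun₁ X
      (by have := hpar 4 rfl; rwa [hprep.sq] at this) (by have := hpar 6 rfl; rwa [hE₁.sample] at this)
      (by have := hpar 8 rfl; rwa [hE₁.big] at this)
    have r2 : Runs bitLength.size X bitLength.compile s₁ s₂ :=
      runs_compile (P := bitLength) (fun b => b == 0) rfl (by decide) (fun b hb => by
        rw [beq_iff_eq] at hb; rw [hb]; exact hpar 0 rfl) (.inl rfl)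
    have r3 : Runs fillSample.size X fillSample.compile s₂ s₃ :=
      runs_compile (P := fillSample) params rfl (by decide) hpar₂ (.inr (by rw [hcoins]; exact hl))
    have r4 : Runs searchAll.size X searchAll.compile s₃ (searchAll.den s₃) :=
      runs_compile (P := searchAll) params rfl (by decide) (fun b hb => by
        rw [hs₃, den_reg_of_std (P := fillSample) rfl hb]; exact hpar₂ b hb) (.inl rfl)
    obtain ⟨t, ht, h⟩ := r1.seq (r2.seq (r3.seq r4))
    refine ⟨t, ht.trans (Nat.mul_le_mul_right _ ?_), h⟩
    unfold randomizedFactor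
    omega
  · exact (searchAll_sound s₃ hE₃ ho₃).1.indep
  · have := searchAll_spec hE₃ ho₃ hG he (by omega) hS (fun v hv => by
      obtain ⟨i, hi, u, hu, huv, hval⟩ := hhit v hv
      refine ⟨i, hi, u, hu, huv, ?_⟩
      rw [hs₃, fillSample_spec (by rw [h6, h10, hcoins]; exact hlen) i (by rw [h6]; exact hi), h6,
        h10, hcoins, hval])
    rwa [← (searchAll_sound s₃ hE₃ ho₃).1.card] at this

/-! ### All samples -/

/-- Put into register 12 the number of samples. -/
def numSamples : Prog :=
  seq (assign 12 (.lit 1)) <| loop 30 6 <| seq (assign 36 (.lit 0)) <|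
    seq (loop 31 0 (assign 36 (.add (.reg 36) (.reg 12)))) (assign 12 (.reg 36))

lemma numSamples_spec (s : Store) : (numSamples.den s).reg 12 = s.reg 0 ^ s.reg 6 := by
  have := loop_inv (P := seq (assign 36 (.lit 0)) <|
    seq (loop 31 0 (assign 36 (.add (.reg 36) (.reg 12)))) (assign 12 (.reg 36)))
    (x := 30) (b := 6) (s₀ := s.setReg 12 1)
    (fun k t => t.reg 12 * s.reg 0 ^ k = s.reg 0 ^ s.reg 6)
    (fun k t v h => by simpa using h) (by simp)
    (fun k _ t hA _ h => by
      have h0 : t.reg 0 = s.reg 0 := (hA.reg 0 (by decide) rfl).trans (by simp)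
      have hmul := loop_inv (P := assign 36 (.add (.reg 36) (.reg 12))) (x := 31) (b := 0)
        (s₀ := t.setReg 36 0)
        (fun k t' => t'.reg 36 + k * t.reg 12 = s.reg 0 * t.reg 12)
        (fun k t' v h => by simpa using h) (by simp [h0])
        (fun k _ t' hA' _ h' => by
          have h12 : t'.reg 12 = t.reg 12 := (hA'.reg 12 (by decide) rfl).trans (by simp)
          simp only [den, Expr.eval, Store.setReg_reg, if_true, h12]
          rw [add_mul] at h'
          omega)
      rw [zero_mul, add_zero] at hmul
      have hden : ((seq (assign 36 (.lit 0)) <| seq (loop 31 0 (assign 36 (.add (.reg 36) (.reg 12))))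
          (assign 12 (.reg 36))).den t).reg 12 =
          ((loop 31 0 (assign 36 (.add (.reg 36) (.reg 12)))).den (t.setReg 36 0)).reg 36 := by
        rw [den, den, den, den, Store.setReg_reg, if_pos rfl]; rfl
      rw [hden, hmul, ← h, pow_succ]
      ring)
  simpa [numSamples, den, Expr.eval] using this

/-- Search with the sample that has number `reg 29`. -/
def searchSample : Prog := seq (digits 3 29 12 (.reg 0)) searchAll

lemma searchSample_sound : Sound G M I searchSample :=
  (sound_of_wr rfl rfl).seq searchAll_sound rfl

/-- Search with all samples. -/
def searchSamples : Prog := loop 29 12 searchSample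

lemma searchSamples_sound : Sound G M I searchSamples :=
  searchSample_sound.loop rfl rfl (by decide)

/-- Search with all samples, after the setup. -/
def deterministic (c : ℕ) : Cmd :=
  .seq (setup c) (.seq numSamples.compile searchSamples.compile)

/-- A constant factor in the running time. -/
def deterministicFactor : ℕ := 52 + numSamples.size + searchSamples.size

lemma deterministic_coinFree (c : ℕ) : (deterministic c).CoinFree :=
  ⟨⟨⟨trivial, trivial, trivial⟩, coinFree_compile rfl, coinFree_compile rfl, coinFree_compile rfl⟩,
    coinFree_compile rfl, coinFree_compile rfl⟩

/-- A sample is a number with `M` digits in base `n`, where `M` is the sample size, so the outer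
loop runs through all of them; one good sample suffices because the output never shrinks. -/
theorem deterministic_spec (G : SimpleGraph (Fin n)) {c : ℕ} (hc : 1 ≤ c) {p q e : ℕ} (hp : 0 < p)
    (hq : q ≤ e * p) (hq' : e * p < q + p) {X : ℕ} (hX : 2 ^ (c * e ^ 3) ≤ X)
    (hX' : (n + 6 * e + 1) * (n + 6 * e + 1) ≤ X) (hX'' : n ^ (c * e ^ 3) ≤ X) :
    ∃ s', Runs deterministicFactor X (deterministic c) (input G p q []) s' ∧
      G.IsIndepSet (fset n 1 s' : Set (Fin n)) ∧
      (G.iocp ≤ 1 → 1 ≤ e → ∀ [DecidableRel G.Adj] (S : Finset (Fin n)),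
        G.IsIndepSet (S : Set (Fin n)) →
        (∃ A : Fin (c * e ^ 3) → Fin n, ∀ v, #S < 12 * e ^ 2 * #(S.filter fun u => G.Adj v u) →
          ∃ i, A i ∈ S ∧ G.Adj v (A i)) →
        e * #S ≤ e * #(fset n 1 s') + #S) := by
  obtain ⟨s₁, hprep, hrun₁⟩ := setup_spec G c hp hq hq' []
  have hpar := hprep.params_le hc hX hX'
  have hE₁ := hprep.env
  set s₂ := numSamples.den s₁ with hs₂
  have h12 : s₂.reg 12 = n ^ (c * e ^ 3) := by
    rw [hs₂, numSamples_spec, hE₁.order, hE₁.sample]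
  have hreg : ∀ b, b ≠ 12 → params b = true → s₂.reg b = s₁.reg b := by
    intro b hb hb'
    refine den_reg ?_ _
    have h30 : b ≠ 30 := by rintro rfl; simp [params] at hb'
    have h31 : b ≠ 31 := by rintro rfl; simp [params] at hb'
    have h36 : b ≠ 36 := by rintro rfl; simp [params] at hb'
    simp [numSamples, wr, hb, h30, h31, h36]
  have hE₂ : Env G (c * e ^ 3) (n + 6 * e + 1) s₂ :=
    ⟨(hreg 0 (by decide) rfl).trans hE₁.order, (hreg 6 (by decide) rfl).trans hE₁.sample,
      (hreg 7 (by decide) rfl).trans hE₁.guesses,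
      (hreg 8 (by decide) rfl).trans hE₁.big, (hreg 9 (by decide) rfl).trans hE₁.rounds, hE₁.lt,
      by rw [hs₂, den_mem rfl, den_mem rfl]; exact hE₁.adj⟩
  have ho₂ : OutInv G s₂ := hprep.outInv.of_eq (s' := s₂) (den_mem rfl _) (den_reg rfl _)
  refine ⟨searchSamples.den s₂, ?_, ?_, fun hG he _ S hS ⟨A, hA⟩ => ?_⟩
  · have r1 := hrun₁ X
      (by have := hpar 4 rfl; rwa [hprep.sq] at this) (by have := hpar 6 rfl; rwa [hE₁.sample] at this)
      (by have := hpar 8 rfl; rwa [hE₁.big] at this)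
    have r2 : Runs numSamples.size X numSamples.compile s₁ s₂ :=
      runs_compile (P := numSamples) (fun b => b == 0 || b == 6) rfl (by decide) (fun b hb => by
        simp only [Bool.or_eq_true, beq_iff_eq] at hb
        rcases hb with rfl | rfl
        · exact hpar 0 rfl
        · exact hpar 6 rfl) (.inl rfl)
    have r3 : Runs searchSamples.size X searchSamples.compile s₂ (searchSamples.den s₂) :=
      runs_compile (P := searchSamples) params rfl (by decide) (fun b hb => by
        by_cases hb' : b = 12
        · rw [hb', h12]; exact hX''
        · rw [hreg b hb' hb]; exact hpar b hb) (.inl rfl)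
    obtain ⟨t, ht, h⟩ := r1.seq (r2.seq r3)
    refine ⟨t, ht.trans (Nat.mul_le_mul_right _ ?_), h⟩
    unfold deterministicFactor
    omega
  · exact (searchSamples_sound s₂ hE₂ ho₂).1.indep
  · have hp : Monotone fun m => e * #S ≤ e * m + #S := fun a b hab h =>
      h.trans (by have := Nat.mul_le_mul_left e hab; omega)
    obtain ⟨z, hz, hzd⟩ := exists_digits n (c * e ^ 3)
      (fun i => if h : i < c * e ^ 3 then A ⟨i, h⟩ else 0) (fun i hi => by
        rw [dif_pos hi]; exact (A _).2)
    have := searchSample_sound.loop_hit (x := 29) (b := 12) (p := fun m => e * #S ≤ e * m + #S)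
      rfl (k := z) rfl (by decide) hE₂ ho₂ hp (by rw [h12]; exact hz) fun t hAg hEt hot hzt => by
        have ht12 : t.reg 12 = n ^ (c * e ^ 3) := (hAg.reg 12 (by decide) rfl).trans h12
        refine searchAll_spec (s := (digits 3 29 12 (.reg 0)).den t) (hEt.den_tame rfl)
          (hot.of_eq (den_mem rfl _) (den_reg rfl _)) hG he (by omega) hS fun v hv => ?_
        obtain ⟨i, hi, huv⟩ := hA v hv
        refine ⟨i, i.2, A i, hi, huv, ?_⟩
        rw [digits_spec (B := n) (Nat.zero_lt_of_lt v.2) (fun s' h => by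
            simp only [Expr.eval]; rw [h, hEt.order]) (by decide) (by rw [hzt, ht12]; exact hz.le)
          i (by rw [hEt.sample]; exact i.2), hzt, hEt.sample, hzd i i.2, dif_pos i.2]
    rw [(searchSamples_sound s₂ hE₂ ho₂).1.card]
    exact this

end Prog

end RAM


/-! ### Probabilities as proportions of coin strings. -/

section Counting

open Finset

/-- If the value of `f` determines the coordinates in the image of `ι`, then at most a
proportional part of all binary words is mapped into a set `B` of values. -/
lemma card_filter_mul_two_pow_le {T : ℕ} {κ γ : Type*} [Fintype κ] [DecidableEq γ] {ι : κ → Fin T}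
    (hι : Function.Injective ι) (f : (Fin T → Bool) → γ)
    (hf : ∀ w w', f w = f w' → ∀ k, w (ι k) = w' (ι k)) (B : Finset γ) :
    #{w | f w ∈ B} * 2 ^ Fintype.card κ ≤ #B * 2 ^ T := by
  classical
  -- The coordinates not read. A word is determined by its value under `f` and its restriction to
  -- `Z`.
  set Z : Finset (Fin T) := (univ.image ι)ᶜ with hZ
  have hcard : #Z + Fintype.card κ = T := by
    rw [hZ, card_compl, card_image_of_injective _ hι, card_univ, Fintype.card_fin]
    have := Fintype.card_le_of_injective ι hι
    rw [Fintype.card_fin] at this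
    omega
  have hle : #{w | f w ∈ B} ≤ #(B ×ˢ (univ : Finset (Z → Bool))) := by
    refine card_le_card_of_injOn (fun w => (f w, fun z : Z => w z)) (fun w hw => ?_)
      fun w _ w' _ h => ?_
    · exact mem_coe.2 (mem_product.2 ⟨(mem_filter.1 hw).2, mem_univ _⟩)
    · obtain ⟨h1, h2⟩ := Prod.mk.inj h
      funext i
      by_cases hi : i ∈ Z
      · exact congrFun h2 ⟨i, hi⟩
      · rw [hZ, mem_compl, not_not, mem_image] at hi
        obtain ⟨k, -, rfl⟩ := hi
        exact hf w w' h1 k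
  rw [card_product, card_univ, Fintype.card_fun, Fintype.card_bool, Fintype.card_coe] at hle
  calc #{w | f w ∈ B} * 2 ^ Fintype.card κ ≤ #B * 2 ^ #Z * 2 ^ Fintype.card κ :=
        Nat.mul_le_mul_right _ hle
    _ = #B * 2 ^ T := by rw [mul_assoc, ← pow_add, hcard]

lemma le_card_of_forall {T : ℕ} {η : ℝ} (hη : 0 < η) {p : (Fin T → Bool) → Prop} (h : ∀ w, p w) :
    (1 - η) * (2 : ℝ) ^ T ≤ Nat.card {w // p w} := by
  have h1 : Nat.card {w // p w} = 2 ^ T := by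
    rw [Nat.card_congr (Equiv.subtypeUnivEquiv h)]
    simp
  rw [h1]
  push_cast
  have : (0 : ℝ) < η * 2 ^ T := by positivity
  linarith

lemma card_le_card_of_imp {T : ℕ} {p p' : (Fin T → Bool) → Prop} (h : ∀ w, p w → p' w) :
    (Nat.card {w // p w} : ℝ) ≤ Nat.card {w // p' w} :=
  Nat.cast_le.2 (Nat.card_le_card_of_injective (Subtype.map id h)
    (Subtype.map_injective h Function.injective_id))

end Counting

/-! ### Accuracy, running times and the existence of good samples. -/

namespace RAM

namespace Prog

open SimpleGraph Finset

/-- Take `e = ⌈q/p⌉`: then `1/ε ≤ q/p ≤ e < q/p + 1 ≤ 2/ε + 1 ≤ 3/ε`. -/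
lemma exists_precision {p q : ℕ} {ε : ℝ} (hε : 0 < ε) (hε1 : ε < 1) (hp : 0 < p)
    (h1 : ε / 2 ≤ (p : ℝ) / q) (h2 : (p : ℝ) / q ≤ ε) :
    ∃ e : ℕ, 1 ≤ e ∧ q ≤ e * p ∧ e * p < q + p ∧ 1 ≤ ε * e ∧ (e : ℝ) ≤ 3 / ε := by
  have hp' : (0 : ℝ) < p := by exact_mod_cast hp
  have hq : 0 < q := by
    -- Division by zero gives 0, so the lower bound on `p/q` excludes `q = 0`.
    rcases Nat.eq_zero_or_pos q with rfl | h
    · simp at h1; linarith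
    · exact h
  have hq' : (0 : ℝ) < q := by exact_mod_cast hq
  have hmod := Nat.div_add_mod (q + p - 1) p
  have hlt := Nat.mod_lt (q + p - 1) hp
  rw [mul_comm] at hmod
  set e := (q + p - 1) / p with he
  have g1 : q ≤ e * p := by omega
  have g2 : e * p < q + p := by omega
  have g1' : (q : ℝ) ≤ e * p := by exact_mod_cast g1
  have g2' : (e : ℝ) * p < q + p := by exact_mod_cast g2
  rw [div_le_iff₀ hq'] at h2
  rw [le_div_iff₀ hq'] at h1
  refine ⟨e, ?_, g1, g2, ?_, ?_⟩
  · rcases Nat.eq_zero_or_pos e with h | h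
    · rw [h] at g1; omega
    · exact h
  · have : (p : ℝ) ≤ (ε * e) * p := by nlinarith
    exact le_of_mul_le_mul_right (by linarith) hp'
  · rw [le_div_iff₀ hε]
    have : (e : ℝ) * ε * p ≤ 3 * p := by nlinarith
    exact le_of_mul_le_mul_right this hp'

lemma sample_le {e c : ℕ} {ε : ℝ} (he : (e : ℝ) ≤ 3 / ε) :
    ((c * e ^ 3 : ℕ) : ℝ) ≤ 27 * c * (1 / ε) ^ 3 := by
  have : (e : ℝ) ^ 3 ≤ (3 / ε) ^ 3 := pow_le_pow_left₀ (by positivity) he 3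
  push_cast
  calc (c : ℝ) * (e : ℝ) ^ 3 ≤ c * (3 / ε) ^ 3 := by gcongr
    _ = 27 * c * (1 / ε) ^ 3 := by ring

lemma natCast_le_softCube {a b c e : ℕ} {ε : ℝ} (hε : 0 < ε) (hε1 : ε < 1) (he : (e : ℝ) ≤ 3 / ε) :
    ((a + b * (c * e ^ 3) : ℕ) : ℝ) ≤ softCube (a + 27 * b * c) 0 ε := by
  have h1 := sample_le (c := c) he
  have h2 : (1 : ℝ) ≤ (1 / ε) ^ 3 := one_le_pow₀ (by rw [le_div_iff₀ hε]; linarith)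
  rw [softCube, pow_zero, mul_one, Nat.cast_add, Nat.cast_mul]
  have h3 : (b : ℝ) * ((c * e ^ 3 : ℕ) : ℝ) ≤ b * (27 * c * (1 / ε) ^ 3) := by gcongr
  have h4 : (a : ℝ) * 1 ≤ a * (1 / ε) ^ 3 := by gcongr
  calc (a : ℝ) + b * ((c * e ^ 3 : ℕ) : ℝ) ≤ a * (1 / ε) ^ 3 + b * (27 * c * (1 / ε) ^ 3) := by
        linarith
    _ = _ := by ring

/-- A bound for the parameters of the search, apart from the number of all samples. -/
def paramBound (m N : ℕ) : ℕ := (8 * 2 ^ m * N) ^ 2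

lemma two_pow_le_paramBound {m N : ℕ} (hN : 2 ≤ N) : 2 ^ m ≤ paramBound m N := by
  have h1 : 2 ^ m ≤ 8 * 2 ^ m * N := by nlinarith [Nat.one_le_two_pow (n := m)]
  exact h1.trans (Nat.le_self_pow (by decide) _)

/-- With `m = c e³` one has `e ≤ m < 2^m`, so the number serving as infinity is at most `8 * 2^m *
N`; the square accounts for the number of rounds. -/
lemma big_le_paramBound {c e n N : ℕ} (hc : 1 ≤ c) (hN : 2 ≤ N) (hn : n ≤ N) :
    (n + 6 * e + 1) * (n + 6 * e + 1) ≤ paramBound (c * e ^ 3) N := by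
  set m := c * e ^ 3 with hm
  have h1 : e ≤ m := (Nat.le_self_pow (by decide) e).trans (Nat.le_mul_of_pos_left _ hc)
  have h2 : m < 2 ^ m := Nat.lt_two_pow_self
  have h3 : N ≤ 2 ^ m * N := Nat.le_mul_of_pos_left _ (by omega)
  have h4 : 2 ^ m * 2 ≤ 2 ^ m * N := Nat.mul_le_mul_left _ hN
  rw [paramBound, sq]
  have h5 : n + 6 * e + 1 ≤ 8 * 2 ^ m * N := by rw [mul_assoc]; omega
  exact Nat.mul_le_mul h5 h5

lemma one_le_paramBound {m N : ℕ} (hN : 2 ≤ N) : 1 ≤ paramBound m N :=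
  Nat.one_le_two_pow.trans (two_pow_le_paramBound hN)

/-- The constant 84 is `12 + 6 * 12`: one factor 2 from the added 1 and a factor `8²` in each of the
twelve powers. -/
lemma time_le_randomized (F m N : ℕ) (hN : 2 ≤ N) :
    F * (paramBound m N + 1) ^ 12 ≤ 2 ^ (F + 84 + 24 * m) * N ^ 24 := by
  have h1 := one_le_paramBound (m := m) hN
  calc F * (paramBound m N + 1) ^ 12 ≤ 2 ^ F * (2 * paramBound m N) ^ 12 :=
        Nat.mul_le_mul Nat.lt_two_pow_self.le (Nat.pow_le_pow_left (by omega) 12)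
    _ = 2 ^ (F + 84 + 24 * m) * N ^ 24 := by
        rw [paramBound, pow_add, pow_add, mul_comm 24 m, pow_mul]
        ring

/-- As `N ≥ 2`, powers of two become powers of `N`; this is where `n` has to be read as at least 2.
-/
lemma time_le_deterministic (F m N : ℕ) (hN : 2 ≤ N) :
    F * (paramBound m N * N ^ m + 1) ^ 12 ≤ N ^ (F + 108 + 36 * m) := by
  have h1 := one_le_paramBound (m := m) hN
  have h2 : 1 ≤ N ^ m := Nat.one_le_pow _ _ (by omega)
  have h3 : 1 ≤ paramBound m N * N ^ m := Nat.mul_le_mul h1 h2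
  have h4 : ∀ k, 2 ^ k ≤ N ^ k := fun k => Nat.pow_le_pow_left hN k
  have h5 : paramBound m N * 2 ≤ N ^ (9 + 2 * m) := by
    calc paramBound m N * 2 = 2 ^ 7 * (2 ^ m) ^ 2 * N ^ 2 := by rw [paramBound]; ring
      _ ≤ N ^ 7 * (N ^ m) ^ 2 * N ^ 2 := by
          gcongr
      _ = N ^ (9 + 2 * m) := by rw [pow_add, mul_comm 2 m, pow_mul]; ring
  calc F * (paramBound m N * N ^ m + 1) ^ 12 ≤ 2 ^ F * (2 * (paramBound m N * N ^ m)) ^ 12 :=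
        Nat.mul_le_mul Nat.lt_two_pow_self.le (Nat.pow_le_pow_left (by omega) 12)
    _ ≤ N ^ F * (N ^ (9 + 2 * m) * N ^ m) ^ 12 := by
        refine Nat.mul_le_mul (h4 F) (Nat.pow_le_pow_left ?_ 12)
        calc 2 * (paramBound m N * N ^ m) = paramBound m N * 2 * N ^ m := by ring
          _ ≤ N ^ (9 + 2 * m) * N ^ m := Nat.mul_le_mul_right _ h5
    _ = N ^ (F + 108 + 36 * m) := by
        rw [← pow_add, ← pow_mul, ← pow_add]; congr 1; ring

/-- Losing `1/e` of the optimum is losing at most a proportion `ε` of it. -/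
lemma approximation {e a b : ℕ} {ε : ℝ} (he : 1 ≤ e) (hε : 1 ≤ ε * e) (h : e * a ≤ e * b + a) :
    (1 - ε) * (a : ℝ) ≤ b := by
  have h1 : (e : ℝ) * a ≤ e * b + a := by exact_mod_cast h
  have h2 : (0 : ℝ) < e := by exact_mod_cast he
  have h3 : (0 : ℝ) ≤ a := Nat.cast_nonneg a
  have h4 : (e : ℝ) * ((1 - ε) * a) ≤ e * b := by nlinarith
  exact le_of_mul_le_mul_left h4 h2

/-- The probability that a random sample is not good enough. -/
theorem exists_random_sample {n d e M t T : ℕ} {β η : ℝ} (G : SimpleGraph (Fin n)) [DecidableRel G.Adj]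
    (hn : 0 < n) (hd : G.nbhdVCDim ≤ d) (S : Finset (Fin n)) (hβ : 0 < β) (hS : β * n ≤ #S)
    (he : 1 ≤ e) (ht : (2 : ℝ) ^ t * Real.exp (-(β / (24 * e ^ 2) / 2 * M)) ≤ 1 / 2)
    (hη : 2 * (2 * (M : ℝ) + 1) ^ d ≤ η * 2 ^ t) (hT : M * Nat.clog 2 n ≤ T) :
    (1 - η) * (2 : ℝ) ^ T ≤ (Nat.card {w : Fin T → Bool //
      ∀ v, #S < 12 * e ^ 2 * #(S.filter fun u => G.Adj v u) →
        ∃ i < M, ∃ u ∈ S, G.Adj v u ∧ bitVal (fun j => (List.ofFn w).getD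
          ((M - 1 - i) * Nat.clog 2 n + j) false) (Nat.clog 2 n) = u} : ℝ) := by
  classical
  set L := Nat.clog 2 n with hL
  -- Uniform vertices cannot be drawn with fair coins, so the samples are binary words of length
  -- `⌈log₂ n⌉`. There are at most `2n` of them, and every vertex has a code.
  let U := Fin L → Bool
  let val : U → ℕ := fun b => bitVal (fun j => if h : j < L then b ⟨j, h⟩ else false) L
  have hnL : n ≤ 2 ^ L := Nat.le_pow_clog (by decide) n
  have hval : ∀ u : Fin n, ∃ b, val b = u := fun u => by
    obtain ⟨f, hf⟩ := exists_bitVal (L := L) (u := u) (u.2.trans_le hnL)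
    refine ⟨fun j => f j, ?_⟩
    rw [← hf]
    exact bitVal_congr fun j hj => by rw [dif_pos hj]
  have hcardU : Fintype.card U = 2 ^ L := by simp [U]
  have hU : Fintype.card U ≤ 2 * n := by
    rw [hcardU]
    rcases Nat.eq_zero_or_pos L with h | h
    · rw [h]; omega
    · have h1 : 2 ^ (L - 1) < n := (Nat.lt_clog_iff_pow_lt (by decide)).1 (by omega)
      obtain ⟨k, hk⟩ : ∃ k, L = k + 1 := ⟨L - 1, by omega⟩
      rw [hk, Nat.add_sub_cancel] at h1
      rw [hk, pow_succ]
      omega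
  have hbad := card_bad_samples_le G hd S hβ hS val hval hU he ht hη
  set Bad : Finset (Fin M → U) := {A : Fin M → U | ∃ v : Fin n,
    #S < 12 * e ^ 2 * #{u ∈ S | G.Adj v u} ∧ ∀ k, ∀ u ∈ S, G.Adj v u → val (A k) ≠ u} with hBad
  -- The coin that gives binary digit `x.2` of member `x.1`; blocks are reversed because the program
  -- fills the sample downwards.
  let ι : Fin M × Fin L → Fin T := fun x => Fin.castLE hT (finProdFinEquiv (x.1.rev, x.2))
  have hι : Function.Injective ι := fun x y hxy => by
    have h := finProdFinEquiv.injective (Fin.castLE_injective hT hxy)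
    rw [Prod.mk.injEq] at h
    exact Prod.ext (Fin.rev_injective h.1) h.2
  let A : (Fin T → Bool) → Fin M → U := fun w i j => w (ι (i, j))
  have hcount := card_filter_mul_two_pow_le hι A (fun w w' h k => congrFun (congrFun h k.1) k.2) Bad
  have hprob : (#{w | A w ∈ Bad} : ℝ) ≤ η * 2 ^ T := by
    have h1 : (#{w | A w ∈ Bad} : ℝ) * 2 ^ (M * L) ≤ #Bad * 2 ^ T := by
      rw [Fintype.card_prod, Fintype.card_fin, Fintype.card_fin] at hcount
      exact_mod_cast hcount
    rw [hcardU] at hbad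
    push_cast at hbad
    rw [← pow_mul, mul_comm L M] at hbad
    have h2 : (#Bad : ℝ) * 2 ^ T ≤ η * 2 ^ (M * L) * 2 ^ T := by gcongr
    have h3 : (0 : ℝ) < 2 ^ (M * L) := by positivity
    refine le_of_mul_le_mul_right ?_ h3
    calc _ ≤ _ := h1
      _ ≤ _ := h2
      _ = _ := by ring
  have hsum := card_filter_add_card_filter_not (s := (univ : Finset (Fin T → Bool)))
    fun w => A w ∈ Bad
  rw [card_univ, Fintype.card_fun, Fintype.card_bool, Fintype.card_fin] at hsum
  have hsum' : (#{w | A w ∈ Bad} : ℝ) + #{w | ¬ A w ∈ Bad} = 2 ^ T := by exact_mod_cast hsum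
  have hgood : #{w | ¬ A w ∈ Bad} ≤ Nat.card {w : Fin T → Bool //
      ∀ v, #S < 12 * e ^ 2 * #(S.filter fun u => G.Adj v u) →
        ∃ i < M, ∃ u ∈ S, G.Adj v u ∧ bitVal (fun j => (List.ofFn w).getD
          ((M - 1 - i) * L + j) false) L = u} := by
    rw [Nat.card_eq_fintype_card, Fintype.card_subtype]
    refine card_le_card fun w hw => ?_
    rw [mem_filter] at hw ⊢
    refine ⟨mem_univ _, fun v hv => ?_⟩
    by_contra hno
    refine hw.2 (mem_filter.2 ⟨mem_univ _, v, hv, fun k u hu hvu hk => hno ?_⟩)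
    refine ⟨k, k.2, u, hu, hvu, ?_⟩
    rw [← hk]
    refine bitVal_congr fun j hj => ?_
    rw [dif_pos hj]
    have hval : ((ι (k, ⟨j, hj⟩) : Fin T) : ℕ) = (M - 1 - k) * L + j := by
      simp only [ι, Fin.val_castLE, finProdFinEquiv_apply_val, Fin.val_rev]
      rw [show M - (k + 1) = M - 1 - k by omega, mul_comm, add_comm]
    rw [← hval, List.getD_eq_getElem _ _ (by simp), List.getElem_ofFn]
  have hgood' : (#{w | ¬ A w ∈ Bad} : ℝ) ≤ _ := Nat.cast_le.2 hgood
  linarith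

/-- Some sample is good enough. -/
theorem exists_sample {n d e M t : ℕ} {β : ℝ} (G : SimpleGraph (Fin n)) [DecidableRel G.Adj]
    (hd : G.nbhdVCDim ≤ d) (S : Finset (Fin n)) (hβ : 0 < β) (hS : β * n ≤ #S)
    (he : 1 ≤ e) (ht : (2 : ℝ) ^ t * Real.exp (-(β / (24 * e ^ 2) / 2 * M)) ≤ 1 / 2)
    (hη : 2 * (2 * (M : ℝ) + 1) ^ d ≤ 1 / 2 * 2 ^ t) (hn : 0 < n) :
    ∃ A : Fin M → Fin n, ∀ v, #S < 12 * e ^ 2 * #(S.filter fun u => G.Adj v u) →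
      ∃ i, A i ∈ S ∧ G.Adj v (A i) := by
  classical
  -- If no sample were good, all samples would be bad, but at most half of them are.
  by_contra! hno
  have hbad := card_bad_samples_le G hd S hβ hS (fun b : Fin n => (b : ℕ)) (fun u => ⟨u, rfl⟩)
    (by simp; omega) he ht hη
  rw [filter_true_of_mem (fun A _ => ?_), card_univ, Fintype.card_fun, Fintype.card_fin,
    Fintype.card_fin] at hbad
  · have h1 : (0 : ℝ) < (n : ℝ) ^ M := by positivity
    push_cast at hbad
    linarith
  · obtain ⟨v, hv, h⟩ := hno A
    refine ⟨v, hv, fun k u hu hvu hk => ?_⟩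
    have : A k = u := Fin.ext hk
    exact h k (this ▸ hu) (this ▸ hvu)

end Prog

end RAM


/-! ### The two algorithms. -/

theorem theorem3 (d : ℕ) (β : ℝ) (hβ0 : 0 < β) (hβ1 : β ≤ 1) :
    -- randomized: time `2 ^ Õ(1/ε³) * n ^ O(1)`, any constant failure probability `η`
    (∀ η : ℝ, 0 < η →
      ∃ (P : RAM.Cmd) (C : ℝ) (k c : ℕ),
        ∀ ε : ℝ, 0 < ε → ε < 1 →
        ∀ p q : ℕ, 0 < p → ε / 2 ≤ (p : ℝ) / (q : ℝ) → (p : ℝ) / (q : ℝ) ≤ ε →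
        ∀ (n : ℕ) (G : SimpleGraph (Fin n)), G.InClassX d β 1 →
        ∃ T : ℕ,
          (T : ℝ) ≤ (2 : ℝ) ^ (softCube C k ε) * ((max n 2 : ℕ) : ℝ) ^ c ∧
          (∀ w : Fin T → Bool,
            (P.run (RAM.input G p q (List.ofFn w)) T).Halted ∧
            G.IsIndepSet
              ((P.run (RAM.input G p q (List.ofFn w)) T).output n : Set (Fin n))) ∧
          (1 - η) * (2 : ℝ) ^ T ≤
            (Nat.card {w : Fin T → Bool //
              (1 - ε) * (G.indepNum : ℝ) ≤
                (((P.run (RAM.input G p q (List.ofFn w)) T).output n).card : ℝ)} : ℝ)) ∧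
    -- deterministic: time `n ^ Õ(1/ε³)`
    (∃ (P : RAM.Cmd) (C : ℝ) (k : ℕ),
      P.CoinFree ∧
        ∀ ε : ℝ, 0 < ε → ε < 1 →
        ∀ p q : ℕ, 0 < p → ε / 2 ≤ (p : ℝ) / (q : ℝ) → (p : ℝ) / (q : ℝ) ≤ ε →
        ∀ (n : ℕ) (G : SimpleGraph (Fin n)), G.InClassX d β 1 →
        ∃ T : ℕ,
          (T : ℝ) ≤ ((max n 2 : ℕ) : ℝ) ^ (softCube C k ε) ∧
          (P.run (RAM.input G p q []) T).Halted ∧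
          G.IsIndepSet ((P.run (RAM.input G p q []) T).output n : Set (Fin n)) ∧
          (1 - ε) * (G.indepNum : ℝ) ≤
            (((P.run (RAM.input G p q []) T).output n).card : ℝ)) := by
  classical
  have hindep : ∀ {n : ℕ} (G : SimpleGraph (Fin n)), ∃ S : Finset (Fin n),
      G.IsIndepSet (S : Set (Fin n)) ∧ S.card = G.indepNum := fun G => by
    obtain ⟨S, hS⟩ := G.exists_isNIndepSet_indepNum
    exact ⟨S, hS.isIndepSet, hS.card_eq⟩
  constructor
  · intro η hη
    obtain ⟨c, hc, hsample⟩ := exists_sample_factor d hβ0 hη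
    -- The exponent `F + 84 + 24 m` with `m ≤ 27 c / ε³` gives `C`. No logarithmic factor arises, so
    -- `k = 0`.
    refine ⟨RAM.Prog.randomized c,
      (RAM.Prog.randomizedFactor + 84 : ℕ) + 27 * (24 : ℕ) * c, 0, 24, fun ε hε hε1 p q hp hpq hpq' n G hG => ?_⟩
    obtain ⟨e, he, hq, hq', hεe, heε⟩ := RAM.Prog.exists_precision hε hε1 hp hpq hpq'
    obtain ⟨t, ht, hηt⟩ := hsample e he
    obtain ⟨hGd, hGβ, hGi⟩ := hG
    rw [Fintype.card_fin] at hGβ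
    set N := max n 2 with hN
    have hN2 : 2 ≤ N := le_max_right _ _
    set X := RAM.Prog.paramBound (c * e ^ 3) N with hX
    set F := RAM.Prog.randomizedFactor with hF
    -- `T` is both the time bound and the number of coins supplied; by then the program has halted
    -- whatever the coins are.
    set T := F * (X + 1) ^ 12 with hT
    have hfill : RAM.Prog.fillSample.size * (X + 1) ^ 12 ≤ T :=
      Nat.mul_le_mul_right _ (by rw [hF, RAM.Prog.randomizedFactor]; omega)
    have hspec := fun w : Fin T → Bool => RAM.Prog.randomized_spec G hc hp hq hq'
      (l := List.ofFn w) (RAM.Prog.two_pow_le_paramBound hN2)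
      (RAM.Prog.big_le_paramBound hc hN2 (le_max_left _ _)) (by rw [List.length_ofFn]; exact hfill)
    choose hlen s' hrun hind happrox using hspec
    have hrun' : ∀ w : Fin T → Bool, (RAM.Prog.randomized c).run (RAM.input G p q (List.ofFn w)) T =
        ⟨[], s' w⟩ := fun w => by
      obtain ⟨t, ht, h⟩ := hrun w
      exact h.halted ht
    obtain ⟨S, hS, hSα⟩ := hindep G
    have hgood : ∀ w : Fin T → Bool,
        (∀ v, S.card < 12 * e ^ 2 * (S.filter fun u => G.Adj v u).card →
          ∃ i < c * e ^ 3, ∃ u ∈ S, G.Adj v u ∧ RAM.Prog.bitVal (fun j => (List.ofFn w).getD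
            ((c * e ^ 3 - 1 - i) * Nat.clog 2 n + j) false) (Nat.clog 2 n) = u) →
        (1 - ε) * (G.indepNum : ℝ) ≤ (RAM.Prog.fset n 1 (s' w)).card := fun w hw => by
      rw [← hSα]
      exact RAM.Prog.approximation he hεe (happrox w hGi he S hS hw)
    clear_value T
    refine ⟨T, ?_, fun w => ?_, ?_⟩
    · have h1 : (T : ℝ) ≤ (2 : ℝ) ^ (F + 84 + 24 * (c * e ^ 3)) * (N : ℝ) ^ 24 := by
        rw [hT]
        exact_mod_cast RAM.Prog.time_le_randomized F (c * e ^ 3) N hN2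
      refine h1.trans ?_
      gcongr
      rw [← Real.rpow_natCast 2]
      exact Real.rpow_le_rpow_of_exponent_le (by norm_num)
        (RAM.Prog.natCast_le_softCube (a := F + 84) (b := 24) hε hε1 heε)
    · rw [hrun' w]
      exact ⟨rfl, hind w⟩
    · simp only [hrun']
      -- The empty graph has nothing to sample from, but also optimum 0.
      rcases Nat.eq_zero_or_pos n with rfl | hn
      · refine le_card_of_forall hη fun w => ?_
        rw [← hSα, Finset.eq_empty_of_isEmpty S, Finset.card_empty, Nat.cast_zero, mul_zero]
        exact Nat.cast_nonneg _
      · refine (RAM.Prog.exists_random_sample (T := T) G hn hGd S hβ0 (by rw [hSα]; exact hGβ) he ht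
          hηt ?_).trans (card_le_card_of_imp hgood)
        have := hlen fun _ => false
        rwa [List.length_ofFn] at this
  -- Any failure probability below 1 shows that a good sample exists.
  · obtain ⟨c, hc, hsample⟩ := exists_sample_factor d hβ0 (show (0 : ℝ) < 1 / 2 by norm_num)
    refine ⟨RAM.Prog.deterministic c,
      (RAM.Prog.deterministicFactor + 108 : ℕ) + 27 * (36 : ℕ) * c, 0, RAM.Prog.deterministic_coinFree c,
      fun ε hε hε1 p q hp hpq hpq' n G hG => ?_⟩
    obtain ⟨e, he, hq, hq', hεe, heε⟩ := RAM.Prog.exists_precision hε hε1 hp hpq hpq'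
    obtain ⟨t, ht, hηt⟩ := hsample e he
    obtain ⟨hGd, hGβ, hGi⟩ := hG
    rw [Fintype.card_fin] at hGβ
    set N := max n 2 with hN
    have hN2 : 2 ≤ N := le_max_right _ _
    have hNm : 1 ≤ N ^ (c * e ^ 3) := Nat.one_le_pow _ _ (by omega)
    set X := RAM.Prog.paramBound (c * e ^ 3) N * N ^ (c * e ^ 3) with hX
    have hle : RAM.Prog.paramBound (c * e ^ 3) N ≤ X := Nat.le_mul_of_pos_right _ hNm
    set F := RAM.Prog.deterministicFactor with hF
    obtain ⟨s', ⟨k, hk, hrun⟩, hind, happrox⟩ := RAM.Prog.deterministic_spec G hc hp hq hq'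
      ((RAM.Prog.two_pow_le_paramBound hN2).trans hle)
      ((RAM.Prog.big_le_paramBound hc hN2 (le_max_left _ _)).trans hle)
      ((Nat.pow_le_pow_left (le_max_left n 2) _).trans
        (Nat.le_mul_of_pos_left _ (RAM.Prog.one_le_paramBound hN2)))
    obtain ⟨S, hS, hSα⟩ := hindep G
    refine ⟨F * (X + 1) ^ 12, ?_, ?_⟩
    · have h1 : ((F * (X + 1) ^ 12 : ℕ) : ℝ) ≤ (N : ℝ) ^ (F + 108 + 36 * (c * e ^ 3)) := by
        exact_mod_cast RAM.Prog.time_le_deterministic F (c * e ^ 3) N hN2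
      refine h1.trans ?_
      rw [← Real.rpow_natCast (N : ℝ)]
      exact Real.rpow_le_rpow_of_exponent_le (by exact_mod_cast (by omega : 1 ≤ N))
        (RAM.Prog.natCast_le_softCube (a := F + 108) (b := 36) hε hε1 heε)
    · rw [hrun.halted hk]
      refine ⟨rfl, hind, ?_⟩
      change (1 - ε) * (G.indepNum : ℝ) ≤ (RAM.Prog.fset n 1 s').card
      rw [← hSα]
      rcases Nat.eq_zero_or_pos n with rfl | hn
      · have hS0 : S.card = 0 := by rw [Finset.card_eq_zero]; exact Finset.eq_empty_of_isEmpty S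
        rw [hS0]; simp
      · exact RAM.Prog.approximation he hεe (happrox hGi he S hS
          (RAM.Prog.exists_sample G hGd S hβ0 (by rw [hSα]; exact hGβ) he ht hηt hn))
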